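/- Let $\widehat{\mathbb C}$ be the Riemann sphere. A Kleinian group is a group of Möbius transformations whose region of discontinuity (the set of points having a neighbourhood that meets only finitely many of its translates) is nonempty. Let $G$ be a finitely generated Kleinian group with region of discontinuity $\Omega(G)$ and let $\Delta\neq\emptyset$ be a $G$-invariant union of connected components of $\Omega(G)$. Let $L^\infty(\Delta,G)$ be the space of $\mu\in L^\infty(\Delta)$ (extended by $0$ to $\widehat{\mathbb C}$) such that for every $g\in G$, $\mu(g(z))\overline{g'(z)}=\mu(z)g'(z)$ a.e. on $\Delta$, let $L^\infty(\Delta,G)_1$ be its open unit ball, and let $\overline{L^\infty(\Delta,G)_1}$ be the closure of this ball in $L^\infty(\Delta,G)$. For $\mu\in\overline{L^\infty(\Delta,G)_1}$ let $\Omega(\mu)$ be the open set of points $p\in\widehat{\mathbb C}$ having an open neighbourhood $U$ with $\|\mu|_U\|_\infty<1$, and let $\Lambda(\mu)=\widehat{\mathbb C}\setminus\Omega(\mu)$. For $\|\nu\|_\infty<1$, a quasiconformal homeomorphism with dilatation $\nu$ is an orientation-preserving homeomorphism $v$ of $\widehat{\mathbb C}$ with distributional derivatives in $L^2_{loc}$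 and $\bar\partial v=\nu\,\partial v$ a.e. A map $w:\Omega(\mu)\to\widehat{\mathbb C}$, orientation preserving and with distributional derivatives in $L^2_{loc}(\Omega(\mu))$, is called a noded quasiconformal map with dilatation $\mu$ if (i) some component of $\Omega(\mu)$ is mapped by $w$ homeomorphically onto its image; (ii) $\bar\partial w=\mu\,\partial w$ a.e. in $\Omega(\mu)$; (iii) there are $\mu_n\in L^\infty(\Delta,G)_1$ converging to $\mu$ a.e. in $\Omega(\mu)$; and (iv) there are quasiconformal homeomorphisms $w_n$ of $\widehat{\mathbb C}$ with dilatations $\mu_n$ converging to $w$ locally uniformly in $\Omega(\mu)$. A noded family of arcs associated with $\mu$ is a countable (possibly finite or empty) collection $\mathcal F=\{\alpha_1,\alpha_2,\dots\}$ of pairwise disjoint simple arcs, including end points, such that: (1) each $\alpha_n$ minus its end points lies in $\Delta$; (2) the spherical diameter of $\alpha_n$ tends to $0$; (3) $\Lambda(\mu)=\overline{\bigcup_n\alpha_n}$; (4) $\Omega(\mu)$ is dense in $\widehat{\mathbb C}$; (5) for each $n$ the stabilizer $\{g\in G: g(\alpha_n)=\alpha_n\}$ is a cyclic group generated by a loxodromic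 transformation or a $\mathbb Z_2$-extension of such a group. A noded quasiconformal deformation of $G$ with dilatation $\mu$ is a continuous map $w:\widehat{\mathbb C}\to\widehat{\mathbb C}$ for which there is a noded family of arcs $\mathcal F$ associated with $\mu$ such that $w$ is injective on $\widehat{\mathbb C}\setminus\bigcup_n\alpha_n$, the restriction of $w$ to $\Omega(\mu)$ is a noded quasiconformal map with dilatation $\mu$, and $w$ is equal to a constant $p_n$ on each $\alpha_n$, with $p_n\ne p_m$ for $n\neq m$. If such a $w$ exists, $\mu\in\overline{L^\infty(\Delta,G)_1}$ is called a noded Beltrami coefficient for $G$ supported in $\Delta$. Theorem. Let $\mu$ be a noded Beltrami coefficient for $G$ supported in $\Delta$ and let $w$ be a noded quasiconformal deformation of $G$ with dilatation $\mu$. Then there are a unique Kleinian group $\theta(G)$ of Möbius transformations and a unique isomorphism of groups $\theta:G\to\theta(G)$ such that $w\circ g=\theta(g)\circ w$ for all $g\in G$. Moreover, the region of discontinuity of $\theta(G)$ acting on $\widehat{\mathbb C}$ is $w(\Omega(\mu)\cap\Omega(G))$. -/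

import Mathlib

open MeasureTheory Topology Filter
open scoped Pointwise ENNReal

noncomputable section

namespace NodedQC

/-! ### The Riemann sphere and Kleinian groups -/

/-- The Riemann sphere `ℂ ∪ {∞}`. -/
abbrev Sphere : Type := OnePoint ℂ

/-- The group of Möbius transformations, as a group of permutations of the sphere: the image of
`GL(2, ℂ)` under its action by fractional linear transformations. -/
def moebiusGroup : Subgroup (Equiv.Perm Sphere) :=
  (MulAction.toPermHom (Matrix.GeneralLinearGroup (Fin 2) ℂ) Sphere).range

/-- The region of discontinuity of a group `Γ` of permutations of the sphere: the points that have
an open neighbourhood meeting only finitely many of its translates. -/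
def regionOfDiscontinuity (Γ : Subgroup (Equiv.Perm Sphere)) : Set Sphere :=
  {x | ∃ U : Set Sphere, IsOpen U ∧ x ∈ U ∧ {g | g ∈ Γ ∧ ((g '' U) ∩ U).Nonempty}.Finite}

/-- A Kleinian group: a group of Möbius transformations that acts discontinuously somewhere on the
sphere (in particular it is discrete). -/
def IsKleinian (Γ : Subgroup (Equiv.Perm Sphere)) : Prop :=
  Γ ≤ moebiusGroup ∧ (regionOfDiscontinuity Γ).Nonempty

/-- `Δ` is a nonempty `G`-invariant union of connected components of the region of discontinuity. -/
structure IsInvariantCollection (G : Subgroup (Equiv.Perm Sphere)) (Δ : Set Sphere) : Prop where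
  nonempty : Δ.Nonempty
  subset : Δ ⊆ regionOfDiscontinuity G
  component : ∀ x ∈ Δ, connectedComponentIn (regionOfDiscontinuity G) x ⊆ Δ
  invariant : ∀ g ∈ G, g '' Δ = Δ

/-- Loxodromic (including hyperbolic) transformations: those conjugate by a Möbius transformation
to `z ↦ k z` with `|k| > 1`. -/
def IsLoxodromic (g : Equiv.Perm Sphere) : Prop :=
  ∃ A ∈ moebiusGroup, ∃ k : ℂ, 1 < ‖k‖ ∧
    ∀ z : ℂ, (A * g * A⁻¹) (z : Sphere) = ((k * z : ℂ) : Sphere)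

/-- A cyclic group generated by a loxodromic transformation. -/
def IsCyclicLoxodromic (H : Subgroup (Equiv.Perm Sphere)) : Prop :=
  ∃ g, IsLoxodromic g ∧ H = Subgroup.zpowers g

/-- A cyclic loxodromic group or a `ℤ/2`-extension of one (that is, a group having a cyclic
loxodromic subgroup of index two). -/
def IsCyclicLoxodromicOrExtension (H : Subgroup (Equiv.Perm Sphere)) : Prop :=
  IsCyclicLoxodromic H ∨ ∃ C ≤ H, IsCyclicLoxodromic C ∧ C.relIndex H = 2

/-- The stereographic identification of the Riemann sphere with the unit sphere of `ℝ³`. -/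
def stereo (x : Sphere) : EuclideanSpace ℝ (Fin 3) :=
  x.elim !₂[0, 0, 1] fun z =>
    !₂[2 * z.re / (1 + ‖z‖ ^ 2), 2 * z.im / (1 + ‖z‖ ^ 2), (‖z‖ ^ 2 - 1) / (1 + ‖z‖ ^ 2)]

/-- The diameter of a subset of the Riemann sphere, seen in the unit sphere of `ℝ³`. -/
def sphericalDiam (s : Set Sphere) : ℝ :=
  Metric.diam (stereo '' s)

/-- Locally uniform convergence on `U`, for the spherical metric, of maps into the sphere. -/
def TendstoLocallyUniformlySphere (F : ℕ → Sphere → Sphere) (f : Sphere → Sphere)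
    (U : Set Sphere) : Prop :=
  TendstoLocallyUniformlyOn (fun n x => stereo (F n x)) (fun x => stereo (f x)) atTop U

/-! ### Charts -/

/-- The affine coordinate on the sphere (with a junk value at `∞`). -/
def affine (x : Sphere) : ℂ := x.elim 0 id

/-- The inversion `z ↦ 1 / z` of the sphere. -/
def inversion (x : Sphere) : Sphere :=
  x.elim ((0 : ℂ) : Sphere) fun z => if z = 0 then OnePoint.infty else ((z⁻¹ : ℂ) : Sphere)

/-- The two coordinate changes defining the complex structure of the sphere. -/
def charts : Set (Sphere → Sphere) := {id, inversion}

/-- The expression of `w` in the chart `κ` of the source and the chart `τ` of the target. -/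
def inCharts (κ τ : Sphere → Sphere) (w : Sphere → Sphere) (z : ℂ) : ℂ :=
  affine (τ (w (κ (z : Sphere))))

/-- The set on which `inCharts κ τ w` is the genuine local expression of `w : U → Sphere`. -/
def chartDomain (U : Set Sphere) (κ τ : Sphere → Sphere) (w : Sphere → Sphere) : Set ℂ :=
  {z | κ (z : Sphere) ∈ U ∧ τ (w (κ (z : Sphere))) ≠ OnePoint.infty}

/-! ### Orientation -/

/-- On all small circles around `z`, traversed once counterclockwise, `f` winds exactly once
counterclockwise around `f z`; `φ` is a continuous logarithm of `f - f z` along the circle. -/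
def WindsOnceAt (f : ℂ → ℂ) (z : ℂ) : Prop :=
  ∀ᶠ r : ℝ in 𝓝[>] 0, ∃ φ : ℝ → ℂ, Continuous φ ∧
    (∀ t : ℝ, f (z + r * Complex.exp (t * Complex.I)) - f z = Complex.exp (φ t)) ∧
    φ (2 * Real.pi) - φ 0 = 2 * Real.pi * Complex.I

/-- `w` preserves the orientation on `U`: in the charts of the sphere it has local degree one at
every point near which it is injective. -/
def IsOrientationPreservingOn (U : Set Sphere) (w : Sphere → Sphere) : Prop :=
  ∀ κ ∈ charts, ∀ τ ∈ charts, ∀ z ∈ chartDomain U κ τ w,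
    (∃ N ∈ 𝓝 z, Set.InjOn (inCharts κ τ w) N) → WindsOnceAt (inCharts κ τ w) z

/-! ### Sobolev maps and the Beltrami equation -/

/-- The derivative `∂φ = (φ_x - i φ_y) / 2`. -/
def dz (φ : ℂ → ℂ) (z : ℂ) : ℂ :=
  (fderiv ℝ φ z 1 - Complex.I * fderiv ℝ φ z Complex.I) / 2

/-- The derivative `∂̄φ = (φ_x + i φ_y) / 2`. -/
def dzbar (φ : ℂ → ℂ) (z : ℂ) : ℂ :=
  (fderiv ℝ φ z 1 + Complex.I * fderiv ℝ φ z Complex.I) / 2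

/-- On the open set `V`, the function `f` has distributional derivatives `∂f = a` and `∂̄f = b`,
and these lie in `L²_loc(V)`. -/
structure HasWeakDerivOn (V : Set ℂ) (f a b : ℂ → ℂ) : Prop where
  locallyIntegrable : LocallyIntegrableOn f V
  memLp_dz : ∀ K ⊆ V, IsCompact K → MemLp a 2 (volume.restrict K)
  memLp_dzbar : ∀ K ⊆ V, IsCompact K → MemLp b 2 (volume.restrict K)
  integral_dz : ∀ φ : ℂ → ℂ, ContDiff ℝ (⊤ : ℕ∞) φ → HasCompactSupport φ → tsupport φ ⊆ V →
    ∫ z, f z * dz φ z = -∫ z, a z * φ z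
  integral_dzbar : ∀ φ : ℂ → ℂ, ContDiff ℝ (⊤ : ℕ∞) φ → HasCompactSupport φ → tsupport φ ⊆ V →
    ∫ z, f z * dzbar φ z = -∫ z, b z * φ z

/-- The continuous maps `w : U → Sphere` (`U` open) that have, in the charts of the sphere,
distributional derivatives in `L²_loc`. -/
def MemSobolevLoc (U : Set Sphere) (w : Sphere → Sphere) : Prop :=
  ContinuousOn w U ∧ ∀ κ ∈ charts, ∀ τ ∈ charts, ∃ a b : ℂ → ℂ,
    HasWeakDerivOn (chartDomain U κ τ w) (inCharts κ τ w) a b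

/-- The Beltrami equation `∂̄w = μ ∂w`, almost everywhere on the open set `U` (near the points
where `w` takes the value `∞` it is the equation for `1 / w`). -/
def SolvesBeltrami (U : Set Sphere) (μ : ℂ → ℂ) (w : Sphere → Sphere) : Prop :=
  ∀ τ ∈ charts, ∃ a b : ℂ → ℂ, HasWeakDerivOn (chartDomain U id τ w) (inCharts id τ w) a b ∧
    ∀ᵐ z ∂volume, z ∈ chartDomain U id τ w → b z = μ z * a z

/-! ### Beltrami coefficients -/

/-- The space `L^∞` of the plane, equivalently of the sphere. -/
abbrev LInfSpace : Type := Lp ℂ ⊤ (volume : Measure ℂ)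

/-- `L^∞(Δ, G)`: the elements of `L^∞` vanishing off `Δ` that satisfy
`μ(g(z)) * conj (g'(z)) = μ(z) * g'(z)` almost everywhere on `Δ`, for all `g ∈ G`. -/
def LInf (Δ : Set Sphere) (G : Subgroup (Equiv.Perm Sphere)) : Set LInfSpace :=
  {μ | (∀ᵐ z : ℂ ∂volume, (z : Sphere) ∉ Δ → μ z = 0) ∧
    ∀ g ∈ G, ∀ᵐ z : ℂ ∂volume, (z : Sphere) ∈ Δ →
      μ (inCharts id id g z) * (starRingEnd ℂ) (deriv (inCharts id id g) z) =
        μ z * deriv (inCharts id id g) z}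

/-- The open unit ball of `L^∞(Δ, G)`: the Beltrami coefficients for `G` supported in `Δ`. -/
def LInfBall (Δ : Set Sphere) (G : Subgroup (Equiv.Perm Sphere)) : Set LInfSpace :=
  {μ | μ ∈ LInf Δ G ∧ ‖μ‖ < 1}

/-- The closure of the open unit ball inside `L^∞(Δ, G)`. -/
def LInfBallClosure (Δ : Set Sphere) (G : Subgroup (Equiv.Perm Sphere)) : Set LInfSpace :=
  LInf Δ G ∩ closure (LInfBall Δ G)

/-- The region of discontinuity `Ω(μ)`: the points of the sphere having an open neighbourhood on
which the essential supremum of `|μ|` is less than one. -/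
def coeffRegion (μ : LInfSpace) : Set Sphere :=
  {p | ∃ U : Set Sphere, IsOpen U ∧ p ∈ U ∧
    eLpNorm μ ⊤ (volume.restrict ((fun z : ℂ => (z : Sphere)) ⁻¹' U)) < 1}

/-- The limit set `Λ(μ)`. -/
def coeffLimitSet (μ : LInfSpace) : Set Sphere := (coeffRegion μ)ᶜ

/-! ### Noded quasiconformal maps and deformations -/

/-- `w` is a quasiconformal homeomorphism of the sphere with complex dilatation `μ`. -/
structure IsQuasiconformal (μ : LInfSpace) (w : Sphere ≃ₜ Sphere) : Prop where
  norm_lt_one : ‖μ‖ < 1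
  orientation : IsOrientationPreservingOn Set.univ w
  sobolev : MemSobolevLoc Set.univ w
  beltrami : SolvesBeltrami Set.univ μ w

/-- The restriction of `w` to `Ω(μ)` is a noded quasiconformal map with dilatation `μ`. -/
structure IsNodedQuasiconformalMap (Δ : Set Sphere) (G : Subgroup (Equiv.Perm Sphere))
    (μ : LInfSpace) (w : Sphere → Sphere) : Prop where
  sobolev : MemSobolevLoc (coeffRegion μ) w
  orientation : IsOrientationPreservingOn (coeffRegion μ) w
  embedding : ∃ x ∈ coeffRegion μ,
    IsEmbedding ((connectedComponentIn (coeffRegion μ) x).domRestrict w)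
  beltrami : SolvesBeltrami (coeffRegion μ) μ w
  approx : ∃ (ν : ℕ → LInfSpace) (v : ℕ → (Sphere ≃ₜ Sphere)),
    (∀ n, ν n ∈ LInfBall Δ G) ∧
    (∀ᵐ z : ℂ ∂volume, (z : Sphere) ∈ coeffRegion μ →
      Tendsto (fun n => ν n z) atTop (𝓝 (μ z))) ∧
    (∀ n, IsQuasiconformal (ν n) (v n)) ∧
    TendstoLocallyUniformlySphere (fun n => v n) w (coeffRegion μ)

/-- `α` is a simple arc (with its end points) whose interior lies in `Δ`. -/
def IsSimpleArcInside (Δ α : Set Sphere) : Prop :=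
  ∃ γ : ℝ → Sphere, ContinuousOn γ (Set.Icc 0 1) ∧ Set.InjOn γ (Set.Icc 0 1) ∧
    γ '' Set.Icc 0 1 = α ∧ γ '' Set.Ioo 0 1 ⊆ Δ

/-- `F` is a noded family of arcs associated with `μ`. The family is countable; it may be finite,
and it is empty when `‖μ‖ < 1`. -/
structure IsNodedFamily (Δ : Set Sphere) (G : Subgroup (Equiv.Perm Sphere)) (μ : LInfSpace)
    (F : Set (Set Sphere)) : Prop where
  countable : F.Countable
  disjoint : F.PairwiseDisjoint id
  arc : ∀ α ∈ F, IsSimpleArcInside Δ α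
  diam : ∀ ε > 0, {α | α ∈ F ∧ ε ≤ sphericalDiam α}.Finite
  limitSet : coeffLimitSet μ = closure (⋃₀ F)
  dense : Dense (coeffRegion μ)
  stabilizer : ∀ α ∈ F,
    IsCyclicLoxodromicOrExtension (G ⊓ MulAction.stabilizer (Equiv.Perm Sphere) α)

/-- `w` is a noded quasiconformal deformation of `G` with complex dilatation `μ`, collapsing the
arcs of the noded family `F`. -/
structure IsNodedDeformationAlong (Δ : Set Sphere) (G : Subgroup (Equiv.Perm Sphere))
    (μ : LInfSpace) (F : Set (Set Sphere)) (w : Sphere → Sphere) : Prop where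
  family : IsNodedFamily Δ G μ F
  continuous : Continuous w
  injOn : Set.InjOn w (⋃₀ F)ᶜ
  noded : IsNodedQuasiconformalMap Δ G μ w
  const : ∀ α ∈ F, ∀ x ∈ α, ∀ y ∈ α, w x = w y
  distinct : ∀ α ∈ F, ∀ β ∈ F, α ≠ β → ∀ x ∈ α, ∀ y ∈ β, w x ≠ w y

/-- `w` is a noded quasiconformal deformation of `G` with complex dilatation `μ`. -/
def IsNodedDeformation (Δ : Set Sphere) (G : Subgroup (Equiv.Perm Sphere)) (μ : LInfSpace)
    (w : Sphere → Sphere) : Prop :=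
  ∃ F : Set (Set Sphere), IsNodedDeformationAlong Δ G μ F w

/-- The noded Beltrami coefficients for `G` supported in `Δ`. -/
def nodedBeltrami (Δ : Set Sphere) (G : Subgroup (Equiv.Perm Sphere)) : Set LInfSpace :=
  {μ | μ ∈ LInfBallClosure Δ G ∧ ∃ w : Sphere → Sphere, IsNodedDeformation Δ G μ w}

end NodedQC

end

/-! The main point is that `w ∘ g` and `w` differ by a Möbius transformation for each `g ∈ G`. For a
quasiconformal `w` with invariant dilatation this is the classical fact that `w g w⁻¹` is conformal,
because `w ∘ g` and `w` solve the same Beltrami equation (`ae_transform`, `conj_mem_moebiusGroup`).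
It rests on a local Stoilow factorization, `exists_holomorphic_factor`, obtained from a Cauchy
formula: if `f₂` is an injective solution winding once around `f₂ z₀`, and `χ` is a radial cutoff
equal to one near `z₀`, then `f₁ q = (1/π) ∫ f₁ dχ ∧ df₂ / (f₂ - f₂ q)` for every solution `f₁`, up
to the normalization of the area form. The integrand lives on an annulus, so the right side is
holomorphic in `f₂ q`. The formula is Stokes' theorem for mollified functions: `df₁ ∧ df₂` vanishes
in the limit, and a smoothed kernel `1/w` makes the remaining term an approximate point mass at `q`,
whose total mass is found by taking `f₁ = 1` and using the winding number. No change of variables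
along `f₂` is needed. A homeomorphism of the sphere that is holomorphic off a finite set is then
Möbius (`mem_moebiusGroup_of_holomorphic`).

A noded `w` is handled by approximation (`exists_moebius`). The approximating `v n` satisfy `v n ∘ g
= A n ∘ v n` with `A n` Möbius. Matrices of `A n` scaled to norm one subconverge, and the limit
matrix relates `w ∘ g` to `w` on `Ω(μ)` minus finitely many points. It is invertible because both
maps are injective there, and density of `Ω(μ)` extends the relation to the sphere.

Two topological facts turn these transformations into an isomorphism. Each fibre through a point of
`Ω(μ)` is a single point (`eq_of_apply_eq`), because a locally uniform limit of homeomorphisms is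
open where it is injective; this makes `θ` injective. And `w` is surjective by a degree argument
(`surjective_of_windsOnceAt`), which makes `θ(g)` unique, hence multiplicative in `g`.

As for the region of discontinuity, openness of `w` on `Ω(μ)` pushes good neighbourhoods forward,
and continuity pulls them back. A point of discontinuity of `θ(G)` cannot come from `Λ(μ)`: a
pulled-back neighbourhood would meet an arc, and the infinite stabilizer of that arc would supply
infinitely many returning translates, since `w` is constant on the arc. -/

namespace NodedQC

/-! ### Wirtinger calculus -/

/-- The density of `du ∧ dv` with respect to `dz ∧ dz̄`. -/
noncomputable def wedge (u v : ℂ → ℂ) (z : ℂ) : ℂ := dz u z * dzbar v z - dzbar u z * dz v z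

lemma fderiv_apply_eq (φ : ℂ → ℂ) (z v : ℂ) :
    fderiv ℝ φ z v = dz φ z * v + dzbar φ z * (starRingEnd ℂ) v := by
  have h : v = v.re • (1 : ℂ) + v.im • Complex.I := by
    simp [Complex.re_add_im]
  have h2 : (starRingEnd ℂ) v = v.re - v.im * Complex.I := by
    apply Complex.ext <;> simp
  have h3 : v = v.re + v.im * Complex.I := (Complex.re_add_im v).symm
  rw [h2]
  conv_lhs => rw [h]
  conv_rhs => enter [1, 2]; rw [h3]
  rw [map_add, map_smul, map_smul, Complex.real_smul, Complex.real_smul, dz, dzbar]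
  linear_combination (v.im * fderiv ℝ φ z Complex.I) * Complex.I_sq

lemma dz_dzbar_of_fderiv {φ : ℂ → ℂ} {z A B : ℂ}
    (h : ∀ v, fderiv ℝ φ z v = A * v + B * (starRingEnd ℂ) v) : dz φ z = A ∧ dzbar φ z = B := by
  simp only [dz, dzbar, h, map_one, Complex.conj_I]
  constructor
  · linear_combination ((-A + B) / 2) * Complex.I_sq
  · linear_combination ((A - B) / 2) * Complex.I_sq

lemma dz_mul {u v : ℂ → ℂ} {z : ℂ} (hu : DifferentiableAt ℝ u z) (hv : DifferentiableAt ℝ v z) :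
    dz (fun z => u z * v z) z = u z * dz v z + dz u z * v z ∧
      dzbar (fun z => u z * v z) z = u z * dzbar v z + dzbar u z * v z := by
  apply dz_dzbar_of_fderiv
  intro w
  rw [fderiv_fun_mul hu hv]
  simp only [add_apply, smul_apply, smul_eq_mul, fderiv_apply_eq u, fderiv_apply_eq v]
  ring

lemma wedge_mul_left {u v f : ℂ → ℂ} {z : ℂ} (hu : DifferentiableAt ℝ u z)
    (hv : DifferentiableAt ℝ v z) :
    wedge (fun z => u z * v z) f z = u z * wedge v f z + wedge u f z * v z := by
  simp only [wedge, (dz_mul hu hv).1, (dz_mul hu hv).2]; ring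

lemma dz_comp {u f : ℂ → ℂ} {z : ℂ} (hu : DifferentiableAt ℝ u (f z))
    (hf : DifferentiableAt ℝ f z) :
    dz (fun z => u (f z)) z =
        dz u (f z) * dz f z + dzbar u (f z) * (starRingEnd ℂ) (dzbar f z) ∧
      dzbar (fun z => u (f z)) z =
        dz u (f z) * dzbar f z + dzbar u (f z) * (starRingEnd ℂ) (dz f z) := by
  apply dz_dzbar_of_fderiv
  intro w
  have : (fun z => u (f z)) = u ∘ f := rfl
  rw [this, fderiv_comp z hu hf, ContinuousLinearMap.comp_apply, fderiv_apply_eq u,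
    fderiv_apply_eq f]
  simp only [map_add, map_mul, Complex.conj_conj]
  ring

/-- The holomorphic part of `du` contributes a multiple of `df ∧ df = 0`; the antiholomorphic part
meets `df` through its conjugate and leaves minus the Jacobian of `f`. -/
lemma wedge_comp_self {u f : ℂ → ℂ} {z : ℂ} (hu : DifferentiableAt ℝ u (f z))
    (hf : DifferentiableAt ℝ f z) :
    wedge (fun z => u (f z)) f z =
      dzbar u (f z) * (dzbar f z * (starRingEnd ℂ) (dzbar f z)
        - dz f z * (starRingEnd ℂ) (dz f z)) := by
  simp only [wedge, (dz_comp hu hf).1, (dz_comp hu hf).2]; ring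

lemma dz_comp_holomorphic {u g : ℂ → ℂ} {z : ℂ} (hu : DifferentiableAt ℝ u (g z))
    (hg : DifferentiableAt ℂ g z) :
    dz (fun z => u (g z)) z = dz u (g z) * deriv g z ∧
      dzbar (fun z => u (g z)) z = dzbar u (g z) * (starRingEnd ℂ) (deriv g z) := by
  have h : dz g z = deriv g z ∧ dzbar g z = 0 := by
    apply dz_dzbar_of_fderiv
    intro w
    rw [(hg.hasDerivAt.hasFDerivAt.restrictScalars ℝ).fderiv]
    simp [mul_comm]
  have := dz_comp hu (hg.restrictScalars ℝ)
  rw [h.1, h.2] at this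
  simpa using this

lemma dz_sub_const (f : ℂ → ℂ) (c z : ℂ) :
    dz (fun z => f z - c) z = dz f z ∧ dzbar (fun z => f z - c) z = dzbar f z := by
  simp [dz, dzbar, fderiv_sub_const]

lemma wedge_eq (u v : ℂ → ℂ) (z : ℂ) :
    wedge u v z = Complex.I / 2 *
      (fderiv ℝ u z 1 * fderiv ℝ v z Complex.I - fderiv ℝ u z Complex.I * fderiv ℝ v z 1) := by
  simp only [wedge, dz, dzbar]; ring

/-- Exact forms with compact support have integral zero. -/
lemma integral_wedge_eq_zero {ψ F : ℂ → ℂ} (hψ : ContDiff ℝ 1 ψ) (hs : HasCompactSupport ψ)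
    (hF : ContDiff ℝ 2 F) : ∫ z, wedge ψ F z = 0 := by
  have hF1 : ContDiff ℝ 1 (fderiv ℝ F) := hF.fderiv_right (by norm_num)
  have hd : ∀ v, ContDiff ℝ 1 (fun z => fderiv ℝ F z v) := fun v => hF1.clm_apply contDiff_const
  have hψc : Continuous (fderiv ℝ ψ) := hψ.continuous_fderiv (by norm_num)
  have hsd : ∀ v, HasCompactSupport fun z => fderiv ℝ ψ z v := fun v => hs.fderiv_apply ℝ v
  have key : ∀ v w, Integrable (fun z => fderiv ℝ ψ z v * fderiv ℝ F z w) := fun v w =>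
    ((hψc.clm_apply continuous_const).mul (hd w).continuous).integrable_of_hasCompactSupport
      (hsd v).mul_right
  have ibp : ∀ v w, ∫ z, ψ z * fderiv ℝ (fun z => fderiv ℝ F z w) z v =
      -∫ z, fderiv ℝ ψ z v * fderiv ℝ F z w := fun v w => by
    apply integral_mul_fderiv_eq_neg_fderiv_mul_of_integrable (key v w)
    · exact (hψ.continuous.mul (((hd w).continuous_fderiv (by norm_num)).clm_apply
        continuous_const)).integrable_of_hasCompactSupport hs.mul_right
    · exact (hψ.continuous.mul (hd w).continuous).integrable_of_hasCompactSupport hs.mul_right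
    · exact fun x _ => hψ.differentiable (by norm_num) x
    · exact fun x _ => (hd w).differentiable (by norm_num) x
  have hsymm : ∀ z v w, fderiv ℝ (fun z => fderiv ℝ F z w) z v =
      fderiv ℝ (fun z => fderiv ℝ F z v) z w := fun z v w => by
    have h1 : ∀ u, fderiv ℝ (fun z => fderiv ℝ F z u) z = (fderiv ℝ (fderiv ℝ F) z).flip u :=
      fun u => by
        ext t
        rw [fderiv_clm_apply (hF1.differentiable (by norm_num) z) (by fun_prop)]
        simp
    have h2 : IsSymmSndFDerivAt ℝ F z := hF.contDiffAt.isSymmSndFDerivAt (by simp)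
    rw [h1, h1]
    simpa using h2 v w
  -- Integrating both terms of the determinant by parts leaves mixed second derivatives of `F`,
  -- which cancel by symmetry.
  have h1 := ibp 1 Complex.I
  have h2 := ibp Complex.I 1
  simp only [hsymm _ 1 Complex.I] at h1
  simp only [wedge_eq]
  rw [integral_const_mul, integral_sub (key _ _) (key _ _)]
  rw [← neg_eq_zero, ← mul_neg, neg_sub, sub_eq_neg_add, ← h1, ← neg_eq_iff_eq_neg.mpr h2]
  simp

/-! ### The regularized Cauchy kernel -/

/-- A smooth regularization of `w ↦ 1 / w`. -/
noncomputable def regInv (δ : ℝ) (w : ℂ) : ℂ := (starRingEnd ℂ) w / ((‖w‖ ^ 2 + δ ^ 2 : ℝ) : ℂ)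

/-- The density of `dzbar (regInv δ)`, an approximation of `π` times the Dirac mass. -/
noncomputable def regDelta (δ : ℝ) (w : ℂ) : ℝ := δ ^ 2 / (‖w‖ ^ 2 + δ ^ 2) ^ 2

lemma regDelta_nonneg (δ : ℝ) (w : ℂ) : 0 ≤ regDelta δ w := by unfold regDelta; positivity

lemma regInv_denom_pos {δ : ℝ} (hδ : 0 < δ) (w : ℂ) : 0 < ‖w‖ ^ 2 + δ ^ 2 := by positivity

lemma contDiff_regInv {δ : ℝ} (hδ : 0 < δ) {n : WithTop ℕ∞} : ContDiff ℝ n (regInv δ) := by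
  unfold regInv
  simp only [div_eq_mul_inv]
  refine Complex.conjCLE.contDiff.mul (ContDiff.inv
    (Complex.ofRealCLM.contDiff.comp ((contDiff_norm_sq ℝ).add contDiff_const)) fun w => ?_)
  exact_mod_cast (regInv_denom_pos hδ w).ne'

lemma continuous_regDelta {δ : ℝ} (hδ : 0 < δ) : Continuous (regDelta δ) := by
  unfold regDelta
  refine continuous_const.div (by fun_prop) fun w => ?_
  have := regInv_denom_pos hδ w
  positivity

lemma dzbar_regInv {δ : ℝ} (hδ : 0 < δ) (w : ℂ) : dzbar (regInv δ) w = regDelta δ w := by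
  have hne : ((‖w‖ ^ 2 + δ ^ 2 : ℝ) : ℂ) ≠ 0 := by
    exact_mod_cast (regInv_denom_pos hδ w).ne'
  have e : ∀ w : ℂ, ((‖w‖ ^ 2 + δ ^ 2 : ℝ) : ℂ) = w * (starRingEnd ℂ) w + (δ : ℂ) ^ 2 :=
    fun w => by rw [Complex.mul_conj, Complex.normSq_eq_norm_sq]; push_cast; ring
  have hc : DifferentiableAt ℝ (fun w : ℂ => (starRingEnd ℂ) w) w :=
    Complex.conjCLE.differentiableAt
  have h1 : dzbar (fun w : ℂ => (starRingEnd ℂ) w) w = 1 := by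
    refine (dz_dzbar_of_fderiv (A := 0) fun v => ?_).2
    have : fderiv ℝ (fun w : ℂ => (starRingEnd ℂ) w) w = (Complex.conjCLE : ℂ →L[ℝ] ℂ) :=
      Complex.conjCLE.hasFDerivAt.fderiv
    simp [this]
  have h0 : dzbar (fun w : ℂ => w) w = 0 :=
    (dz_dzbar_of_fderiv (A := 1) fun v => by simp).2
  have h2 : dzbar (fun w : ℂ => w * (starRingEnd ℂ) w + (δ : ℂ) ^ 2) w = w := by
    have := (dz_sub_const (fun w : ℂ => w * (starRingEnd ℂ) w) (-(δ : ℂ) ^ 2) w).2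
    simp only [sub_neg_eq_add] at this
    rw [this, (dz_mul (u := fun w => w) differentiableAt_id hc).2, h1, h0]
    simp
  -- Clearing the denominator allows `dzbar` to be found from the product rule alone, without
  -- differentiating a quotient.
  have h3 : (fun w => regInv δ w * (w * (starRingEnd ℂ) w + (δ : ℂ) ^ 2)) =
      fun w => (starRingEnd ℂ) w := by
    ext w
    rw [regInv, ← e, div_mul_cancel₀]
    exact_mod_cast (regInv_denom_pos hδ w).ne'
  have h4 := (dz_mul (u := regInv δ) (v := fun w => w * (starRingEnd ℂ) w + (δ : ℂ) ^ 2) (z := w)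
    ((contDiff_regInv hδ (n := 1)).differentiable (by norm_num) w)
    ((differentiableAt_id.mul hc).add_const _)).2
  rw [h3, h1, h2] at h4
  have e2 : (regDelta δ w : ℂ) = δ ^ 2 / (w * (starRingEnd ℂ) w + (δ : ℂ) ^ 2) ^ 2 := by
    rw [regDelta, ← e]; push_cast; ring
  have e3 : regInv δ w = (starRingEnd ℂ) w / (w * (starRingEnd ℂ) w + (δ : ℂ) ^ 2) := by
    rw [regInv, e]
  rw [e] at hne
  rw [e2, eq_div_iff (pow_ne_zero 2 hne)]
  rw [e3] at h4
  have h5 : (starRingEnd ℂ) w / (w * (starRingEnd ℂ) w + (δ : ℂ) ^ 2) *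
      (w * (starRingEnd ℂ) w + (δ : ℂ) ^ 2) = (starRingEnd ℂ) w := div_mul_cancel₀ _ hne
  linear_combination -(w * (starRingEnd ℂ) w + (δ : ℂ) ^ 2) * h4 - w * h5

/-! ### Winding numbers -/

/-- The closed curve `γ : [0, 2π] → ℂ` winds exactly once around the origin. -/
def WindsOnce (γ : ℝ → ℂ) : Prop :=
  ∃ φ : ℝ → ℂ, Continuous φ ∧ (∀ t, γ t = Complex.exp (φ t)) ∧
    φ (2 * Real.pi) - φ 0 = 2 * Real.pi * Complex.I

/-- A closed curve `u` inside a disc that omits the origin has a single-valued logarithm, so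
multiplying by it leaves the winding number unchanged. -/
lemma WindsOnce.mul_of_norm_sub_lt {γ u : ℝ → ℂ} (h : WindsOnce γ) (hu : Continuous u)
    (hper : u (2 * Real.pi) = u 0) {c : ℂ} (hc : ∀ t, ‖u t - c‖ < ‖c‖) :
    WindsOnce fun t => γ t * u t := by
  obtain ⟨φ, hφ, he, h2⟩ := h
  have hc0 : c ≠ 0 := by
    rintro rfl
    exact absurd (hc 0) (by simp)
  have hs : ∀ t, u t / c ∈ Complex.slitPlane := fun t => by
    have : u t / c = 1 + (u t - c) / c := by field_simp; ring
    rw [this]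
    apply Complex.mem_slitPlane_of_norm_lt_one
    rw [norm_div, div_lt_one (norm_pos_iff.mpr hc0)]
    exact hc t
  refine ⟨fun t => φ t + (Complex.log (u t / c) + Complex.log c), ?_, fun t => ?_, ?_⟩
  · exact hφ.add (((hu.div_const c).clog hs).add continuous_const)
  · beta_reduce
    rw [Complex.exp_add, Complex.exp_add, Complex.exp_log (Complex.slitPlane_ne_zero (hs t)),
      Complex.exp_log hc0, he, div_mul_cancel₀ _ hc0]
  · simp only [hper]
    linear_combination h2

lemma WindsOnce.apply_two_pi {γ : ℝ → ℂ} (h : WindsOnce γ) : γ (2 * Real.pi) = γ 0 := by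
  obtain ⟨φ, hφ, he, h2⟩ := h
  rw [he, he, eq_add_of_sub_eq h2, Complex.exp_add, Complex.exp_two_pi_mul_I, one_mul]

lemma WindsOnce.ne_zero {γ : ℝ → ℂ} (h : WindsOnce γ) (t : ℝ) : γ t ≠ 0 := by
  obtain ⟨φ, hφ, he, h2⟩ := h
  rw [he]
  exact Complex.exp_ne_zero _

lemma WindsOnce.continuous {γ : ℝ → ℂ} (h : WindsOnce γ) : Continuous γ := by
  obtain ⟨φ, hφ, he, h2⟩ := h
  rw [funext he]
  fun_prop

/-- Rouché's principle: the quotient `γ' / γ` stays in the unit disc about `1`. -/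
lemma WindsOnce.of_norm_sub_lt {γ γ' : ℝ → ℂ} (h : WindsOnce γ) (hu : Continuous γ')
    (hper : γ' (2 * Real.pi) = γ' 0) (hc : ∀ t, ‖γ' t - γ t‖ < ‖γ t‖) : WindsOnce γ' := by
  have h1 := h.mul_of_norm_sub_lt (u := fun t => γ' t / γ t) (c := 1)
    (hu.div h.continuous h.ne_zero) (by rw [hper, h.apply_two_pi]) fun t => by
      have := h.ne_zero t
      rw [div_sub_one this, norm_div, norm_one, div_lt_one (norm_pos_iff.mpr this)]
      exact hc t
  convert h1 using 2 with t
  rw [mul_div_cancel₀ _ (h.ne_zero t)]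

lemma not_windsOnce_of_norm_sub_lt {γ : ℝ → ℂ} {c : ℂ} (hc : ∀ t, ‖γ t - c‖ < ‖c‖) :
    ¬ WindsOnce γ := by
  intro h
  have hc0 : c ≠ 0 := by
    rintro rfl
    exact absurd (hc 0) (by simp)
  obtain ⟨φ, hφ, he, h2⟩ := id h
  have hs : ∀ t, γ t / c ∈ Complex.slitPlane := fun t => by
    have : γ t / c = 1 + (γ t - c) / c := by field_simp; ring
    rw [this]
    apply Complex.mem_slitPlane_of_norm_lt_one
    rw [norm_div, div_lt_one (norm_pos_iff.mpr hc0)]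
    exact hc t
  -- All values of `ψ` are logarithms of the single number `c`, so this continuous function is
  -- constant; then `φ` returns to its initial value, against its increment `2πi`.
  set ψ : ℝ → ℂ := fun t => φ t - Complex.log (γ t / c) with hψ
  have hψc : Continuous ψ := hφ.sub ((h.continuous.div_const c).clog hs)
  have hψe : ∀ t, Complex.exp (ψ t) = c := fun t => by
    simp only [hψ]
    rw [Complex.exp_sub, Complex.exp_log (Complex.slitPlane_ne_zero (hs t)), ← he]
    have := h.ne_zero t
    field_simp
  have hconst : ∀ t, ψ t = ψ 0 := by
    have hl : IsLocallyConstant ψ := by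
      rw [IsLocallyConstant.iff_eventually_eq]
      intro t
      have : ∀ᶠ s in 𝓝 t, ‖ψ s - ψ t‖ < 1 := by
        have := (hψc.tendsto t).eventually (Metric.ball_mem_nhds (ψ t) one_pos)
        simpa [dist_eq_norm] using this
      filter_upwards [this] with s hs1
      have h3 : Complex.exp (ψ s - ψ t) = 1 := by
        rw [Complex.exp_sub, hψe, hψe, div_self hc0]
      obtain ⟨n, hn⟩ := Complex.exp_eq_one_iff.mp h3
      have h4 : n = 0 := by
        by_contra h0
        rw [hn, norm_mul, Complex.norm_intCast, norm_mul, norm_mul, Complex.norm_I,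
          Complex.norm_real, Complex.norm_ofNat, Real.norm_of_nonneg Real.pi_pos.le] at hs1
        have : (1 : ℝ) ≤ |(n : ℝ)| := by exact_mod_cast Int.one_le_abs h0
        nlinarith [Real.pi_gt_three]
      rw [h4] at hn
      simpa [sub_eq_zero] using hn
    exact fun t => hl.apply_eq_of_isPreconnected isPreconnected_univ (Set.mem_univ _)
      (Set.mem_univ _)
  have h5 := hconst (2 * Real.pi)
  simp only [hψ, h.apply_two_pi] at h5
  have h6 : (2 * Real.pi * Complex.I : ℂ) = 0 := by rw [← h2]; linear_combination h5
  simp [Real.pi_ne_zero] at h6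

/-- The continuous logarithm of a differentiable curve is a primitive of `γ' / γ`. The interval is
the angular range of polar coordinates. -/
lemma WindsOnce.integral_eq {γ γ' : ℝ → ℂ} (h : WindsOnce γ) (hd : ∀ t, HasDerivAt γ (γ' t) t)
    (hc : Continuous γ') (hper : Function.Periodic γ (2 * Real.pi)) :
    ∫ t in (-Real.pi)..Real.pi, γ' t / γ t = 2 * Real.pi * Complex.I := by
  have hne := h.ne_zero
  have hγ := h.continuous
  obtain ⟨φ, hφ, he, h2⟩ := h
  have hder : ∀ t, HasDerivAt φ (γ' t / γ t) t := by
    intro t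
    -- Near `t` the increment of `φ` has imaginary part below `π` in absolute value, so the
    -- principal branch recovers it.
    have h1 : ∀ᶠ s in 𝓝 t, φ s = φ t + Complex.log (γ s / γ t) := by
      have : ∀ᶠ s in 𝓝 t, ‖φ s - φ t‖ < 1 := by
        have := (hφ.tendsto t).eventually (Metric.ball_mem_nhds (φ t) one_pos)
        simpa [dist_eq_norm] using this
      filter_upwards [this] with s hs
      have h3 := (abs_lt.mp ((Complex.abs_im_le_norm _).trans_lt hs))
      rw [he, he, ← Complex.exp_sub, Complex.log_exp] <;> [ring; skip; skip]
      · linarith [Real.pi_gt_three]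
      · linarith [Real.pi_gt_three]
    have h4 : HasDerivAt (fun s => φ t + Complex.log (γ s / γ t)) (γ' t / γ t) t := by
      have h5 := ((hd t).div_const (γ t)).clog_real (by rw [div_self (hne t)]; simp)
      rw [div_self (hne t), div_one] at h5
      exact h5.const_add _
    exact h4.congr_of_eventuallyEq h1
  have hper' : Function.Periodic (fun t => γ' t / γ t) (2 * Real.pi) := by
    intro t
    have : γ' (t + 2 * Real.pi) = γ' t := by
      have h1 := (hd (t + 2 * Real.pi)).comp_add_const t (2 * Real.pi)
      have h2 : (fun x => γ (x + 2 * Real.pi)) = γ := funext hper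
      rw [h2] at h1
      exact h1.unique (hd t)
    simp only [this, hper t]
  have h6 := hper'.intervalIntegral_add_eq (-Real.pi) 0
  rw [zero_add, show -Real.pi + 2 * Real.pi = Real.pi by ring] at h6
  rw [h6, intervalIntegral.integral_eq_sub_of_hasDerivAt (fun t _ => hder t)
    ((hc.div hγ hne).intervalIntegrable _ _), h2]

/-! ### Degree integrals -/

/-- The radial function `z ↦ k (|z - z₀| ^ 2)`. -/
noncomputable def radial (k : ℝ → ℝ) (z₀ z : ℂ) : ℂ := (k (‖z - z₀‖ ^ 2) : ℂ)

lemma contDiff_radial {k : ℝ → ℝ} {n : WithTop ℕ∞} (hk : ContDiff ℝ n k) (z₀ : ℂ) :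
    ContDiff ℝ n (radial k z₀) :=
  Complex.ofRealCLM.contDiff.comp
    (hk.comp ((contDiff_norm_sq ℝ).comp (contDiff_id.sub contDiff_const)))

/-- The differential of a radial function sees only the radial direction, so its wedge with `dF`
retains only the derivative of `F` along circles about `z₀`. -/
lemma wedge_radial {k : ℝ → ℝ} (hk : ContDiff ℝ 1 k) (z₀ : ℂ) (F : ℂ → ℂ) (z : ℂ) :
    wedge (radial k z₀) F z =
      Complex.I * deriv k (‖z - z₀‖ ^ 2) * fderiv ℝ F z (Complex.I * (z - z₀)) := by
  have h1 : HasFDerivAt (fun z : ℂ => ‖z - z₀‖ ^ 2)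
      (2 • (innerSL ℝ (z - z₀)).comp (ContinuousLinearMap.id ℝ ℂ)) z :=
    HasFDerivAt.norm_sq ((hasFDerivAt_id z).sub_const z₀)
  have h2 := ((hk.differentiable (by norm_num) _).hasDerivAt).comp_hasFDerivAt z h1
  have h3 := Complex.ofRealCLM.hasFDerivAt.comp z h2
  have h4 : fderiv ℝ (radial k z₀) z = _ := h3.fderiv
  rw [wedge_eq, h4]
  have h5 : fderiv ℝ F z (Complex.I * (z - z₀)) =
      (z - z₀).re • fderiv ℝ F z Complex.I - (z - z₀).im • fderiv ℝ F z 1 := by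
    rw [← map_smul, ← map_smul, ← map_sub]
    congr 1
    apply Complex.ext <;> simp
  rw [h5]
  simp [Complex.inner]
  ring

/-- In polar coordinates the angular integral is the winding integral `2πi`, independent of the
radius; the radial integral is then that of a derivative and sees only the drop of `k` from one to
zero. -/
lemma integral_wedge_radial_div {F : ℂ → ℂ} (hF : ContDiff ℝ 1 F) {k : ℝ → ℝ}
    (hk : ContDiff ℝ 1 k) {r₁ r₂ : ℝ} (h₁ : 0 < r₁) (h₂ : r₁ < r₂)
    (hk1 : ∀ s ≤ r₁ ^ 2, k s = 1) (hk0 : ∀ s, r₂ ^ 2 ≤ s → k s = 0) {z₀ c : ℂ}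
    (hw : ∀ r ∈ Set.Icc r₁ r₂,
      WindsOnce fun t => F (z₀ + r * Complex.exp (t * Complex.I)) - c) :
    ∫ z, wedge (radial k z₀) F z / (F z - c) = Real.pi := by
  have hkc : Continuous (deriv k) := hk.continuous_deriv (by norm_num)
  have hk' : ∀ r : ℝ, 0 ≤ r → r ∉ Set.Icc r₁ r₂ → deriv k (r ^ 2) = 0 := by
    intro r hr hrn
    have : r < r₁ ∨ r₂ < r := by
      by_contra! h
      exact hrn ⟨h.1, h.2⟩
    rcases this with h | h
    · have : k =ᶠ[𝓝 (r ^ 2)] fun _ => 1 := by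
        filter_upwards [gt_mem_nhds (show r ^ 2 < r₁ ^ 2 by gcongr)] with s hs
        exact hk1 s hs.le
      rw [this.deriv_eq, deriv_const]
    · have : k =ᶠ[𝓝 (r ^ 2)] fun _ => 0 := by
        filter_upwards [lt_mem_nhds (show r₂ ^ 2 < r ^ 2 by have := h₁.trans h₂; gcongr)] with s hs
        exact hk0 s hs.le
      rw [this.deriv_eq, deriv_const]
  have hne : ∀ z : ℂ, ‖z‖ ∈ Set.Icc r₁ r₂ → F (z₀ + z) - c ≠ 0 := fun z hz => by
    have := (hw _ hz).ne_zero z.arg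
    rwa [Complex.norm_mul_exp_arg_mul_I] at this
  set G : ℂ → ℂ := fun z => Complex.I * deriv k (‖z‖ ^ 2) *
    fderiv ℝ F (z₀ + z) (Complex.I * z) / (F (z₀ + z) - c) with hG
  have hG0 : ∀ z, ‖z‖ ∉ Set.Icc r₁ r₂ → G z = 0 := fun z hz => by
    simp [hG, hk' _ (norm_nonneg z) hz]
  have hFc : Continuous (fderiv ℝ F) := hF.continuous_fderiv (by norm_num)
  have hGc : Continuous G := by
    rw [continuous_iff_continuousAt]
    intro z
    by_cases hz : ‖z‖ ∈ Set.Icc r₁ r₂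
    · refine ContinuousAt.div ?_ ?_ (hne z hz)
      · have : Continuous fun z : ℂ => Complex.I * ((deriv k (‖z‖ ^ 2) : ℝ) : ℂ) *
            fderiv ℝ F (z₀ + z) (Complex.I * z) := by fun_prop
        exact this.continuousAt
      · have : Continuous fun z => F (z₀ + z) - c := by
          have := hF.continuous
          fun_prop
        exact this.continuousAt
    · have : (fun _ => 0) =ᶠ[𝓝 z] G := by
        have h3 : ∀ᶠ y : ℂ in 𝓝 z, ‖y‖ ∉ Set.Icc r₁ r₂ :=
          continuous_norm.continuousAt.eventually (isClosed_Icc.isOpen_compl.mem_nhds hz)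
        filter_upwards [h3] with y hy
        exact (hG0 y hy).symm
      exact continuousAt_const.congr this
  have e1 : ∫ z, wedge (radial k z₀) F z / (F z - c) = ∫ z, G z := by
    rw [← integral_add_left_eq_self _ z₀]
    simp only [wedge_radial hk, add_sub_cancel_left, hG]
  rw [e1, ← Complex.integral_comp_polarCoord_symm]
  have hpc : Continuous fun p : ℝ × ℝ => p.1 • G (Complex.polarCoord.symm p) := by
    simp only [Complex.polarCoord_symm_apply]
    fun_prop
  have hint : IntegrableOn (fun p : ℝ × ℝ => p.1 • G (Complex.polarCoord.symm p))
      (Set.Ioi 0 ×ˢ Set.Ioo (-Real.pi) Real.pi) := by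
    have hc : IsCompact (Set.Icc (0 : ℝ) r₂ ×ˢ Set.Icc (-Real.pi) Real.pi) :=
      isCompact_Icc.prod isCompact_Icc
    refine (hpc.continuousOn.integrableOn_compact hc).of_forall_sdiff_eq_zero
      (measurableSet_Ioi.prod measurableSet_Ioo) fun p hp => ?_
    rw [hG0, smul_zero]
    rw [Complex.norm_polarCoord_symm]
    intro h
    have h0 : (0 : ℝ) < p.1 := hp.1.1
    rw [abs_of_pos h0] at h
    exact hp.2 ⟨⟨h0.le, h.2⟩, Set.Ioo_subset_Icc_self hp.1.2⟩
  rw [polarCoord_target]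
  rw [Measure.volume_eq_prod] at hint ⊢
  rw [setIntegral_prod _ hint]
  -- The factors `r · i k'(r²)` and `2πi` combine to minus `π` times the derivative of `k (r ^ 2)`.
  -- Outside `[r₁, r₂]`, where the winding number is not known, `k'` vanishes.
  have hinner : ∀ r ∈ Set.Ioi (0 : ℝ), ∫ θ in Set.Ioo (-Real.pi) Real.pi,
      r • G (Complex.polarCoord.symm (r, θ)) = ((-Real.pi * (deriv k (r ^ 2) * (2 * r)) : ℝ) : ℂ) := by
    intro r hr
    have hr0 : (0 : ℝ) < r := hr
    have hn : ∀ θ : ℝ, ‖Complex.polarCoord.symm (r, θ)‖ = r := fun θ => by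
      rw [Complex.norm_polarCoord_symm, abs_of_pos hr0]
    by_cases hr12 : r ∈ Set.Icc r₁ r₂
    · have hd : ∀ t : ℝ, HasDerivAt
          (fun t : ℝ => F (z₀ + r * Complex.exp (t * Complex.I)) - c)
          (fderiv ℝ F (z₀ + r * Complex.exp (t * Complex.I))
            (Complex.I * (r * Complex.exp (t * Complex.I)))) t := by
        intro t
        have h3 : HasDerivAt (fun t : ℝ => z₀ + r * Complex.exp (t * Complex.I))
            (Complex.I * (r * Complex.exp (t * Complex.I))) t := by
          have h4 : HasDerivAt (fun t : ℝ => (t : ℂ) * Complex.I) (1 * Complex.I) t :=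
            (Complex.ofRealCLM.hasDerivAt).mul_const _
          have h5 := (h4.cexp.const_mul (r : ℂ)).const_add z₀
          exact h5.congr_deriv (by ring)
        exact (((hF.differentiable (by norm_num) _).hasFDerivAt).comp_hasDerivAt t h3).sub_const c
      have h6 := (hw r hr12).integral_eq hd (by fun_prop) (fun t => by
        simp only
        congr 3
        rw [Complex.ofReal_add, add_mul, Complex.exp_add]
        push_cast
        rw [Complex.exp_two_pi_mul_I, mul_one])
      rw [intervalIntegral.integral_of_le (by linarith [Real.pi_pos]),
        integral_Ioc_eq_integral_Ioo] at h6
      have h7 : ∀ θ : ℝ, r • G (Complex.polarCoord.symm (r, θ)) =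
          (r * Complex.I * deriv k (r ^ 2)) *
          (fderiv ℝ F (z₀ + r * Complex.exp (θ * Complex.I))
            (Complex.I * (r * Complex.exp (θ * Complex.I))) /
            (F (z₀ + r * Complex.exp (θ * Complex.I)) - c)) := by
        intro θ
        simp only [hG, hn]
        rw [Complex.polarCoord_symm_apply, Complex.exp_mul_I, Complex.real_smul]
        push_cast
        ring
      simp only [h7]
      rw [integral_const_mul, h6]
      push_cast
      linear_combination (2 * Real.pi * r * deriv k (r ^ 2) : ℂ) * Complex.I_sq
    · have h8 : ∀ θ : ℝ, r • G (Complex.polarCoord.symm (r, θ)) = 0 := fun θ => by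
        rw [hG0 _ (by rwa [hn]), smul_zero]
      simp only [h8, integral_zero, hk' r hr0.le hr12]
      simp
  rw [setIntegral_congr_fun measurableSet_Ioi hinner, integral_complex_ofReal]
  congr 1
  have hder : ∀ r : ℝ, HasDerivAt (fun r => -Real.pi * k (r ^ 2))
      (-Real.pi * (deriv k (r ^ 2) * (2 * r))) r := fun r => by
    have h3 := ((hk.differentiable (by norm_num) (r ^ 2)).hasDerivAt).comp r (hasDerivAt_pow 2 r)
    simpa using h3.const_mul (-Real.pi)
  rw [integral_Ioi_of_hasDerivAt_of_tendsto (m := 0) (f := fun r => -Real.pi * k (r ^ 2))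
    (hder 0).continuousAt.continuousWithinAt (fun r _ => hder r)]
  · rw [hk1 (0 ^ 2) (by norm_num; positivity)]; simp
  · have hcs : Continuous fun r : ℝ => -Real.pi * (deriv k (r ^ 2) * (2 * r)) := by fun_prop
    refine (hcs.continuousOn.integrableOn_compact (isCompact_Icc (a := 0) (b := r₂))
      ).of_forall_sdiff_eq_zero measurableSet_Ioi fun r hr => ?_
    rw [hk' r (le_of_lt hr.1) fun h => hr.2 ⟨le_of_lt hr.1, h.2⟩]
    simp
  · refine tendsto_const_nhds.congr' ?_
    filter_upwards [eventually_ge_atTop r₂] with r hr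
    rw [hk0 _ (by gcongr; linarith), mul_zero]

/-! ### Mollification -/

/-- The convolution of `g` with a normalized smooth bump function. -/
noncomputable def mollify (ρ : ContDiffBump (0 : ℂ)) (g : ℂ → ℂ) : ℂ → ℂ :=
  convolution (ρ.normed volume) g (ContinuousLinearMap.lsmul ℝ ℝ) volume

lemma mollify_apply (ρ : ContDiffBump (0 : ℂ)) (g : ℂ → ℂ) (z : ℂ) :
    mollify ρ g z = ∫ y, ρ.normed volume (z - y) • g y := by
  rw [mollify, convolution_eq_swap]; rfl

lemma convolutionExists_normed (ρ : ContDiffBump (0 : ℂ)) {g : ℂ → ℂ}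
    (hg : LocallyIntegrable g volume) :
    ConvolutionExists (ρ.normed volume) g (ContinuousLinearMap.lsmul ℝ ℝ) volume :=
  ρ.hasCompactSupport_normed.convolutionExists_left _ ρ.continuous_normed hg

lemma mollify_sub (ρ : ContDiffBump (0 : ℂ)) {g h : ℂ → ℂ}
    (hg : LocallyIntegrable g volume) (hh : LocallyIntegrable h volume) :
    mollify ρ (g - h) = mollify ρ g - mollify ρ h := by
  ext z
  have h1 := convolutionExists_normed ρ hg z
  have h2 := convolutionExists_normed ρ hh z
  simp only [mollify, convolution, Pi.sub_apply, map_sub]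
  exact integral_sub h1 h2

/-- Mollifying averages translates of `g` against a probability measure: the pointwise bound of the
`L¹` norm by the `L²` norm and Tonelli's theorem give the contraction. -/
lemma eLpNorm_mollify_le (ρ : ContDiffBump (0 : ℂ)) {g : ℂ → ℂ}
    (hg : AEStronglyMeasurable g volume) :
    eLpNorm (mollify ρ g) 2 volume ≤ eLpNorm g 2 volume := by
  set d : ℂ → ℝ≥0∞ := fun t => ENNReal.ofReal (ρ.normed volume t) with hd
  have hdm : Measurable d := (ENNReal.measurable_ofReal).comp ρ.continuous_normed.measurable
  set ν : Measure ℂ := volume.withDensity d with hν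
  have hνp : IsProbabilityMeasure ν := by
    constructor
    rw [hν, withDensity_apply _ MeasurableSet.univ, Measure.restrict_univ,
      ← ofReal_integral_eq_lintegral_ofReal ρ.integrable_normed
        (Eventually.of_forall ρ.nonneg_normed), ρ.integral_normed, ENNReal.ofReal_one]
  have hνac : ν ≪ volume := withDensity_absolutelyContinuous _ _
  have hshift : ∀ x, AEStronglyMeasurable (fun t => g (x - t)) ν := fun x =>
    (hg.comp_quasiMeasurePreserving
      (Measure.measurePreserving_sub_left volume x).quasiMeasurePreserving).mono_ac hνac
  have hpt : ∀ x, ‖mollify ρ g x‖ₑ ^ 2 ≤ ∫⁻ t, ‖g (x - t)‖ₑ ^ 2 ∂ν := by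
    intro x
    have e : mollify ρ g x = ∫ t, g (x - t) ∂ν := by
      rw [hν, integral_withDensity_eq_integral_toReal_smul hdm
        (Eventually.of_forall fun _ => ENNReal.ofReal_lt_top)]
      simp only [hd, ENNReal.toReal_ofReal (ρ.nonneg_normed _)]
      rfl
    have h1 : ‖mollify ρ g x‖ₑ ≤ eLpNorm (fun t => g (x - t)) 2 ν := by
      rw [e]
      refine (enorm_integral_le_lintegral_enorm _).trans ?_
      rw [← eLpNorm_one_eq_lintegral_enorm]
      exact eLpNorm_le_eLpNorm_of_exponent_le (by norm_num) (hshift x)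
    calc ‖mollify ρ g x‖ₑ ^ 2 ≤ (eLpNorm (fun t => g (x - t)) 2 ν) ^ 2 := by gcongr
      _ = _ := by
        have := eLpNorm_nnreal_pow_eq_lintegral (μ := ν) (f := fun t => g (x - t)) (p := 2)
          (by norm_num)
        simpa using this
  have hsq : ∀ u : ℂ → ℂ, eLpNorm u 2 volume = (∫⁻ x, ‖u x‖ₑ ^ 2) ^ (1 / 2 : ℝ) := fun u => by
    rw [eLpNorm_eq_lintegral_rpow_enorm_toReal (by norm_num) (by norm_num)]
    simp
  rw [hsq, hsq]
  refine ENNReal.rpow_le_rpow ?_ (by norm_num)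
  calc ∫⁻ x, ‖mollify ρ g x‖ₑ ^ 2 ≤ ∫⁻ x, ∫⁻ t, ‖g (x - t)‖ₑ ^ 2 ∂ν := lintegral_mono hpt
    _ = ∫⁻ t, ∫⁻ x, ‖g (x - t)‖ₑ ^ 2 ∂volume ∂ν := by
      have := hg.comp_quasiMeasurePreserving
        (quasiMeasurePreserving_sub_of_right_invariant volume ν)
      exact lintegral_lintegral_swap (f := fun x t => ‖g (x - t)‖ₑ ^ 2) (this.enorm.pow_const 2)
    _ = ∫⁻ x, ‖g x‖ₑ ^ 2 := by
      have : ∀ t, ∫⁻ x, ‖g (x - t)‖ₑ ^ 2 = ∫⁻ x, ‖g x‖ₑ ^ 2 := fun t =>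
        lintegral_sub_right_eq_self (fun x => ‖g x‖ₑ ^ 2) t
      simp [this]

/-- By the contraction property it is enough to treat a dense class. For continuous `h` of compact
support the convergence is uniform, and the supports stay in a fixed ball. -/
lemma tendsto_eLpNorm_mollify_sub {ρ : ℕ → ContDiffBump (0 : ℂ)}
    (hρ : Tendsto (fun n => (ρ n).rOut) atTop (𝓝 0)) {g : ℂ → ℂ} (hg : MemLp g 2 volume) :
    Tendsto (fun n => eLpNorm (mollify (ρ n) g - g) 2 volume) atTop (𝓝 0) := by
  rw [ENNReal.tendsto_nhds_zero]
  intro ε hε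
  obtain ⟨h, hcs, hgh, hhc, hhm⟩ := hg.exists_hasCompactSupport_eLpNorm_sub_le (by norm_num)
    (ε := ε / 3) (by simpa using hε.ne')
  have hgl : LocallyIntegrable g volume := hg.locallyIntegrable (by norm_num)
  have hhl : LocallyIntegrable h volume := hhc.locallyIntegrable
  obtain ⟨R, hR⟩ := hcs.isCompact.isBounded.subset_closedBall 0
  set s := Metric.closedBall (0 : ℂ) (R + 1)
  have hsfin : volume s ≠ ⊤ := (isCompact_closedBall _ _).measure_ne_top
  obtain ⟨c, hc0, hc⟩ : ∃ c : ℝ, 0 < c ∧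
      ENNReal.ofReal c * volume s ^ (1 / (2 : ℝ≥0∞).toReal) ≤ ε / 3 := by
    have h1 : Tendsto (fun c : ℝ => ENNReal.ofReal c * volume s ^ (1 / (2 : ℝ≥0∞).toReal))
        (𝓝[>] 0) (𝓝 (ENNReal.ofReal 0 * volume s ^ (1 / (2 : ℝ≥0∞).toReal))) := by
      apply ENNReal.Tendsto.mul_const
      · exact (ENNReal.continuous_ofReal.tendsto 0).mono_left nhdsWithin_le_nhds
      · right
        exact ENNReal.rpow_ne_top_of_nonneg (by norm_num) hsfin
    rw [ENNReal.ofReal_zero, zero_mul] at h1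
    have h2 := h1.eventually (Iic_mem_nhds (show (0 : ℝ≥0∞) < ε / 3 by
      exact ENNReal.div_pos hε.ne' (by norm_num)))
    obtain ⟨c, hc, hc0⟩ := (h2.and self_mem_nhdsWithin).exists
    exact ⟨c, hc0, hc⟩
  have huc := hcs.uniformContinuous_of_continuous hhc
  rw [Metric.uniformContinuous_iff] at huc
  obtain ⟨η, hη, hηh⟩ := huc c hc0
  have hev : ∀ᶠ n in atTop, (ρ n).rOut < min η 1 :=
    hρ.eventually (gt_mem_nhds (lt_min hη one_pos))
  filter_upwards [hev] with n hn
  have hn1 : (ρ n).rOut < η := hn.trans_le (min_le_left _ _)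
  have hn2 : (ρ n).rOut < 1 := hn.trans_le (min_le_right _ _)
  have h3 : eLpNorm (mollify (ρ n) h - h) 2 volume ≤ ε / 3 := by
    refine le_trans (eLpNorm_sub_le_of_dist_bdd volume (by norm_num) (s := s)
      measurableSet_closedBall hc0.le ?_ ?_ ?_) hc
    · intro x
      refine ContDiffBump.dist_normed_convolution_le hhc.aestronglyMeasurable fun y hy => ?_
      exact (hηh (lt_trans (by simpa using hy) hn1)).le
    · refine (support_convolution_subset _).trans ?_
      rintro _ ⟨u, hu, v, hv, rfl⟩
      rw [ContDiffBump.support_normed_eq] at hu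
      have hv' := hR (subset_tsupport _ hv)
      simp only [s, Metric.mem_ball, Metric.mem_closedBall, dist_zero_right] at *
      exact (norm_add_le _ _).trans (by linarith)
    · exact (subset_tsupport _).trans (hR.trans (Metric.closedBall_subset_closedBall (by simp)))
  have e : mollify (ρ n) g - g = mollify (ρ n) (g - h) + (mollify (ρ n) h - h) + (h - g) := by
    rw [mollify_sub _ hgl hhl]; abel
  have hm : ∀ u : ℂ → ℂ, LocallyIntegrable u volume →
      AEStronglyMeasurable (mollify (ρ n) u) volume := fun u hu =>
    ((ρ n).hasCompactSupport_normed.continuous_convolution_left _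
      (ρ n).continuous_normed hu).aestronglyMeasurable
  have m1 := hm _ (hgl.sub hhl)
  have m2 := (hm _ hhl).sub hhc.aestronglyMeasurable
  rw [e]
  calc _ ≤ eLpNorm (mollify (ρ n) (g - h)) 2 volume + eLpNorm (mollify (ρ n) h - h) 2 volume
        + eLpNorm (h - g) 2 volume := by
        refine (eLpNorm_add_le (m1.add m2) (hhc.aestronglyMeasurable.sub
          hg.aestronglyMeasurable) (by norm_num)).trans ?_
        gcongr
        exact eLpNorm_add_le m1 m2 (by norm_num)
    _ ≤ ε / 3 + ε / 3 + ε / 3 := by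
        gcongr
        · exact (eLpNorm_mollify_le _ (hg.aestronglyMeasurable.sub
            hhc.aestronglyMeasurable)).trans hgh
        · rwa [eLpNorm_sub_comm]
    _ = ε := ENNReal.add_thirds ε

lemma contDiff_mollify (ρ : ContDiffBump (0 : ℂ)) {g : ℂ → ℂ} (hg : LocallyIntegrable g volume)
    {n : ℕ∞} : ContDiff ℝ n (mollify ρ g) :=
  ρ.hasCompactSupport_normed.contDiff_convolution_left _ ρ.contDiff_normed hg

lemma tendstoUniformly_mollify {ρ : ℕ → ContDiffBump (0 : ℂ)}
    (hρ : Tendsto (fun n => (ρ n).rOut) atTop (𝓝 0)) {g : ℂ → ℂ} (hg : Continuous g)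
    (hs : HasCompactSupport g) : TendstoUniformly (fun n => mollify (ρ n) g) g atTop := by
  rw [Metric.tendstoUniformly_iff]
  intro ε hε
  have huc := hs.uniformContinuous_of_continuous hg
  rw [Metric.uniformContinuous_iff] at huc
  obtain ⟨η, hη, hηh⟩ := huc (ε / 2) (half_pos hε)
  filter_upwards [hρ.eventually (gt_mem_nhds hη)] with n hn x
  rw [dist_comm]
  refine lt_of_le_of_lt (ContDiffBump.dist_normed_convolution_le hg.aestronglyMeasurable
    fun y hy => ?_) (half_lt_self hε)
  exact (hηh (lt_trans (by simpa using hy) hn)).le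

/-- Mollification commutes with weak derivatives. -/
lemma dz_mollify (ρ : ContDiffBump (0 : ℂ)) {g a b : ℂ → ℂ} (hg : LocallyIntegrable g volume)
    (ha : ∀ φ : ℂ → ℂ, ContDiff ℝ (⊤ : ℕ∞) φ → HasCompactSupport φ →
      ∫ z, g z * dz φ z = -∫ z, a z * φ z)
    (hb : ∀ φ : ℂ → ℂ, ContDiff ℝ (⊤ : ℕ∞) φ → HasCompactSupport φ →
      ∫ z, g z * dzbar φ z = -∫ z, b z * φ z) (z : ℂ) :
    dz (mollify ρ g) z = mollify ρ a z ∧ dzbar (mollify ρ g) z = mollify ρ b z := by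
  set r := ρ.normed volume with hr
  have hrs : ContDiff ℝ (⊤ : ℕ∞) r := ρ.contDiff_normed
  have hrd : Differentiable ℝ r := hrs.differentiable (by simp)
  -- The translated and reflected kernel is the test function. Reflection changes the sign of its
  -- derivative, which compensates the sign in the definition of weak derivatives.
  set φ : ℂ → ℂ := fun y => (r (z - y) : ℂ) with hφ
  have hφs : ContDiff ℝ (⊤ : ℕ∞) φ :=
    Complex.ofRealCLM.contDiff.comp (hrs.comp (contDiff_const.sub contDiff_id))
  have hφc : HasCompactSupport φ := by
    have h1 : HasCompactSupport fun y => r (z - y) :=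
      ρ.hasCompactSupport_normed.comp_homeomorph (Homeomorph.subLeft z)
    exact h1.comp_left (g := fun x : ℝ => (x : ℂ)) (by simp)
  have hφd : ∀ y v, fderiv ℝ φ y v = -(fderiv ℝ r (z - y) v : ℂ) := fun y v => by
    have h1 : HasFDerivAt (fun y => z - y) (-ContinuousLinearMap.id ℝ ℂ) y :=
      (hasFDerivAt_id y).const_sub z
    have h2 := Complex.ofRealCLM.hasFDerivAt.comp y (((hrd (z - y)).hasFDerivAt).comp y h1)
    have h3 : fderiv ℝ φ y = _ := h2.fderiv
    rw [h3]
    simp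
  have hD : HasFDerivAt (mollify ρ g)
      (convolution (fderiv ℝ r) g ((ContinuousLinearMap.lsmul ℝ ℝ).precompL ℂ) volume z) z :=
    ρ.hasCompactSupport_normed.hasFDerivAt_convolution_left _ ρ.contDiff_normed hg z
  have hex : ConvolutionExistsAt (fderiv ℝ r) g z ((ContinuousLinearMap.lsmul ℝ ℝ).precompL ℂ)
      volume := (ρ.hasCompactSupport_normed.fderiv ℝ).convolutionExists_left _
        (hrs.continuous_fderiv (by simp)) hg z
  have hv : ∀ v, fderiv ℝ (mollify ρ g) z v = -∫ y, g y * fderiv ℝ φ y v := fun v => by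
    rw [hD.fderiv, convolution_eq_swap, ContinuousLinearMap.integral_apply,
      ← integral_neg]
    · congr 1
      ext y
      rw [hφd]
      simp [ContinuousLinearMap.precompL_apply, mul_comm]
    · have := hex.integrable_swap
      exact this
  have hgi : ∀ v, Integrable fun y => g y * fderiv ℝ φ y v := fun v => by
    have hc : Continuous fun y => fderiv ℝ φ y v :=
      (hφs.continuous_fderiv (by simp)).clm_apply continuous_const
    have := hg.integrable_smul_left_of_hasCompactSupport hc (hφc.fderiv_apply ℝ v)
    simpa [mul_comm] using this
  have hconv : ∀ u : ℂ → ℂ, mollify ρ u z = ∫ y, u y * φ y := fun u => by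
    rw [mollify_apply]
    congr 1
    ext y
    simp [hφ, hr, mul_comm]
  have e1 : dz (mollify ρ g) z = -∫ y, g y * dz φ y := by
    simp only [dz, hv]
    rw [← integral_neg, ← integral_neg, ← integral_neg, ← integral_const_mul, ← integral_sub
      (by simpa using (hgi _).neg) (by simpa using ((hgi _).neg.const_mul _)),
      ← integral_div]
    congr 1; ext y; ring
  have e2 : dzbar (mollify ρ g) z = -∫ y, g y * dzbar φ y := by
    simp only [dzbar, hv]
    rw [← integral_neg, ← integral_neg, ← integral_neg, ← integral_const_mul, ← integral_add
      (by simpa using (hgi _).neg) (by simpa using ((hgi _).neg.const_mul _)),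
      ← integral_div]
    congr 1; ext y; ring
  rw [e1, e2, ha φ hφs hφc, hb φ hφs hφc, hconv, hconv, neg_neg, neg_neg]
  exact ⟨rfl, rfl⟩

/-! ### Approximation of Sobolev functions -/

/-- On `K`, the functions `F n` converge to `f` uniformly, and their derivatives converge to
`a` and `b` in `L²`. -/
structure SobolevApprox (K : Set ℂ) (f a b : ℂ → ℂ) (F : ℕ → ℂ → ℂ) : Prop where
  memLp_dz : MemLp a 2 (volume.restrict K)
  memLp_dzbar : MemLp b 2 (volume.restrict K)
  uniform : TendstoUniformlyOn F f atTop K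
  tendsto_dz : Tendsto (fun n => eLpNorm (dz (F n) - a) 2 (volume.restrict K)) atTop (𝓝 0)
  tendsto_dzbar : Tendsto (fun n => eLpNorm (dzbar (F n) - b) 2 (volume.restrict K)) atTop (𝓝 0)

lemma continuous_mul_of_tsupport_subset {V : Set ℂ} (hV : IsOpen V) {u f : ℂ → ℂ}
    (hu : Continuous u) (hs : tsupport u ⊆ V) (hf : ContinuousOn f V) :
    Continuous fun z => u z * f z := by
  rw [continuous_iff_continuousAt]
  intro z
  by_cases hz : z ∈ V
  · exact hu.continuousAt.mul (hf.continuousAt (hV.mem_nhds hz))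
  · have : (fun _ => 0) =ᶠ[𝓝 z] fun z => u z * f z := by
      filter_upwards [notMem_tsupport_iff_eventuallyEq.mp fun h => hz (hs h)] with y hy
      simp [hy]
    exact continuousAt_const.congr this

lemma exists_cutoff {K V : Set ℂ} (hK : IsCompact K) (hV : IsOpen V) (hKV : K ⊆ V) :
    ∃ χ : ℂ → ℂ, ContDiff ℝ (⊤ : ℕ∞) χ ∧ HasCompactSupport χ ∧ tsupport χ ⊆ V ∧
      ∀ z ∈ K, χ =ᶠ[𝓝 z] fun _ => 1 := by
  obtain ⟨L, hL, hKL, hLV⟩ := exists_compact_between hK hV hKV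
  obtain ⟨χ, h0, h1, -⟩ := exists_contMDiffMap_zero_one_nhds_of_isClosed (n := ⊤)
    (modelWithCornersSelf ℝ ℂ) (s := (interior L)ᶜ) (t := K) isOpen_interior.isClosed_compl
    hK.isClosed (Set.disjoint_left.mpr fun z hz hz' => hz (hKL hz'))
  have hsL : tsupport (fun z => (χ z : ℂ)) ⊆ L := by
    refine closure_minimal (fun z hz => ?_) hL.isClosed
    by_contra h
    have := h0.self_of_nhdsSet z fun h' => h (interior_subset h')
    simp [this] at hz
  refine ⟨fun z => (χ z : ℂ), Complex.ofRealCLM.contDiff.comp χ.contMDiff.contDiff,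
    HasCompactSupport.of_support_subset_isCompact hL ((subset_tsupport _).trans hsL),
    hsL.trans hLV, fun z hz => ?_⟩
  filter_upwards [Filter.eventually_of_mem ((nhds_le_nhdsSet hz) h1) fun _ h => h] with y hy
  simp [show χ y = 1 from hy]

lemma continuous_dz {u : ℂ → ℂ} (hu : ContDiff ℝ 1 u) : Continuous (dz u) ∧ Continuous (dzbar u) := by
  have h1 : Continuous (fderiv ℝ u) := hu.continuous_fderiv (by norm_num)
  constructor
  · unfold dz; fun_prop
  · unfold dzbar; fun_prop

lemma tsupport_dz_subset (u : ℂ → ℂ) : tsupport (dz u) ⊆ tsupport u ∧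
    tsupport (dzbar u) ⊆ tsupport u := by
  constructor <;>
  · refine closure_minimal (fun z hz => ?_) (isClosed_tsupport _)
    by_contra h
    have : fderiv ℝ u z = 0 := image_eq_zero_of_notMem_tsupport
      fun h' => h (tsupport_fderiv_subset ℝ h')
    simp [dz, dzbar, this] at hz

/-- A cutoff equal to one near `K` turns `f` into a compactly supported continuous function on the
whole plane with weak derivatives in `L²`. Mollifying it does not require care near the boundary of
`V`. -/
lemma exists_sobolevApprox {V : Set ℂ} (hV : IsOpen V) {f a b : ℂ → ℂ}
    (h : HasWeakDerivOn V f a b) (hf : ContinuousOn f V) {K : Set ℂ} (hK : IsCompact K)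
    (hKV : K ⊆ V) :
    ∃ F : ℕ → ℂ → ℂ, (∀ n, ContDiff ℝ (⊤ : ℕ∞) (F n)) ∧ SobolevApprox K f a b F := by
  obtain ⟨χ, hχ, hχc, hχV, hχ1⟩ := exists_cutoff hK hV hKV
  have hχ1' : ContDiff ℝ 1 χ := hχ.of_le (by norm_cast)
  set g : ℂ → ℂ := fun z => χ z * f z with hg
  set A : ℂ → ℂ := fun z => χ z * a z + dz χ z * f z with hA
  set B : ℂ → ℂ := fun z => χ z * b z + dzbar χ z * f z with hB
  have hgc : Continuous g := continuous_mul_of_tsupport_subset hV hχ.continuous hχV hf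
  have hgs : HasCompactSupport g := hχc.mul_right
  have hchi_a : ∀ a : ℂ → ℂ, (∀ K ⊆ V, IsCompact K → MemLp a 2 (volume.restrict K)) →
      MemLp (fun z => χ z * a z) 2 volume := fun a ha => by
    have h1 : MemLp ((tsupport χ).indicator a) 2 volume :=
      (memLp_indicator_iff_restrict (isClosed_tsupport χ).measurableSet).mpr (ha _ hχV hχc)
    have h2 : MemLp χ ⊤ volume := hχ.continuous.memLp_of_hasCompactSupport hχc
    have h3 := h1.mul (φ := χ) (r := 2) h2
    convert h3 using 1
    ext z
    by_cases hz : z ∈ tsupport χ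
    · simp [Set.indicator_of_mem hz]
    · simp [image_eq_zero_of_notMem_tsupport hz]
  have hd : ∀ u : ℂ → ℂ, Continuous u → tsupport u ⊆ tsupport χ →
      Continuous (fun z => u z * f z) ∧ HasCompactSupport fun z => u z * f z := fun u hu hus =>
    ⟨continuous_mul_of_tsupport_subset hV hu (hus.trans hχV) hf,
      HasCompactSupport.mul_right (f := u) (hχc.of_isClosed_subset (isClosed_tsupport _) hus)⟩
  obtain ⟨hzc, hzc'⟩ := continuous_dz hχ1'
  obtain ⟨hzs, hzs'⟩ := tsupport_dz_subset χ
  obtain ⟨hA2c, hA2s⟩ := hd _ hzc hzs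
  obtain ⟨hB2c, hB2s⟩ := hd _ hzc' hzs'
  have hAm : MemLp A 2 volume :=
    (hchi_a a h.memLp_dz).add (hA2c.memLp_of_hasCompactSupport hA2s)
  have hBm : MemLp B 2 volume :=
    (hchi_a b h.memLp_dzbar).add (hB2c.memLp_of_hasCompactSupport hB2s)
  have hgl : LocallyIntegrable g volume := hgc.locallyIntegrable
  have hmulφ : ∀ φ : ℂ → ℂ, ContDiff ℝ (⊤ : ℕ∞) φ → ContDiff ℝ (⊤ : ℕ∞) (fun z => χ z * φ z) ∧
      HasCompactSupport (fun z => χ z * φ z) ∧ tsupport (fun z => χ z * φ z) ⊆ tsupport χ :=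
    fun φ hφ => ⟨hχ.mul hφ, hχc.mul_right, tsupport_mul_subset_left⟩
  have hint1 : ∀ {u φ : ℂ → ℂ}, MemLp (fun z => χ z * u z) 2 volume → Continuous φ →
      HasCompactSupport φ → Integrable (fun z => χ z * u z * φ z) := fun hu hφ hφc =>
    hu.integrable_mul (hφ.memLp_of_hasCompactSupport (p := 2) hφc)
  have hwA : ∀ φ : ℂ → ℂ, ContDiff ℝ (⊤ : ℕ∞) φ → HasCompactSupport φ →
      ∫ z, g z * dz φ z = -∫ z, A z * φ z := by
    intro φ hφ hφc
    obtain ⟨hm1, hm2, hm3⟩ := hmulφ φ hφ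
    have h1 := h.integral_dz _ hm1 hm2 (hm3.trans hχV)
    have hm1' : ContDiff ℝ 1 (fun z => χ z * φ z) := hm1.of_le (by norm_cast)
    obtain ⟨hc1, hc2⟩ := hd _ (continuous_dz hm1').1 ((tsupport_dz_subset _).1.trans hm3)
    -- The cutoff is moved to the test function, whose support then lies in `V`.
    have e1 : ∀ z, g z * dz φ z = dz (fun z => χ z * φ z) z * f z - dz χ z * f z * φ z := by
      intro z
      rw [(dz_mul (hχ.differentiable (by simp) z) (hφ.differentiable (by simp) z)).1]
      simp only [hg]; ring
    have i2 : Integrable fun z => dz χ z * f z * φ z :=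
      (hA2c.mul hφ.continuous).integrable_of_hasCompactSupport hA2s.mul_right
    simp only [e1, hA, add_mul]
    rw [integral_sub (hc1.integrable_of_hasCompactSupport hc2) i2,
      integral_add (hint1 (hchi_a a h.memLp_dz) hφ.continuous hφc) i2]
    have e2 : ∫ z, dz (fun z => χ z * φ z) z * f z = -∫ z, χ z * a z * φ z := by
      rw [show (fun z => dz (fun z => χ z * φ z) z * f z) =
        fun z => f z * dz (fun z => χ z * φ z) z from funext fun z => mul_comm _ _, h1]
      congr 2; ext z; ring
    rw [e2]; ring
  have hwB : ∀ φ : ℂ → ℂ, ContDiff ℝ (⊤ : ℕ∞) φ → HasCompactSupport φ →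
      ∫ z, g z * dzbar φ z = -∫ z, B z * φ z := by
    intro φ hφ hφc
    obtain ⟨hm1, hm2, hm3⟩ := hmulφ φ hφ
    have h1 := h.integral_dzbar _ hm1 hm2 (hm3.trans hχV)
    have hm1' : ContDiff ℝ 1 (fun z => χ z * φ z) := hm1.of_le (by norm_cast)
    obtain ⟨hc1, hc2⟩ := hd _ (continuous_dz hm1').2 ((tsupport_dz_subset _).2.trans hm3)
    have e1 : ∀ z, g z * dzbar φ z =
        dzbar (fun z => χ z * φ z) z * f z - dzbar χ z * f z * φ z := by
      intro z
      rw [(dz_mul (hχ.differentiable (by simp) z) (hφ.differentiable (by simp) z)).2]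
      simp only [hg]; ring
    have i2 : Integrable fun z => dzbar χ z * f z * φ z :=
      (hB2c.mul hφ.continuous).integrable_of_hasCompactSupport hB2s.mul_right
    simp only [e1, hB, add_mul]
    rw [integral_sub (hc1.integrable_of_hasCompactSupport hc2) i2,
      integral_add (hint1 (hchi_a b h.memLp_dzbar) hφ.continuous hφc) i2]
    have e2 : ∫ z, dzbar (fun z => χ z * φ z) z * f z = -∫ z, χ z * b z * φ z := by
      rw [show (fun z => dzbar (fun z => χ z * φ z) z * f z) =
        fun z => f z * dzbar (fun z => χ z * φ z) z from funext fun z => mul_comm _ _, h1]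
      congr 2; ext z; ring
    rw [e2]; ring
  let ρ : ℕ → ContDiffBump (0 : ℂ) := fun n =>
    ⟨1 / (n + 1 : ℝ) / 2, 1 / (n + 1 : ℝ), by positivity, half_lt_self (by positivity)⟩
  have hρ : Tendsto (fun n => (ρ n).rOut) atTop (𝓝 0) := tendsto_one_div_add_atTop_nhds_zero_nat
  -- The cutoff is one on a neighbourhood of each point of `K`, so its derivative contributes
  -- nothing there.
  have hloc : ∀ z ∈ K, A z = a z ∧ B z = b z := by
    intro z hz
    have e0 : fderiv ℝ χ z = 0 := by
      rw [(hχ1 z hz).fderiv_eq, fderiv_const_apply]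
    have e1 : χ z = 1 := (hχ1 z hz).eq_of_nhds
    simp [hA, hB, dz, dzbar, e0, e1]
  have hLp : ∀ {U u : ℂ → ℂ} {D : ℕ → ℂ → ℂ}, MemLp U 2 volume → (∀ z ∈ K, U z = u z) →
      (∀ n, D n = mollify (ρ n) U) →
      Tendsto (fun n => eLpNorm (D n - u) 2 (volume.restrict K)) atTop (𝓝 0) := by
    intro U u D hU hUu hD
    refine tendsto_of_tendsto_of_tendsto_of_le_of_le tendsto_const_nhds
      (tendsto_eLpNorm_mollify_sub hρ hU) (fun n => zero_le) fun n => ?_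
    have : eLpNorm (D n - u) 2 (volume.restrict K) =
        eLpNorm (mollify (ρ n) U - U) 2 (volume.restrict K) := by
      refine eLpNorm_congr_ae ?_
      filter_upwards [ae_restrict_mem hK.measurableSet] with z hz
      simp [hD, hUu z hz]
    rw [this]
    exact eLpNorm_mono_measure _ Measure.restrict_le_self
  refine ⟨fun n => mollify (ρ n) g, fun n => contDiff_mollify _ hgl,
    ⟨h.memLp_dz K hKV hK, h.memLp_dzbar K hKV hK, ?_, ?_, ?_⟩⟩
  · refine (tendstoUniformly_mollify hρ hgc hgs).tendstoUniformlyOn.congr_right fun z hz => ?_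
    simp [hg, (hχ1 z hz).eq_of_nhds]
  · exact hLp hAm (fun z hz => (hloc z hz).1)
      fun n => funext fun z => (dz_mollify (ρ n) hgl hwA hwB z).1
  · exact hLp hBm (fun z hz => (hloc z hz).2)
      fun n => funext fun z => (dz_mollify (ρ n) hgl hwA hwB z).2

/-! ### Holomorphic changes of variable -/

/-- The set lies in the image under `h` of part of `N`, and differentiable maps of the plane
preserve null sets. -/
lemma measure_inter_preimage_eq_zero {g h : ℂ → ℂ} {K N : Set ℂ}
    (hh : ∀ w ∈ g '' K, DifferentiableAt ℂ h w) (hl : ∀ z ∈ K, h (g z) = z)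
    (hN : volume N = 0) : volume (K ∩ g ⁻¹' N) = 0 := by
  have h1 : volume (h '' (N ∩ g '' K)) = 0 :=
    addHaar_image_eq_zero_of_differentiableOn_of_addHaar_eq_zero volume
      (fun w hw => ((hh w hw.2).restrictScalars ℝ).differentiableWithinAt)
      (measure_mono_null Set.inter_subset_left hN)
  exact measure_mono_null (show K ∩ g ⁻¹' N ⊆ h '' (N ∩ g '' K) from
    fun z hz => ⟨g z, ⟨hz.2, z, hz.1, rfl⟩, hl z hz.1⟩) h1

/-- Conformal invariance of the Dirichlet norm: the Jacobian of a holomorphic map is `|g'| ^ 2`,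
exactly the factor that the chain rule produces in the square of a derivative. -/
lemma eLpNorm_comp_mul_deriv {g : ℂ → ℂ} {K : Set ℂ} (hK : MeasurableSet K)
    (hg : ∀ z ∈ K, DifferentiableAt ℂ g z) (hi : Set.InjOn g K) (u v : ℂ → ℂ)
    (hv : ∀ z ∈ K, ‖v z‖ₑ = ‖u (g z)‖ₑ * ‖deriv g z‖ₑ) :
    eLpNorm v 2 (volume.restrict K) = eLpNorm u 2 (volume.restrict (g '' K)) := by
  rw [eLpNorm_eq_lintegral_rpow_enorm_toReal (by norm_num) (by norm_num),
    eLpNorm_eq_lintegral_rpow_enorm_toReal (by norm_num) (by norm_num)]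
  congr 1
  rw [lintegral_image_eq_lintegral_abs_det_fderiv_mul volume hK (f := g)
    (f' := fun z => (ContinuousLinearMap.toSpanSingleton ℂ (deriv g z)).restrictScalars ℝ)
    (fun z hz => ((hg z hz).hasDerivAt.hasFDerivAt.restrictScalars ℝ).hasFDerivWithinAt) hi]
  refine setLIntegral_congr_fun hK fun z hz => ?_
  have hdet : ((ContinuousLinearMap.toSpanSingleton ℂ (deriv g z)).restrictScalars ℝ).det =
      ‖deriv g z‖ ^ 2 := by
    rw [← Complex.normSq_eq_norm_sq, ← Algebra.norm_complex_apply, Algebra.norm_apply,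
      ContinuousLinearMap.det]
    congr 1
    ext
    simp [mul_comm]
  rw [hv z hz, hdet, abs_of_nonneg (by positivity), ENNReal.ofReal_pow (norm_nonneg _),
    ofReal_norm, ENNReal.mul_rpow_of_nonneg _ _ (by norm_num)]
  simp [mul_comm]

/-- This supplies the weak derivatives of `w ∘ g` through approximants alone, with no chain rule for
Sobolev functions. The `L²` errors on `K` equal those on `g '' K` by conformal invariance. -/
lemma SobolevApprox.comp_holomorphic {K : Set ℂ} (hK : IsCompact K) {g h : ℂ → ℂ}
    (hg : ∀ z ∈ K, DifferentiableAt ℂ g z)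
    (hh : ∀ w ∈ g '' K, DifferentiableAt ℂ h w) (hl : ∀ z ∈ K, h (g z) = z)
    {f a b : ℂ → ℂ} {F : ℕ → ℂ → ℂ} (hF : ∀ n, Differentiable ℝ (F n))
    (hs : SobolevApprox (g '' K) f a b F) :
    SobolevApprox K (fun z => f (g z)) (fun z => a (g z) * deriv g z)
      (fun z => b (g z) * (starRingEnd ℂ) (deriv g z)) (fun n z => F n (g z)) := by
  have hKm := hK.measurableSet
  have hi : Set.InjOn g K := fun x hx y hy hxy => by rw [← hl x hx, ← hl y hy, hxy]
  have hgc : ContinuousOn g K := fun z hz => (hg z hz).continuousAt.continuousWithinAt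
  have hgm : AEMeasurable g (volume.restrict K) := hgc.aemeasurable hKm
  have hac : (volume.restrict K).map g ≪ volume.restrict (g '' K) := by
    refine Measure.AbsolutelyContinuous.mk fun N hN h0 => ?_
    rw [Measure.map_apply_of_aemeasurable hgm hN, Measure.restrict_apply' hKm]
    rw [Measure.restrict_apply hN] at h0
    refine measure_mono_null (fun z hz => ?_) (measure_inter_preimage_eq_zero hh hl h0)
    exact ⟨hz.2, hz.1, z, hz.2, rfl⟩
  have hmeas : ∀ u : ℂ → ℂ, AEStronglyMeasurable u (volume.restrict (g '' K)) →
      AEStronglyMeasurable (fun z => u (g z)) (volume.restrict K) := fun u hu =>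
    (hu.mono_ac hac).comp_aemeasurable hgm
  have hdm : AEStronglyMeasurable (deriv g) (volume.restrict K) :=
    (measurable_deriv g).aestronglyMeasurable
  have hdm' : AEStronglyMeasurable (fun z => (starRingEnd ℂ) (deriv g z)) (volume.restrict K) :=
    Complex.continuous_conj.comp_aestronglyMeasurable hdm
  refine ⟨⟨(hmeas a hs.memLp_dz.1).mul hdm, ?_⟩, ⟨(hmeas b hs.memLp_dzbar.1).mul hdm', ?_⟩,
    ?_, ?_, ?_⟩
  · rw [eLpNorm_comp_mul_deriv hKm hg hi a _ fun z _ => by rw [enorm_mul]]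
    exact hs.memLp_dz.2
  · rw [eLpNorm_comp_mul_deriv hKm hg hi b _ fun z _ => by rw [enorm_mul, RCLike.enorm_conj]]
    exact hs.memLp_dzbar.2
  · exact (hs.uniform.comp g).mono (Set.subset_preimage_image g K)
  · refine hs.tendsto_dz.congr fun n => ?_
    refine (eLpNorm_comp_mul_deriv hKm hg hi (dz (F n) - a) _ fun z hz => ?_).symm
    rw [Pi.sub_apply, (dz_comp_holomorphic (hF n _) (hg z hz)).1, ← sub_mul, enorm_mul,
      Pi.sub_apply]
  · refine hs.tendsto_dzbar.congr fun n => ?_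
    refine (eLpNorm_comp_mul_deriv hKm hg hi (dzbar (F n) - b) _ fun z hz => ?_).symm
    rw [Pi.sub_apply, (dz_comp_holomorphic (hF n _) (hg z hz)).2, ← sub_mul, enorm_mul,
      Pi.sub_apply, RCLike.enorm_conj]

/-! ### Convergence in `L^p` -/

/-- Convergence in `L^s` of a sequence of functions. -/
structure TendstoLp (s : ℝ≥0∞) (ν : Measure ℂ) (P : ℕ → ℂ → ℂ) (p : ℂ → ℂ) : Prop where
  memLp_seq : ∀ n, MemLp (P n) s ν
  memLp : MemLp p s ν
  tendsto : Tendsto (fun n => eLpNorm (P n - p) s ν) atTop (𝓝 0)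

lemma MemLp.tendstoLp {s : ℝ≥0∞} {ν : Measure ℂ} {p : ℂ → ℂ} (hp : MemLp p s ν) :
    TendstoLp s ν (fun _ => p) p := ⟨fun _ => hp, hp, by simp⟩

lemma TendstoLp.add {s : ℝ≥0∞} (hs : 1 ≤ s) {ν : Measure ℂ} {P Q : ℕ → ℂ → ℂ} {p q : ℂ → ℂ}
    (hP : TendstoLp s ν P p) (hQ : TendstoLp s ν Q q) :
    TendstoLp s ν (fun n z => P n z + Q n z) (fun z => p z + q z) := by
  refine ⟨fun n => (hP.1 n).add (hQ.1 n), hP.2.add hQ.2, ?_⟩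
  have h := hP.3.add hQ.3
  rw [add_zero] at h
  refine tendsto_of_tendsto_of_tendsto_of_le_of_le tendsto_const_nhds h (fun n => zero_le)
    fun n => ?_
  have e : (fun z => P n z + Q n z) - (fun z => p z + q z) = (P n - p) + (Q n - q) := by
    ext z; simp only [Pi.sub_apply, Pi.add_apply]; ring
  simp only [e]
  exact eLpNorm_add_le ((hP.1 n).1.sub hP.2.1) ((hQ.1 n).1.sub hQ.2.1) hs

lemma TendstoLp.mul {s t r : ℝ≥0∞} [hT : ENNReal.HolderTriple s t r] (hr : 1 ≤ r)
    {ν : Measure ℂ} {P Q : ℕ → ℂ → ℂ} {p q : ℂ → ℂ} (hP : TendstoLp s ν P p)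
    (hQ : TendstoLp t ν Q q) :
    TendstoLp r ν (fun n z => P n z * Q n z) (fun z => p z * q z) := by
  have hp0 : eLpNorm p s ν ≠ ⊤ := hP.memLp.eLpNorm_ne_top
  have hq0 : eLpNorm q t ν ≠ ⊤ := hQ.memLp.eLpNorm_ne_top
  have m1 : ∀ n, AEStronglyMeasurable (P n - p) ν := fun n =>
    (hP.memLp_seq n).1.sub hP.memLp.1
  have m2 : ∀ n, AEStronglyMeasurable (Q n - q) ν := fun n =>
    (hQ.memLp_seq n).1.sub hQ.memLp.1
  have hold : ∀ {u v : ℂ → ℂ}, AEStronglyMeasurable u ν → AEStronglyMeasurable v ν →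
      eLpNorm (u * v) r ν ≤ eLpNorm u s ν * eLpNorm v t ν := fun {u v} hu hv => by
    have := eLpNorm_smul_le_mul_eLpNorm (p := s) (q := t) (r := r) hv hu
    rwa [smul_eq_mul] at this
  have hb : ∀ n, eLpNorm ((fun z => P n z * Q n z) - fun z => p z * q z) r ν ≤
      eLpNorm (P n - p) s ν * eLpNorm (Q n - q) t ν + eLpNorm (P n - p) s ν * eLpNorm q t ν +
        eLpNorm p s ν * eLpNorm (Q n - q) t ν := by
    intro n
    -- Every term contains at least one difference tending to zero, and Hölder's inequality controls
    -- the products.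
    have e : (fun z => P n z * Q n z) - (fun z => p z * q z) =
        (P n - p) * (Q n - q) + (P n - p) * q + p * (Q n - q) := by
      ext z; simp only [Pi.sub_apply, Pi.add_apply, Pi.mul_apply]; ring
    rw [e]
    refine (eLpNorm_add_le (((m1 n).mul (m2 n)).add ((m1 n).mul hQ.memLp.1))
      (hP.memLp.1.mul (m2 n)) hr).trans (add_le_add ?_ (hold hP.memLp.1 (m2 n)))
    exact (eLpNorm_add_le ((m1 n).mul (m2 n)) ((m1 n).mul hQ.memLp.1) hr).trans
      (add_le_add (hold (m1 n) (m2 n)) (hold (m1 n) hQ.memLp.1))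
  have h1 : Tendsto (fun n => eLpNorm (P n - p) s ν * eLpNorm (Q n - q) t ν) atTop (𝓝 0) := by
    simpa using ENNReal.Tendsto.mul hP.tendsto (Or.inr (by simp)) hQ.tendsto (Or.inr (by simp))
  have h2 : Tendsto (fun n => eLpNorm (P n - p) s ν * eLpNorm q t ν) atTop (𝓝 0) := by
    simpa using ENNReal.Tendsto.mul_const hP.tendsto (Or.inr hq0)
  have h3 : Tendsto (fun n => eLpNorm p s ν * eLpNorm (Q n - q) t ν) atTop (𝓝 0) := by
    simpa using ENNReal.Tendsto.const_mul hQ.tendsto (Or.inr hp0)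
  refine ⟨fun n => MemLp.mul (p := s) (q := t) (hQ.memLp_seq n) (hP.memLp_seq n),
    MemLp.mul (p := s) (q := t) hQ.memLp hP.memLp,
    tendsto_of_tendsto_of_tendsto_of_le_of_le tendsto_const_nhds ?_ (fun n => zero_le) hb⟩
  simpa using (h1.add h2).add h3

lemma TendstoLp.conj {s : ℝ≥0∞} {ν : Measure ℂ} {P : ℕ → ℂ → ℂ} {p : ℂ → ℂ}
    (hP : TendstoLp s ν P p) :
    TendstoLp s ν (fun n z => (starRingEnd ℂ) (P n z)) (fun z => (starRingEnd ℂ) (p z)) := by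
  refine ⟨fun n => (hP.1 n).star, hP.2.star, hP.3.congr fun n => ?_⟩
  refine eLpNorm_congr_norm_ae (Eventually.of_forall fun z => ?_)
  simp only [Pi.sub_apply]
  rw [← map_sub, RCLike.norm_conj]

lemma TendstoLp.neg {s : ℝ≥0∞} {ν : Measure ℂ} {P : ℕ → ℂ → ℂ} {p : ℂ → ℂ}
    (hP : TendstoLp s ν P p) :
    TendstoLp s ν (fun n z => -(P n z)) (fun z => -(p z)) := by
  refine ⟨fun n => (hP.1 n).neg, hP.2.neg, hP.3.congr fun n => ?_⟩
  refine eLpNorm_congr_norm_ae (Eventually.of_forall fun z => ?_)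
  simp only [Pi.sub_apply]
  rw [← neg_sub', norm_neg]

lemma TendstoLp.integral {ν : Measure ℂ} {P : ℕ → ℂ → ℂ} {p : ℂ → ℂ}
    (hP : TendstoLp 1 ν P p) : Tendsto (fun n => ∫ z, P n z ∂ν) atTop (𝓝 (∫ z, p z ∂ν)) :=
  tendsto_integral_of_L1' p hP.2.1
    (Eventually.of_forall fun n => memLp_one_iff_integrable.mp (hP.1 n)) hP.3

lemma memLp_restrict_of_continuousOn {K : Set ℂ} (hK : IsCompact K) {u : ℂ → ℂ}
    (hu : ContinuousOn u K) (s : ℝ≥0∞) : MemLp u s (volume.restrict K) := by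
  have : IsFiniteMeasure (volume.restrict K) := ⟨by
    rw [Measure.restrict_apply_univ]; exact hK.measure_lt_top⟩
  obtain ⟨C, hC⟩ := hK.exists_bound_of_continuousOn hu
  exact MemLp.of_bound (hu.aestronglyMeasurable hK.measurableSet) C
    ((ae_restrict_mem hK.measurableSet).mono hC)

lemma tendstoLp_top_of_uniform {K : Set ℂ} (hK : IsCompact K) {U : ℕ → ℂ → ℂ} {u : ℂ → ℂ}
    (hU : ∀ n, ContinuousOn (U n) K) (hu : ContinuousOn u K)
    (h : TendstoUniformlyOn U u atTop K) : TendstoLp ⊤ (volume.restrict K) U u := by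
  refine ⟨fun n => memLp_restrict_of_continuousOn hK (hU n) _,
    memLp_restrict_of_continuousOn hK hu _, ?_⟩
  rw [ENNReal.tendsto_nhds_zero]
  intro ε hε
  obtain ⟨c, hc0, hc⟩ : ∃ c : ℝ, 0 < c ∧ ENNReal.ofReal c ≤ ε := by
    rcases eq_or_ne ε ⊤ with rfl | h
    · exact ⟨1, one_pos, le_top⟩
    · exact ⟨ε.toReal, ENNReal.toReal_pos hε.ne' h, ENNReal.ofReal_toReal_le⟩
  filter_upwards [(Metric.tendstoUniformlyOn_iff.mp h) c hc0] with n hn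
  refine le_trans ?_ hc
  rw [eLpNorm_exponent_top]
  refine eLpNormEssSup_le_of_ae_bound ((ae_restrict_mem hK.measurableSet).mono fun z hz => ?_)
  rw [Pi.sub_apply, ← dist_eq_norm, dist_comm]
  exact (hn z hz).le

lemma tendstoUniformlyOn_inv {K : Set ℂ} {U : ℕ → ℂ → ℂ} {u : ℂ → ℂ} {η : ℝ} (hη : 0 < η)
    (hu : ∀ z ∈ K, η ≤ ‖u z‖) (h : TendstoUniformlyOn U u atTop K) :
    TendstoUniformlyOn (fun n z => (U n z)⁻¹) (fun z => (u z)⁻¹) atTop K := by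
  rw [Metric.tendstoUniformlyOn_iff] at h ⊢
  intro ε hε
  filter_upwards [h (min (η / 2) (ε * η ^ 2 / 2)) (by positivity)] with n hn z hz
  have h1 := hn z hz
  have h2 := hu z hz
  rw [dist_eq_norm] at h1 ⊢
  have h3 : η / 2 ≤ ‖U n z‖ := by
    have := norm_sub_norm_le (u z) (U n z)
    have := h1.trans_le (min_le_left _ _)
    linarith
  have hu0 : u z ≠ 0 := norm_pos_iff.mp (hη.trans_le h2)
  have hU0 : U n z ≠ 0 := norm_pos_iff.mp ((half_pos hη).trans_le h3)
  rw [inv_sub_inv hu0 hU0, norm_div, norm_mul, norm_sub_rev, div_lt_iff₀ (by positivity)]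
  calc _ < ε * η ^ 2 / 2 := h1.trans_le (min_le_right _ _)
    _ = ε * (η * (η / 2)) := by ring
    _ ≤ _ := by gcongr

lemma tendstoUniformlyOn_comp {K : Set ℂ} (hK : IsCompact K) {U : ℕ → ℂ → ℂ} {u v : ℂ → ℂ}
    (hu : ContinuousOn u K) (hv : Continuous v) (h : TendstoUniformlyOn U u atTop K) :
    TendstoUniformlyOn (fun n z => v (U n z)) (fun z => v (u z)) atTop K := by
  -- A compact set containing all values of `U n` for large `n`, on which `v` is uniformly
  -- continuous.
  have hc : IsCompact (Metric.cthickening 1 (u '' K)) :=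
    (hK.image_of_continuousOn hu).cthickening
  have huc := hc.uniformContinuousOn_of_continuous hv.continuousOn
  rw [Metric.uniformContinuousOn_iff] at huc
  rw [Metric.tendstoUniformlyOn_iff] at h ⊢
  intro ε hε
  obtain ⟨δ, hδ, hd⟩ := huc ε hε
  filter_upwards [h (min δ 1) (by positivity)] with n hn z hz
  have h1 := hn z hz
  refine hd _ (Metric.self_subset_cthickening _ ⟨z, hz, rfl⟩) _ ?_ (h1.trans_le (min_le_left _ _))
  exact Metric.mem_cthickening_of_dist_le _ (u z) _ _ ⟨z, hz, rfl⟩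
    (by rw [dist_comm]; exact (h1.trans_le (min_le_right _ _)).le)

/-! ### A Cauchy formula relative to a homeomorphic solution -/

lemma TendstoLp.one_of_two {K : Set ℂ} (hK : IsCompact K) {P : ℕ → ℂ → ℂ} {p : ℂ → ℂ}
    (h : TendstoLp 2 (volume.restrict K) P p) : TendstoLp 1 (volume.restrict K) P p := by
  have h1 : MemLp (fun _ : ℂ => (1 : ℂ)) 2 (volume.restrict K) :=
    memLp_restrict_of_continuousOn hK continuousOn_const _
  have := h.mul (r := 1) le_rfl (MemLp.tendstoLp h1)
  simpa using this

lemma tsupport_dz_eq_zero {χ : ℂ → ℂ} {z : ℂ} (hz : z ∉ tsupport χ) :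
    χ z = 0 ∧ dz χ z = 0 ∧ dzbar χ z = 0 :=
  ⟨image_eq_zero_of_notMem_tsupport hz,
    image_eq_zero_of_notMem_tsupport fun h => hz ((tsupport_dz_subset χ).1 h),
    image_eq_zero_of_notMem_tsupport fun h => hz ((tsupport_dz_subset χ).2 h)⟩

/-- This is Stokes' theorem for the compactly supported form `χ F₁ a(F₂ - c) dF₂`, expanded by the
product rule. It will be used with `a` the regularized Cauchy kernel. -/
lemma integral_wedge_expand {K : Set ℂ} (hK : IsCompact K) {χ F₁ F₂ a : ℂ → ℂ}
    (hχ : ContDiff ℝ 1 χ) (hχK : tsupport χ ⊆ K) (hF₁ : ∀ z ∈ K, ContDiffAt ℝ 1 F₁ z)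
    (hF₂ : ContDiff ℝ 2 F₂) (ha : ContDiff ℝ 1 a) (c : ℂ) :
    ∫ z in K, (wedge χ F₂ z * (F₁ z * a (F₂ z - c)) +
      χ z * (F₁ z * (dzbar a (F₂ z - c) * (dzbar F₂ z * (starRingEnd ℂ) (dzbar F₂ z)
        - dz F₂ z * (starRingEnd ℂ) (dz F₂ z))) + wedge F₁ F₂ z * a (F₂ z - c))) = 0 := by
  have hF₂1 : ContDiff ℝ 1 F₂ := hF₂.of_le (by norm_num)
  have haF : ContDiff ℝ 1 fun z => a (F₂ z - c) := ha.comp (hF₂1.sub contDiff_const)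
  set ψ : ℂ → ℂ := fun z => χ z * (F₁ z * a (F₂ z - c)) with hψ
  have hψs : tsupport ψ ⊆ tsupport χ := tsupport_mul_subset_left
  have hψc : HasCompactSupport ψ := hK.of_isClosed_subset (isClosed_tsupport _) (hψs.trans hχK)
  have hψ1 : ContDiff ℝ 1 ψ := by
    rw [contDiff_iff_contDiffAt]
    intro z
    by_cases hz : z ∈ K
    · exact hχ.contDiffAt.mul ((hF₁ z hz).mul haF.contDiffAt)
    · have : ψ =ᶠ[𝓝 z] fun _ => 0 :=
        notMem_tsupport_iff_eventuallyEq.mp fun h => hz (hχK (hψs h))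
      exact contDiffAt_const.congr_of_eventuallyEq this
  have h0 := integral_wedge_eq_zero hψ1 hψc hF₂
  rw [← setIntegral_eq_integral_of_forall_compl_eq_zero (s := K)] at h0
  · rw [← h0]
    refine setIntegral_congr_fun hK.measurableSet fun z hz => ?_
    have d1 : DifferentiableAt ℝ F₁ z := (hF₁ z hz).differentiableAt (by norm_num)
    have d2 : DifferentiableAt ℝ F₂ z := hF₂.differentiable (by norm_num) z
    have d3 : DifferentiableAt ℝ (fun z => a (F₂ z - c)) z := haF.differentiable (by norm_num) z
    have dχ : DifferentiableAt ℝ χ z := hχ.differentiable (by norm_num) z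
    have e1 := wedge_mul_left (f := F₂) dχ (v := fun z => F₁ z * a (F₂ z - c)) (d1.mul d3)
    have e2 := wedge_mul_left (f := F₂) d1 d3
    have e3 : wedge (fun z => a (F₂ z - c)) F₂ z =
        dzbar a (F₂ z - c) * (dzbar F₂ z * (starRingEnd ℂ) (dzbar F₂ z)
        - dz F₂ z * (starRingEnd ℂ) (dz F₂ z)) := by
      have h1 := wedge_comp_self (u := a) (f := fun z => F₂ z - c) (z := z)
        (ha.differentiable (by norm_num) _) (d2.sub_const c)
      simp only [wedge, (dz_sub_const F₂ c z).1, (dz_sub_const F₂ c z).2] at h1 ⊢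
      exact h1
    simp only [hψ] at *
    rw [e1, e2, e3]
    ring
  · intro z hz
    have := tsupport_dz_eq_zero (χ := ψ) fun h => hz (hχK (hψs h))
    simp [wedge, this.2.1, this.2.2]

lemma SobolevApprox.tendstoLp {K : Set ℂ} (hK : IsCompact K) {f a b : ℂ → ℂ} {F : ℕ → ℂ → ℂ}
    (hf : ContinuousOn f K) (hF : ∀ n, ∀ z ∈ K, ContDiffAt ℝ 1 (F n) z)
    (h : SobolevApprox K f a b F) :
    TendstoLp ⊤ (volume.restrict K) F f ∧
      TendstoLp 2 (volume.restrict K) (fun n => dz (F n)) a ∧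
      TendstoLp 2 (volume.restrict K) (fun n => dzbar (F n)) b := by
  have hd : ∀ n, ContinuousOn (fderiv ℝ (F n)) K := fun n z hz =>
    ((hF n z hz).continuousAt_fderiv (by norm_num)).continuousWithinAt
  have hd1 : ∀ n, ContinuousOn (dz (F n)) K ∧ ContinuousOn (dzbar (F n)) K := fun n => by
    have := hd n
    constructor
    · unfold dz; fun_prop
    · unfold dzbar; fun_prop
  exact ⟨tendstoLp_top_of_uniform hK
      (fun n z hz => (hF n z hz).continuousAt.continuousWithinAt) hf h.uniform,
    ⟨fun n => memLp_restrict_of_continuousOn hK (hd1 n).1 _, h.memLp_dz, h.tendsto_dz⟩,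
    ⟨fun n => memLp_restrict_of_continuousOn hK (hd1 n).2 _, h.memLp_dzbar, h.tendsto_dzbar⟩⟩

/-- The density of `dχ ∧ df`, where `a` and `b` are the derivatives of `f`. -/
noncomputable def cutoffWedge (χ a b : ℂ → ℂ) (z : ℂ) : ℂ := dz χ z * b z + -(dzbar χ z * a z)

lemma tendstoLp_cutoffWedge {K : Set ℂ} (hK : IsCompact K) {χ a b : ℂ → ℂ} {P Q : ℕ → ℂ → ℂ}
    (hχ : ContDiff ℝ 1 χ) (ha : TendstoLp 2 (volume.restrict K) P a)
    (hb : TendstoLp 2 (volume.restrict K) Q b) :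
    TendstoLp 2 (volume.restrict K) (fun n => cutoffWedge χ (P n) (Q n)) (cutoffWedge χ a b) := by
  have h1 : TendstoLp ⊤ (volume.restrict K) _ _ :=
    MemLp.tendstoLp (memLp_restrict_of_continuousOn hK (continuous_dz hχ).1.continuousOn ⊤)
  have h2 : TendstoLp ⊤ (volume.restrict K) _ _ :=
    MemLp.tendstoLp (memLp_restrict_of_continuousOn hK (continuous_dz hχ).2.continuousOn ⊤)
  exact (h1.mul (r := 2) (by norm_num) hb).add (by norm_num)
    (h2.mul (r := 2) (by norm_num) ha).neg

/-- The Stokes identity passes from smooth approximants to the Sobolev functions, and `hW` kills the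
term `df₁ ∧ df₂`. What remains balances a boundary term carried by `dχ` against the Jacobian of `f₂`
weighted by the approximate Dirac mass. -/
lemma integral_cutoffWedge_regInv {K : Set ℂ} (hK : IsCompact K) {χ f₁ f₂ a₁ b₁ a₂ b₂ : ℂ → ℂ}
    (hχ : ContDiff ℝ 1 χ) (hχK : tsupport χ ⊆ K) {F₁ F₂ : ℕ → ℂ → ℂ}
    (hf₁ : ContinuousOn f₁ K) (hf₂ : ContinuousOn f₂ K)
    (hF₁ : ∀ n, ∀ z ∈ K, ContDiffAt ℝ 1 (F₁ n) z) (hF₂ : ∀ n, ContDiff ℝ 2 (F₂ n))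
    (h₁ : SobolevApprox K f₁ a₁ b₁ F₁) (h₂ : SobolevApprox K f₂ a₂ b₂ F₂)
    (hW : ∀ᵐ z ∂volume.restrict K, a₁ z * b₂ z = b₁ z * a₂ z) (c : ℂ) {δ : ℝ} (hδ : 0 < δ) :
    ∫ z in K, cutoffWedge χ a₂ b₂ z * (f₁ z * regInv δ (f₂ z - c)) =
      ∫ z in K, χ z * (f₁ z * (regDelta δ (f₂ z - c) *
        (a₂ z * (starRingEnd ℂ) (a₂ z) + -(b₂ z * (starRingEnd ℂ) (b₂ z))))) := by
  obtain ⟨c1, da1, db1⟩ := h₁.tendstoLp hK hf₁ hF₁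
  obtain ⟨c2, da2, db2⟩ := h₂.tendstoLp hK hf₂
    (fun n z _ => ((hF₂ n).of_le (by norm_num)).contDiffAt)
  have hinv : TendstoLp ⊤ (volume.restrict K) (fun n z => regInv δ (F₂ n z - c))
      (fun z => regInv δ (f₂ z - c)) := by
    have hc : Continuous fun w => regInv δ (w - c) :=
      (contDiff_regInv hδ (n := 1)).continuous.comp (continuous_sub_right c)
    exact tendstoLp_top_of_uniform hK (fun n => (hc.comp (hF₂ n).continuous).continuousOn)
      (hc.comp_continuousOn hf₂)
      (tendstoUniformlyOn_comp hK hf₂ (v := fun w => regInv δ (w - c)) hc h₂.uniform)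
  have hdel : TendstoLp ⊤ (volume.restrict K) (fun n z => (regDelta δ (F₂ n z - c) : ℂ))
      (fun z => (regDelta δ (f₂ z - c) : ℂ)) := by
    have hc : Continuous fun w => (regDelta δ (w - c) : ℂ) :=
      Complex.continuous_ofReal.comp ((continuous_regDelta hδ).comp (continuous_sub_right c))
    exact tendstoLp_top_of_uniform hK (fun n => (hc.comp (hF₂ n).continuous).continuousOn)
      (hc.comp_continuousOn hf₂)
      (tendstoUniformlyOn_comp hK hf₂ (v := fun w => (regDelta δ (w - c) : ℂ)) hc h₂.uniform)
  have hχ' : TendstoLp ⊤ (volume.restrict K) (fun _ => χ) χ :=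
    MemLp.tendstoLp (memLp_restrict_of_continuousOn hK hχ.continuous.continuousOn ⊤)
  have t1 := ((tendstoLp_cutoffWedge hK hχ da2 db2).mul (r := 2) (by norm_num)
    (c1.mul (r := ⊤) (by norm_num) hinv)).one_of_two hK
  -- The Jacobian is quadratic in `L²` derivatives, so it converges only in `L¹`; the factors
  -- multiplying it converge uniformly.
  have tJ := (da2.mul (r := 1) le_rfl da2.conj).add le_rfl (db2.mul (r := 1) le_rfl db2.conj).neg
  have t2 := hχ'.mul (r := 1) le_rfl (c1.mul (r := 1) le_rfl (hdel.mul (r := 1) le_rfl tJ))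
  have t3 := hχ'.mul (r := 1) le_rfl (((da1.mul (r := 1) le_rfl db2).add le_rfl
    (db1.mul (r := 1) le_rfl da2).neg).mul (r := 1) le_rfl hinv)
  have t := (t1.add le_rfl t2.neg).add le_rfl t3
  have hz : ∀ n, ∫ z in K, (cutoffWedge χ (dz (F₂ n)) (dzbar (F₂ n)) z *
      (F₁ n z * regInv δ (F₂ n z - c)) + -(χ z * (F₁ n z * (regDelta δ (F₂ n z - c) *
        (dz (F₂ n) z * (starRingEnd ℂ) (dz (F₂ n) z) +
          -(dzbar (F₂ n) z * (starRingEnd ℂ) (dzbar (F₂ n) z)))))) +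
      χ z * ((dz (F₁ n) z * dzbar (F₂ n) z + -(dzbar (F₁ n) z * dz (F₂ n) z)) *
        regInv δ (F₂ n z - c))) = 0 := by
    intro n
    rw [← integral_wedge_expand hK hχ hχK (hF₁ n) (hF₂ n) (contDiff_regInv hδ) c]
    congr 1
    ext z
    rw [dzbar_regInv hδ]
    simp only [cutoffWedge, wedge]
    ring
  have h0 := t.integral
  simp only [hz] at h0
  have h0' := tendsto_nhds_unique h0 tendsto_const_nhds
  have hae : ∀ᵐ z ∂volume.restrict K, χ z * ((a₁ z * b₂ z + -(b₁ z * a₂ z)) *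
      regInv δ (f₂ z - c)) = 0 := hW.mono fun z hz => by rw [hz]; ring
  have i1 := memLp_one_iff_integrable.mp t1.memLp
  have i2 := memLp_one_iff_integrable.mp t2.memLp
  rw [← sub_eq_zero, ← integral_sub i1 i2, ← h0']
  refine integral_congr_ae (hae.mono fun z hz => ?_)
  simp only
  rw [hz]
  ring

/-- The smooth degree integral is applied to approximants and passed to the limit. The margin `η`
serves twice: it keeps `F n - c` away from zero on `A`, and by Rouché it lets `F n - c` inherit the
winding of `f - f z₀`. -/
lemma integral_cutoffWedge_div {A : Set ℂ} (hA : IsCompact A) {k : ℝ → ℝ}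
    (hk : ContDiff ℝ 1 k) {r₁ r₂ : ℝ} (hr₁ : 0 < r₁) (hr₂ : r₁ < r₂)
    (hk1 : ∀ s ≤ r₁ ^ 2, k s = 1) (hk0 : ∀ s, r₂ ^ 2 ≤ s → k s = 0) {z₀ c : ℂ}
    (hAr : ∀ z, ‖z - z₀‖ ∈ Set.Icc r₁ r₂ → z ∈ A)
    (hAk : ∀ z ∉ A, dz (radial k z₀) z = 0 ∧ dzbar (radial k z₀) z = 0)
    {f a b : ℂ → ℂ} {F : ℕ → ℂ → ℂ}
    (hf : ContinuousOn f A) (hF : ∀ n, ContDiff ℝ 2 (F n)) (h : SobolevApprox A f a b F)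
    {η : ℝ} (hη : 0 < η) (hc : ∀ z ∈ A, η ≤ ‖f z - c‖)
    (hcw : ∀ z ∈ A, ‖c - f z₀‖ + η ≤ ‖f z - f z₀‖)
    (hw : ∀ r ∈ Set.Icc r₁ r₂,
      WindsOnce fun t => f (z₀ + r * Complex.exp (t * Complex.I)) - f z₀) :
    ∫ z in A, cutoffWedge (radial k z₀) a b z * (f z - c)⁻¹ = Real.pi := by
  have hχ := contDiff_radial hk z₀
  have hF1 : ∀ n, ContDiff ℝ 1 (F n) := fun n => (hF n).of_le (by norm_num)
  obtain ⟨-, da, db⟩ := h.tendstoLp hA hf (fun n z _ => (hF1 n).contDiffAt)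
  have hunif := (Metric.tendstoUniformlyOn_iff.mp h.uniform) (η / 2) (half_pos hη)
  obtain ⟨N, hN⟩ := eventually_atTop.mp hunif
  have hNn : ∀ n, ∀ z ∈ A, ‖F (n + N) z - f z‖ < η / 2 := fun n z hz => by
    rw [← dist_eq_norm, dist_comm]; exact hN (n + N) (Nat.le_add_left _ _) z hz
  have hu : TendstoUniformlyOn (fun n z => F (n + N) z - c) (fun z => f z - c) atTop A := by
    rw [Metric.tendstoUniformlyOn_iff]
    intro ε hε
    filter_upwards [(tendsto_add_atTop_nat N).eventually
      ((Metric.tendstoUniformlyOn_iff.mp h.uniform) ε hε)] with n hn z hz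
    rw [dist_sub_right]
    exact hn z hz
  have hinv := tendstoUniformlyOn_inv hη hc hu
  have hne : ∀ n, ∀ z ∈ A, F (n + N) z - c ≠ 0 := fun n z hz h0 => by
    have h1 := hNn n z hz
    have h2 := hc z hz
    rw [sub_eq_zero.mp h0, norm_sub_rev] at h1
    linarith
  have hne' : ∀ z ∈ A, f z - c ≠ 0 := fun z hz => norm_pos_iff.mp (hη.trans_le (hc z hz))
  have t1 : TendstoLp ⊤ (volume.restrict A) (fun n z => (F (n + N) z - c)⁻¹)
      (fun z => (f z - c)⁻¹) := tendstoLp_top_of_uniform hA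
    (fun n => ((hF (n + N)).continuous.continuousOn.sub continuousOn_const).inv₀ (hne n))
    ((hf.sub continuousOn_const).inv₀ hne') hinv
  have t2 := tendstoLp_cutoffWedge hA hχ da db
  have t2' : TendstoLp 2 (volume.restrict A) (fun n => cutoffWedge (radial k z₀)
      (dz (F (n + N))) (dzbar (F (n + N)))) (cutoffWedge (radial k z₀) a b) :=
    ⟨fun n => t2.1 (n + N), t2.2, t2.3.comp (tendsto_add_atTop_nat N)⟩
  have t := ((t2'.mul (r := 2) (by norm_num) t1).one_of_two hA).integral
  have hconst : ∀ n, ∫ z in A, cutoffWedge (radial k z₀) (dz (F (n + N))) (dzbar (F (n + N))) z *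
      (F (n + N) z - c)⁻¹ = Real.pi := by
    intro n
    rw [setIntegral_eq_integral_of_forall_compl_eq_zero fun z hz => by
      simp [cutoffWedge, (hAk z hz).1, (hAk z hz).2]]
    rw [← integral_wedge_radial_div (hF1 (n + N)) hk hr₁ hr₂ hk1 hk0 (z₀ := z₀) (c := c)]
    · congr 1
    · intro r hr
      have hcir : ∀ t : ℝ, z₀ + r * Complex.exp (t * Complex.I) ∈ A := fun t => by
        refine hAr _ ?_
        rw [add_sub_cancel_left, norm_mul, Complex.norm_exp_ofReal_mul_I, mul_one,
          Complex.norm_real, Real.norm_of_nonneg (hr₁.le.trans hr.1)]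
        exact hr
      refine (hw r hr).of_norm_sub_lt ?_ ?_ fun t => ?_
      · have := (hF (n + N)).continuous
        fun_prop
      · simp [Complex.exp_two_pi_mul_I]
      · have h1 := hNn n _ (hcir t)
        have h2 := hcw _ (hcir t)
        set w := z₀ + r * Complex.exp (t * Complex.I)
        calc ‖F (n + N) w - c - (f w - f z₀)‖ = ‖(F (n + N) w - f w) - (c - f z₀)‖ := by
              congr 1; ring
          _ ≤ ‖F (n + N) w - f w‖ + ‖c - f z₀‖ := norm_sub_le _ _
          _ < _ := by linarith
  simp only [hconst] at t
  exact (tendsto_nhds_unique t tendsto_const_nhds)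

/-! ### Removing the regularization -/

lemma norm_regInv_sub_inv_le {δ η : ℝ} (hδ : 0 < δ) (hη : 0 < η) {w : ℂ} (hw : η ≤ ‖w‖) :
    ‖regInv δ w - w⁻¹‖ ≤ δ ^ 2 / η ^ 3 := by
  have hw0 : w ≠ 0 := norm_pos_iff.mp (hη.trans_le hw)
  have hD : ((‖w‖ ^ 2 + δ ^ 2 : ℝ) : ℂ) ≠ 0 := by exact_mod_cast (regInv_denom_pos hδ w).ne'
  have e : regInv δ w - w⁻¹ = -(δ : ℂ) ^ 2 / (((‖w‖ ^ 2 + δ ^ 2 : ℝ) : ℂ) * w) := by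
    have h1 : (starRingEnd ℂ) w * w = ((‖w‖ ^ 2 : ℝ) : ℂ) := by
      rw [mul_comm, Complex.mul_conj, Complex.normSq_eq_norm_sq]
    rw [regInv, div_sub' hD, div_eq_div_iff hD (mul_ne_zero hD hw0)]
    have h2 : ((‖w‖ ^ 2 + δ ^ 2 : ℝ) : ℂ) = (starRingEnd ℂ) w * w + (δ : ℂ) ^ 2 := by
      rw [h1]; push_cast; ring
    rw [h2]
    field_simp
    ring
  rw [e, norm_div, norm_neg, norm_pow, norm_mul, Complex.norm_real, Complex.norm_real,
    Real.norm_of_nonneg hδ.le, Real.norm_of_nonneg (regInv_denom_pos hδ w).le]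
  gcongr
  calc η ^ 3 = η ^ 2 * η := by ring
    _ ≤ (‖w‖ ^ 2 + δ ^ 2) * ‖w‖ := by
      gcongr
      nlinarith [sq_nonneg δ, pow_le_pow_left₀ hη.le hw 2]

lemma regDelta_le {δ η : ℝ} (hη : 0 < η) {w : ℂ} (hw : η ≤ ‖w‖) :
    regDelta δ w ≤ δ ^ 2 / η ^ 4 := by
  unfold regDelta
  gcongr
  calc η ^ 4 = (η ^ 2) ^ 2 := by ring
    _ ≤ (‖w‖ ^ 2 + δ ^ 2) ^ 2 := by
      gcongr
      nlinarith [sq_nonneg δ, pow_le_pow_left₀ hη.le hw 2]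

/-- Only `A` contributes, and there `f` keeps its distance from `c`, so the regularized kernel
converges uniformly to the Cauchy kernel. -/
lemma tendsto_integral_regInv {K A : Set ℂ} (hK : IsCompact K) (hA : IsCompact A) (hAK : A ⊆ K)
    {M u f : ℂ → ℂ} (hM : MemLp M 2 (volume.restrict K)) (hMA : ∀ z ∉ A, M z = 0)
    (hu : ContinuousOn u K) (hf : ContinuousOn f K) {c : ℂ} {η : ℝ} (hη : 0 < η)
    (hc : ∀ z ∈ A, η ≤ ‖f z - c‖) :
    Tendsto (fun n : ℕ => ∫ z in K, M z * (u z * regInv (1 / (n + 1 : ℝ)) (f z - c))) atTop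
      (𝓝 (∫ z in A, M z * (u z * (f z - c)⁻¹))) := by
  have e : ∀ n : ℕ, ∫ z in K, M z * (u z * regInv (1 / (n + 1 : ℝ)) (f z - c)) =
      ∫ z in A, M z * (u z * regInv (1 / (n + 1 : ℝ)) (f z - c)) := fun n => by
    refine setIntegral_eq_of_subset_of_forall_sdiff_eq_zero hK.measurableSet hAK fun z hz => ?_
    rw [hMA z hz.2, zero_mul]
  simp only [e]
  have hδ : ∀ n : ℕ, 0 < (1 / (n + 1 : ℝ)) := fun n => by positivity
  have hfA := hf.mono hAK
  have t0 : TendstoUniformlyOn (fun (n : ℕ) z => regInv (1 / (n + 1 : ℝ)) (f z - c))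
      (fun z => (f z - c)⁻¹) atTop A := by
    rw [Metric.tendstoUniformlyOn_iff]
    intro ε hε
    have h1 : Tendsto (fun n : ℕ => (1 / (n + 1 : ℝ)) ^ 2 / η ^ 3) atTop (𝓝 0) := by
      have := ((tendsto_one_div_add_atTop_nhds_zero_nat (𝕜 := ℝ)).pow 2).div_const (η ^ 3)
      simpa using this
    filter_upwards [h1.eventually (gt_mem_nhds hε)] with n hn z hz
    rw [dist_comm, dist_eq_norm]
    exact (norm_regInv_sub_inv_le (hδ n) hη (hc z hz)).trans_lt hn
  have t1 : TendstoLp ⊤ (volume.restrict A)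
      (fun (n : ℕ) z => regInv (1 / (n + 1 : ℝ)) (f z - c)) (fun z => (f z - c)⁻¹) :=
    tendstoLp_top_of_uniform hA
      (fun n => (contDiff_regInv (hδ n) (n := 1)).continuous.comp_continuousOn
        (hfA.sub continuousOn_const))
      ((hfA.sub continuousOn_const).inv₀ fun z hz => norm_pos_iff.mp (hη.trans_le (hc z hz))) t0
  have t2 : TendstoLp ⊤ (volume.restrict A) (fun _ => u) u :=
    MemLp.tendstoLp (memLp_restrict_of_continuousOn hA (hu.mono hAK) ⊤)
  have t3 : TendstoLp 2 (volume.restrict A) (fun _ => M) M :=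
    MemLp.tendstoLp (hM.mono_measure (Measure.restrict_mono hAK le_rfl))
  exact ((t3.mul (r := 2) (by norm_num) (t2.mul (r := ⊤) (by norm_num) t1)).one_of_two hA).integral

/-- If the kernels `regDelta δ (f z - f q) * J z` have total mass tending to `m`, they concentrate
at the point `q`. -/
lemma tendsto_integral_regDelta {K : Set ℂ} (hK : IsCompact K) {x J : ℂ → ℝ} {u f : ℂ → ℂ}
    (hx : Continuous x) (hx0 : ∀ z, 0 ≤ x z) (hx1 : ∀ z, x z ≤ 1)
    (hJ : Integrable J (volume.restrict K)) (hJ0 : ∀ᵐ z ∂volume.restrict K, 0 ≤ J z)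
    (hu : ContinuousOn u K) (hf : ContinuousOn f K) (hi : Set.InjOn f K) {q : ℂ} (hq : q ∈ K)
    {m : ℝ} (hm : Tendsto (fun n : ℕ => ∫ z in K,
      ((x z * (regDelta (1 / (n + 1 : ℝ)) (f z - f q) * J z) : ℝ) : ℂ)) atTop (𝓝 (m : ℂ))) :
    Tendsto (fun n : ℕ => ∫ z in K,
      u z * ((x z * (regDelta (1 / (n + 1 : ℝ)) (f z - f q) * J z) : ℝ) : ℂ)) atTop
      (𝓝 (u q * m)) := by
  have hδ : ∀ n : ℕ, 0 < (1 / (n + 1 : ℝ)) := fun n => by positivity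
  set D : ℕ → ℂ → ℝ := fun n z => regDelta (1 / (n + 1 : ℝ)) (f z - f q) with hD
  have hDc : ∀ n, ContinuousOn (D n) K := fun n =>
    (continuous_regDelta (hδ n)).comp_continuousOn (hf.sub continuousOn_const)
  have hfin : IsFiniteMeasure (volume.restrict K) := ⟨by
    rw [Measure.restrict_apply_univ]; exact hK.measure_lt_top⟩
  have hint : ∀ n, Integrable (fun z => x z * (D n z * J z)) (volume.restrict K) := fun n => by
    obtain ⟨C, hC⟩ := hK.exists_bound_of_continuousOn (hDc n)
    have h1 := hJ.bdd_mul ((hx.continuousOn.mul (hDc n)).aestronglyMeasurable hK.measurableSet)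
      (c := C) ((ae_restrict_mem hK.measurableSet).mono fun z hz => by
        rw [Pi.mul_apply, norm_mul, Real.norm_of_nonneg (hx0 z)]
        have := hC z hz
        nlinarith [hx1 z, hx0 z, norm_nonneg (D n z)])
    refine h1.congr (Eventually.of_forall fun z => ?_)
    simp only [Pi.mul_apply]; ring
  have hintc : ∀ n, Integrable (fun z => ((x z * (D n z * J z) : ℝ) : ℂ)) (volume.restrict K) :=
    fun n => (hint n).ofReal
  obtain ⟨B, hB⟩ := hK.exists_bound_of_continuousOn (hu.sub (continuousOn_const (c := u q)))
  have hB0 : 0 ≤ B := (norm_nonneg _).trans (hB q hq)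
  have hintu : ∀ n, Integrable (fun z => (u z - u q) * ((x z * (D n z * J z) : ℝ) : ℂ))
      (volume.restrict K) := fun n =>
    (hintc n).bdd_mul ((hu.sub continuousOn_const).aestronglyMeasurable hK.measurableSet)
      ((ae_restrict_mem hK.measurableSet).mono hB)
  have hmR : Tendsto (fun n : ℕ => ∫ z in K, x z * (D n z * J z)) atTop (𝓝 m) := by
    have h1 := (Complex.continuous_re.tendsto _).comp hm
    simp only [Complex.ofReal_re] at h1
    refine h1.congr fun n => ?_
    simp only [Function.comp]
    rw [integral_complex_ofReal, Complex.ofReal_re]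
  have key : Tendsto (fun n : ℕ => ∫ z in K, (u z - u q) * ((x z * (D n z * J z) : ℝ) : ℂ)) atTop
      (𝓝 0) := by
    rw [Metric.tendsto_atTop']
    intro ε hε
    -- Near `q` the oscillation of `u` is below `ε'` and the mass is close to `m`, so this part
    -- costs at most about `ε / 2`.
    set ε' := ε / (2 * (|m| + 1)) with hε'
    have hε'0 : 0 < ε' := by positivity
    obtain ⟨r, hr, hru⟩ := Metric.continuousWithinAt_iff.mp (hu q hq) ε' hε'0
    -- Injectivity of `f` and compactness give the gap; beyond it the kernel is at most a constant
    -- times the square of the regularization parameter.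
    obtain ⟨η, hη, hηf⟩ : ∃ η > 0, ∀ z ∈ K \ Metric.ball q r, η ≤ ‖f z - f q‖ := by
      have hc : IsCompact (K \ Metric.ball q r) := hK.diff Metric.isOpen_ball
      rcases (K \ Metric.ball q r).eq_empty_or_nonempty with he | hne
      · exact ⟨1, one_pos, by simp [he]⟩
      · obtain ⟨z, hz, hmin⟩ := hc.exists_isMinOn hne
          ((hf.mono Set.sdiff_subset).sub (continuousOn_const (c := f q))).norm
        refine ⟨‖f z - f q‖, norm_pos_iff.mpr fun h => hz.2 ?_, fun y hy => hmin hy⟩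
        rw [hi hz.1 hq (sub_eq_zero.mp h)]
        exact Metric.mem_ball_self hr
    have h1 : Tendsto (fun n : ℕ => ε' * (∫ z in K, x z * (D n z * J z)) +
        B * ((1 / (n + 1 : ℝ)) ^ 2 / η ^ 4) * ∫ z in K, J z) atTop
        (𝓝 (ε' * m + B * (0 ^ 2 / η ^ 4) * ∫ z in K, J z)) :=
      (hmR.const_mul _).add (((((tendsto_one_div_add_atTop_nhds_zero_nat (𝕜 := ℝ)).pow 2).div_const
        _).const_mul _).mul_const _)
    have h2 : ε' * m + B * (0 ^ 2 / η ^ 4) * ∫ z in K, J z < ε := by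
      have h3 : ε' * m ≤ ε' * (|m| + 1) := by
        gcongr
        linarith [le_abs_self m]
      have h4 : ε' * (|m| + 1) = ε / 2 := by rw [hε']; field_simp
      simp only [ne_eq, OfNat.ofNat_ne_zero, not_false_eq_true, zero_pow, zero_div, mul_zero,
        zero_mul, add_zero]
      linarith
    obtain ⟨N, hN⟩ := eventually_atTop.mp (h1.eventually (gt_mem_nhds h2))
    refine ⟨N, fun n hn => lt_of_le_of_lt ?_ (hN n hn.le)⟩
    rw [dist_zero_right]
    have h5 : Integrable (fun z => ε' * (x z * (D n z * J z)) +
        B * ((1 / (n + 1 : ℝ)) ^ 2 / η ^ 4) * J z) (volume.restrict K) :=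
      ((hint n).const_mul _).add (hJ.const_mul _)
    rw [← integral_const_mul, ← integral_const_mul, ← integral_add ((hint n).const_mul _)
      (hJ.const_mul _)]
    refine norm_integral_le_of_norm_le h5 ?_
    filter_upwards [hJ0, ae_restrict_mem hK.measurableSet] with z hJz hz
    have hD0 : 0 ≤ D n z := regDelta_nonneg _ _
    have hpos : 0 ≤ x z * (D n z * J z) := mul_nonneg (hx0 z) (mul_nonneg hD0 hJz)
    rw [norm_mul, Complex.norm_real, Real.norm_of_nonneg hpos]
    by_cases hzr : z ∈ Metric.ball q r
    · have h6 := (hru hz hzr).le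
      rw [dist_eq_norm] at h6
      have h7 : 0 ≤ B * ((1 / (n + 1 : ℝ)) ^ 2 / η ^ 4) * J z := by positivity
      have := mul_le_mul_of_nonneg_right h6 hpos
      linarith
    · have h6 : D n z ≤ (1 / (n + 1 : ℝ)) ^ 2 / η ^ 4 := regDelta_le hη (hηf z ⟨hz, hzr⟩)
      have h7 : x z * (D n z * J z) ≤ (1 / (n + 1 : ℝ)) ^ 2 / η ^ 4 * J z := by
        calc x z * (D n z * J z) ≤ 1 * (D n z * J z) := by gcongr; exact hx1 z
          _ = D n z * J z := one_mul _
          _ ≤ _ := by gcongr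
      have h8 : ‖u z - u q‖ * (x z * (D n z * J z)) ≤
          B * ((1 / (n + 1 : ℝ)) ^ 2 / η ^ 4 * J z) :=
        mul_le_mul (hB z hz) h7 hpos hB0
      have := mul_nonneg hε'0.le hpos
      linarith
  have h := key.add (hm.const_mul (u q))
  rw [zero_add] at h
  refine h.congr fun n => ?_
  rw [← integral_const_mul, ← integral_add (hintu n) ((hintc n).const_mul _)]
  congr 1; ext z; ring

/-- A Cauchy-type integral is holomorphic in `c` off `f '' A`: differentiation under the integral is
dominated on the disc of radius `η / 2`. -/
lemma differentiableAt_integral_inv {A : Set ℂ} (hA : IsCompact A) {N f : ℂ → ℂ}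
    (hN : Integrable N (volume.restrict A)) (hf : ContinuousOn f A) {c₀ : ℂ} {η : ℝ} (hη : 0 < η)
    (hc : ∀ z ∈ A, η ≤ ‖f z - c₀‖) :
    DifferentiableAt ℂ (fun c => ∫ z in A, N z * (f z - c)⁻¹) c₀ := by
  have hlow : ∀ z ∈ A, ∀ c ∈ Metric.ball c₀ (η / 2), η / 2 ≤ ‖f z - c‖ := fun z hz c hcb => by
    have h1 := hc z hz
    rw [Metric.mem_ball, dist_eq_norm] at hcb
    have h2 : ‖f z - c₀‖ ≤ ‖f z - c‖ + ‖c - c₀‖ := by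
      have := norm_add_le (f z - c) (c - c₀)
      simpa using this
    linarith
  have hmem := ae_restrict_mem (μ := volume) hA.measurableSet
  have hmeas : ∀ c ∈ Metric.ball c₀ (η / 2), ContinuousOn (fun z => (f z - c)⁻¹) A :=
    fun c hcb => (hf.sub continuousOn_const).inv₀ fun z hz =>
      norm_pos_iff.mp ((half_pos hη).trans_le (hlow z hz c hcb))
  have h0 : c₀ ∈ Metric.ball c₀ (η / 2) := Metric.mem_ball_self (half_pos hη)
  refine (hasDerivAt_integral_of_dominated_loc_of_deriv_le (μ := volume.restrict A)
    (F := fun c z => N z * (f z - c)⁻¹) (F' := fun c z => N z * ((f z - c)⁻¹) ^ 2)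
    (bound := fun z => ‖N z‖ * ((η / 2)⁻¹) ^ 2) (Metric.ball_mem_nhds c₀ (half_pos hη))
    ?_ ?_ ?_ ?_ (hN.norm.mul_const _) ?_).2.differentiableAt
  · filter_upwards [Metric.ball_mem_nhds c₀ (half_pos hη)] with c hcb
    exact hN.1.mul ((hmeas c hcb).aestronglyMeasurable hA.measurableSet)
  · refine hN.mul_bdd (c := η⁻¹) ((hmeas c₀ h0).aestronglyMeasurable hA.measurableSet) ?_
    filter_upwards [hmem] with z hz
    rw [norm_inv]
    gcongr
    exact hc z hz
  · exact hN.1.mul (((hmeas c₀ h0).pow 2).aestronglyMeasurable hA.measurableSet)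
  · filter_upwards [hmem] with z hz c hcb
    rw [norm_mul, norm_pow, norm_inv]
    gcongr
    exact hlow z hz c hcb
  · filter_upwards [hmem] with z hz c hcb
    have hne : f z - c ≠ 0 := norm_pos_iff.mp ((half_pos hη).trans_le (hlow z hz c hcb))
    have h1 := (((hasDerivAt_id c).const_sub (f z)).inv hne).const_mul (N z)
    refine h1.congr_deriv ?_
    simp only [id]
    field_simp

lemma SobolevApprox.mono {K A : Set ℂ} (hAK : A ⊆ K) {f a b : ℂ → ℂ} {F : ℕ → ℂ → ℂ}
    (h : SobolevApprox K f a b F) : SobolevApprox A f a b F := by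
  have hle := Measure.restrict_mono (μ := (volume : Measure ℂ)) hAK le_rfl
  have hz : ∀ {D : ℕ → ℂ → ℂ}, Tendsto (fun n => eLpNorm (D n) 2 (volume.restrict K)) atTop (𝓝 0) →
      Tendsto (fun n => eLpNorm (D n) 2 (volume.restrict A)) atTop (𝓝 0) := fun hD =>
    tendsto_of_tendsto_of_tendsto_of_le_of_le tendsto_const_nhds hD (fun n => zero_le)
      fun n => eLpNorm_mono_measure _ hle
  exact ⟨h.memLp_dz.mono_measure hle, h.memLp_dzbar.mono_measure hle, h.uniform.mono hAK,
    hz h.tendsto_dz, hz h.tendsto_dzbar⟩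

lemma sobolevApprox_const (K : Set ℂ) (c : ℂ) :
    SobolevApprox K (fun _ => c) 0 0 (fun _ _ => c) := by
  have h : dz (fun _ => c) = 0 ∧ dzbar (fun _ => c) = 0 := by
    constructor <;> · ext z; simp [dz, dzbar]
  refine ⟨MemLp.zero, MemLp.zero, ?_, by simp [h.1], by simp [h.2]⟩
  rw [Metric.tendstoUniformlyOn_iff]
  exact fun ε hε => Eventually.of_forall fun n z _ => by simpa using hε

/-! ### Local Stoilow factorization -/

/-- A cutoff profile. -/
noncomputable def profile (r₁ r₂ s : ℝ) : ℝ :=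
  Real.smoothTransition ((r₂ ^ 2 - s) / (r₂ ^ 2 - r₁ ^ 2))

lemma contDiff_profile (r₁ r₂ : ℝ) : ContDiff ℝ 1 (profile r₁ r₂) :=
  Real.smoothTransition.contDiff.comp ((contDiff_const.sub contDiff_id).div_const _)

/-- Stoilow factorization, locally: a solution `f₁` of a Beltrami equation factors through an
injective solution `f₂` of the same equation. -/
theorem exists_holomorphic_factor {V : Set ℂ} (hV : IsOpen V) {f₁ f₂ a₁ b₁ a₂ b₂ : ℂ → ℂ} {z₀ : ℂ}
    (hz₀ : z₀ ∈ V) (hf₁ : ContinuousOn f₁ V) (hf₂ : ContinuousOn f₂ V) (hi : Set.InjOn f₂ V)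
    (hw : WindsOnceAt f₂ z₀)
    (h₁ : ∀ K ⊆ V, IsCompact K → ∃ F : ℕ → ℂ → ℂ,
      (∀ n, ∀ z ∈ K, ContDiffAt ℝ 1 (F n) z) ∧ SobolevApprox K f₁ a₁ b₁ F)
    (h₂ : ∀ K ⊆ V, IsCompact K → ∃ F : ℕ → ℂ → ℂ,
      (∀ n, ContDiff ℝ 2 (F n)) ∧ SobolevApprox K f₂ a₂ b₂ F)
    (hW : ∀ᵐ z, z ∈ V → a₁ z * b₂ z = b₁ z * a₂ z) (hJ : ∀ᵐ z, z ∈ V → ‖b₂ z‖ ≤ ‖a₂ z‖) :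
    ∃ Φ : ℂ → ℂ, DifferentiableAt ℂ Φ (f₂ z₀) ∧ ∀ᶠ q in 𝓝 z₀, f₁ q = Φ (f₂ q) := by
  obtain ⟨ρ₁, hρ₁, hwρ⟩ := mem_nhdsGT_iff_exists_Ioo_subset.mp hw
  obtain ⟨ρ₂, hρ₂, hball⟩ := Metric.nhds_basis_closedBall.mem_iff.mp (hV.mem_nhds hz₀)
  have hρ₁0 : (0 : ℝ) < ρ₁ := hρ₁
  set r₂ := min ρ₁ ρ₂ / 2 with hr₂
  set r₁ := r₂ / 2 with hr₁
  have hmin : 0 < min ρ₁ ρ₂ := lt_min hρ₁0 hρ₂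
  have h0r₂ : 0 < r₂ := half_pos hmin
  have h0r₁ : 0 < r₁ := half_pos h0r₂
  have hr₁₂ : r₁ < r₂ := half_lt_self h0r₂
  have hr₂ρ₁ : r₂ < ρ₁ := (half_lt_self hmin).trans_le (min_le_left _ _)
  have hr₂ρ₂ : r₂ ≤ ρ₂ := (half_lt_self hmin).le.trans (min_le_right _ _)
  have hden : 0 < r₂ ^ 2 - r₁ ^ 2 := by nlinarith
  have hwr : ∀ r ∈ Set.Icc r₁ r₂,
      WindsOnce fun t => f₂ (z₀ + r * Complex.exp (t * Complex.I)) - f₂ z₀ := fun r hr =>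
    hwρ ⟨h0r₁.trans_le hr.1, hr.2.trans_lt hr₂ρ₁⟩
  have hk := contDiff_profile r₁ r₂
  set k := profile r₁ r₂ with hkdef
  have hk1 : ∀ s ≤ r₁ ^ 2, k s = 1 := fun s hs => by
    apply Real.smoothTransition.one_of_one_le
    rw [one_le_div hden]
    linarith
  have hk0 : ∀ s, r₂ ^ 2 ≤ s → k s = 0 := fun s hs => by
    apply Real.smoothTransition.zero_of_nonpos
    exact div_nonpos_of_nonpos_of_nonneg (by linarith) hden.le
  set χ := radial k z₀ with hχdef
  have hχ : ContDiff ℝ 1 χ := contDiff_radial hk z₀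
  set K := Metric.closedBall z₀ r₂ with hKdef
  have hK : IsCompact K := isCompact_closedBall _ _
  have hKV : K ⊆ V := (Metric.closedBall_subset_closedBall hr₂ρ₂).trans hball
  set A := K \ Metric.ball z₀ r₁ with hAdef
  have hA : IsCompact A := hK.diff Metric.isOpen_ball
  have hAK : A ⊆ K := Set.sdiff_subset
  have hχK : tsupport χ ⊆ K := by
    refine closure_minimal (fun z hz => ?_) Metric.isClosed_closedBall
    by_contra h
    rw [hKdef, Metric.mem_closedBall, not_le, dist_eq_norm] at h
    exact hz (by rw [hχdef, radial, hk0 _ (by gcongr)]; simp)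
  have hAr : ∀ z, ‖z - z₀‖ ∈ Set.Icc r₁ r₂ → z ∈ A := fun z hz => by
    refine ⟨?_, ?_⟩
    · rw [hKdef, Metric.mem_closedBall, dist_eq_norm]; exact hz.2
    · rw [Metric.mem_ball, dist_eq_norm, not_lt]; exact hz.1
  have hAk : ∀ z ∉ A, dz χ z = 0 ∧ dzbar χ z = 0 := by
    intro z hz
    by_cases hzK : z ∈ K
    · have hzb : z ∈ Metric.ball z₀ r₁ := by
        by_contra h
        exact hz ⟨hzK, h⟩
      have : χ =ᶠ[𝓝 z] fun _ => 1 := by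
        filter_upwards [Metric.isOpen_ball.mem_nhds hzb] with y hy
        rw [Metric.mem_ball, dist_eq_norm] at hy
        rw [hχdef, radial, hk1 _ (by gcongr)]
        simp
      simp [dz, dzbar, this.fderiv_eq]
    · exact (tsupport_dz_eq_zero fun h => hzK (hχK h)).2
  obtain ⟨F₁, hF₁, hs₁⟩ := h₁ K hKV hK
  obtain ⟨F₂, hF₂, hs₂⟩ := h₂ K hKV hK
  have hf₁K := hf₁.mono hKV
  have hf₂K := hf₂.mono hKV
  have hiK := hi.mono hKV
  have hz₀K : z₀ ∈ K := Metric.mem_closedBall_self h0r₂.le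
  -- The factor two leaves a gap of `η` after the centre `f₂ z₀` is replaced by a value `f₂ q`
  -- closer than `η` to it.
  obtain ⟨η, hη, hηA⟩ : ∃ η > 0, ∀ z ∈ A, 2 * η ≤ ‖f₂ z - f₂ z₀‖ := by
    rcases A.eq_empty_or_nonempty with he | hne
    · exact ⟨1, one_pos, by simp [he]⟩
    · obtain ⟨z, hz, hmin⟩ := hA.exists_isMinOn hne
        ((hf₂K.mono hAK).sub (continuousOn_const (c := f₂ z₀))).norm
      have hpos : 0 < ‖f₂ z - f₂ z₀‖ := norm_pos_iff.mpr fun h => hz.2 (by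
        rw [hiK hz.1 hz₀K (sub_eq_zero.mp h)]
        exact Metric.mem_ball_self h0r₁)
      refine ⟨‖f₂ z - f₂ z₀‖ / 2, half_pos hpos, fun y hy => ?_⟩
      rw [mul_div_cancel₀ _ two_ne_zero]
      exact hmin hy
  set M := cutoffWedge χ a₂ b₂ with hM
  have hM0 : ∀ z ∉ A, M z = 0 := fun z hz => by
    simp [hM, cutoffWedge, (hAk z hz).1, (hAk z hz).2]
  obtain ⟨-, da₂, db₂⟩ := hs₂.tendstoLp hK hf₂K fun n z _ => ((hF₂ n).of_le (by norm_num)).contDiffAt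
  have hML : MemLp M 2 (volume.restrict K) := (tendstoLp_cutoffWedge hK hχ da₂ db₂).memLp
  have hKm : ∀ᵐ z ∂volume.restrict K, z ∈ V :=
    (ae_restrict_mem hK.measurableSet).mono fun z hz => hKV hz
  have hWK : ∀ᵐ z ∂volume.restrict K, a₁ z * b₂ z = b₁ z * a₂ z := by
    filter_upwards [ae_restrict_of_ae hW, hKm] with z h h' using h h'
  set J : ℂ → ℝ := fun z => ‖a₂ z‖ ^ 2 - ‖b₂ z‖ ^ 2 with hJdef
  have hJ0 : ∀ᵐ z ∂volume.restrict K, 0 ≤ J z := by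
    filter_upwards [ae_restrict_of_ae hJ, hKm] with z h h'
    have := h h'
    exact sub_nonneg.mpr (by gcongr)
  have hJi : Integrable J (volume.restrict K) := by
    have h3 := (hs₂.memLp_dz.integrable_norm_pow (by norm_num)).sub
      (hs₂.memLp_dzbar.integrable_norm_pow (by norm_num))
    exact h3
  have hJc : ∀ z, (J z : ℂ) = a₂ z * (starRingEnd ℂ) (a₂ z) + -(b₂ z * (starRingEnd ℂ) (b₂ z)) := by
    intro z
    rw [Complex.mul_conj, Complex.mul_conj, Complex.normSq_eq_norm_sq, Complex.normSq_eq_norm_sq,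
      hJdef]
    push_cast
    ring
  set x : ℂ → ℝ := fun z => k (‖z - z₀‖ ^ 2) with hx
  have hxc : Continuous x := by
    have := hk.continuous
    fun_prop
  have hM1 : Integrable (fun z => M z * f₁ z) (volume.restrict A) := by
    have h3 := MemLp.mul (p := 2) (q := 2) (r := 1)
      (memLp_restrict_of_continuousOn hA (hf₁K.mono hAK) 2)
      (hML.mono_measure (Measure.restrict_mono hAK le_rfl))
    exact memLp_one_iff_integrable.mp h3
  -- The factor is the Cauchy integral itself: `A` avoids a neighbourhood of `z₀`, so it is
  -- holomorphic near `f₂ z₀`.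
  refine ⟨fun c => (∫ z in A, M z * f₁ z * (f₂ z - c)⁻¹) / Real.pi, ?_, ?_⟩
  · refine (differentiableAt_integral_inv hA hM1 (hf₂K.mono hAK) hη fun z hz => ?_).div_const _
    linarith [hηA z hz]
  have hqK : ∀ᶠ q in 𝓝 z₀, q ∈ K := Metric.closedBall_mem_nhds z₀ h0r₂
  have hqη : ∀ᶠ q in 𝓝 z₀, ‖f₂ q - f₂ z₀‖ < η := by
    have := (hf₂.continuousAt (hV.mem_nhds hz₀)).eventually (Metric.ball_mem_nhds _ hη)
    simpa [dist_eq_norm] using this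
  filter_upwards [hqK, hqη] with q hq hqη
  have hcw : ∀ z ∈ A, ‖f₂ q - f₂ z₀‖ + η ≤ ‖f₂ z - f₂ z₀‖ := fun z hz => by linarith [hηA z hz]
  have hc : ∀ z ∈ A, η ≤ ‖f₂ z - f₂ q‖ := fun z hz => by
    have h3 := norm_add_le (f₂ z - f₂ q) (f₂ q - f₂ z₀)
    rw [sub_add_sub_cancel] at h3
    linarith [hcw z hz]
  have hB := integral_cutoffWedge_div hA hk h0r₁ hr₁₂ hk1 hk0 hAr hAk (hf₂K.mono hAK) hF₂
    (hs₂.mono hAK) hη hc hcw hwr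
  have hδ : ∀ n : ℕ, 0 < (1 / (n + 1 : ℝ)) := fun n => by positivity
  have hform : ∀ {u a b : ℂ → ℂ} {F : ℕ → ℂ → ℂ}, ContinuousOn u K →
      (∀ n, ∀ z ∈ K, ContDiffAt ℝ 1 (F n) z) → SobolevApprox K u a b F →
      (∀ᵐ z ∂volume.restrict K, a z * b₂ z = b z * a₂ z) → ∀ n : ℕ,
      ∫ z in K, M z * (u z * regInv (1 / (n + 1 : ℝ)) (f₂ z - f₂ q)) = ∫ z in K, u z *
        ((x z * (regDelta (1 / (n + 1 : ℝ)) (f₂ z - f₂ q) * J z) : ℝ) : ℂ) := by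
    intro u a b F hu hF hs hab n
    rw [hM, integral_cutoffWedge_regInv hK hχ hχK hu hf₂K hF hF₂ hs hs₂ hab _ (hδ n)]
    congr 1
    ext z
    rw [← hJc]
    simp only [hχdef, radial, hx]
    push_cast
    ring
  -- The constant function computes the limiting mass of the kernels, namely `π`; this is where the
  -- winding hypothesis enters.
  have hone := hform (u := fun _ => 1) continuousOn_const
    (fun _ _ _ => contDiffAt_const) (sobolevApprox_const K 1) (by simp)
  have hm := tendsto_integral_regInv hK hA hAK hML hM0 (u := fun _ => 1) continuousOn_const hf₂K
    hη hc
  simp only [hone] at hm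
  simp only [one_mul] at hm
  rw [hB] at hm
  have hlim := tendsto_integral_regDelta hK hxc (fun z => Real.smoothTransition.nonneg _)
    (fun z => Real.smoothTransition.le_one _) hJi hJ0 hf₁K hf₂K hiK hq hm
  have hlim' := tendsto_integral_regInv hK hA hAK hML hM0 hf₁K hf₂K hη hc
  simp only [hform hf₁K hF₁ hs₁ hWK] at hlim'
  -- The same integrals converge to `f₁ q` times the mass and to the Cauchy integral.
  have hfin := tendsto_nhds_unique hlim hlim'
  rw [eq_div_iff (by simp [Real.pi_ne_zero]), hfin]
  congr 1; ext z; ring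

/-! ### Möbius transformations -/

lemma coe_affine {x : Sphere} (hx : x ≠ OnePoint.infty) : ((affine x : ℂ) : Sphere) = x := by
  obtain ⟨z, rfl⟩ := OnePoint.ne_infty_iff_exists.mp hx
  rfl

lemma affine_coe (z : ℂ) : affine (z : Sphere) = z := rfl

lemma continuousAt_affine {x : Sphere} (hx : x ≠ OnePoint.infty) : ContinuousAt affine x := by
  obtain ⟨z, rfl⟩ := OnePoint.ne_infty_iff_exists.mp hx
  rw [OnePoint.continuousAt_coe]
  exact continuousAt_id

lemma tendsto_coe_cobounded :
    Tendsto ((↑) : ℂ → Sphere) (Bornology.cobounded ℂ) (𝓝 OnePoint.infty) := by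
  rw [Metric.cobounded_eq_cocompact, ← coclosedCompact_eq_cocompact]
  exact OnePoint.tendsto_coe_infty

/-- The point of the sphere with homogeneous coordinates `p`. -/
noncomputable def ofHomogeneous (p : ℂ × ℂ) : Sphere :=
  open Classical in if p.2 = 0 then OnePoint.infty else ((p.1 / p.2 : ℂ) : Sphere)

lemma ofHomogeneous_smul {t : ℂ} (ht : t ≠ 0) (p : ℂ × ℂ) :
    ofHomogeneous (t * p.1, t * p.2) = ofHomogeneous p := by
  simp [ofHomogeneous, ht, mul_div_mul_left]

/-- Working in homogeneous coordinates treats the poles and the point at infinity of a Möbius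
transformation uniformly. -/
lemma continuousAt_ofHomogeneous {p : ℂ × ℂ} (hp : p ≠ 0) : ContinuousAt ofHomogeneous p := by
  by_cases h : p.2 = 0
  · have h1 : p.1 ≠ 0 := fun h1 => hp (Prod.ext h1 h)
    have hval : ofHomogeneous p = OnePoint.infty := if_pos h
    rw [ContinuousAt, hval, tendsto_def]
    intro U hU
    obtain ⟨R, -, hR⟩ := (hasBasis_cobounded_norm (E := ℂ)).eventually_iff.mp
      (tendsto_coe_cobounded.eventually hU)
    have hp1 : 0 < ‖p.1‖ := norm_pos_iff.mpr h1
    have e1 : ∀ᶠ q : ℂ × ℂ in 𝓝 p, ‖p.1‖ / 2 < ‖q.1‖ :=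
      continuous_fst.norm.continuousAt.eventually (lt_mem_nhds (half_lt_self hp1))
    have e2 : ∀ᶠ q : ℂ × ℂ in 𝓝 p, ‖q.2‖ < ‖p.1‖ / 2 / (|R| + 1) := by
      refine continuous_snd.norm.continuousAt.eventually (gt_mem_nhds ?_)
      simp only [h, norm_zero]
      positivity
    filter_upwards [e1, e2] with q h3 h4
    simp only [Set.mem_preimage, ofHomogeneous]
    split_ifs with hq
    · exact mem_of_mem_nhds hU
    · apply hR
      have hq2 : 0 < ‖q.2‖ := norm_pos_iff.mpr hq
      rw [lt_div_iff₀ (by positivity)] at h4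
      simp only [Set.mem_ofPred_eq, norm_div]
      rw [le_div_iff₀ hq2]
      nlinarith [le_abs_self R]
  · have : (fun q : ℂ × ℂ => ((q.1 / q.2 : ℂ) : Sphere)) =ᶠ[𝓝 p] ofHomogeneous := by
      filter_upwards [continuous_snd.continuousAt.eventually_ne h] with q hq
      simp [ofHomogeneous, hq]
    refine ContinuousAt.congr ?_ this
    exact OnePoint.continuous_coe.continuousAt.comp
      (continuousAt_fst.div continuousAt_snd h)

lemma moebius_apply (g : Matrix.GeneralLinearGroup (Fin 2) ℂ) (z : ℂ) :
    g • (z : Sphere) = ofHomogeneous (g 0 0 * z + g 0 1, g 1 0 * z + g 1 1) := by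
  rw [OnePoint.smul_some_eq_ite, ofHomogeneous]

lemma moebius_apply_infty (g : Matrix.GeneralLinearGroup (Fin 2) ℂ) :
    g • (OnePoint.infty : Sphere) = ofHomogeneous (g 0 0, g 1 0) := by
  rw [OnePoint.smul_infty_eq_ite, ofHomogeneous]

lemma moebius_det (g : Matrix.GeneralLinearGroup (Fin 2) ℂ) :
    g 0 0 * g 1 1 - g 0 1 * g 1 0 ≠ 0 := by
  have := g.det_ne_zero
  rwa [Matrix.det_fin_two] at this

lemma continuous_moebius (g : Matrix.GeneralLinearGroup (Fin 2) ℂ) :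
    Continuous fun x : Sphere => g • x := by
  have hdet := moebius_det g
  rw [continuous_iff_continuousAt]
  intro x
  induction x using OnePoint.rec with
  | coe z =>
    rw [OnePoint.continuousAt_coe]
    have : (fun x : Sphere => g • x) ∘ OnePoint.some =
        fun z : ℂ => ofHomogeneous (g 0 0 * z + g 0 1, g 1 0 * z + g 1 1) :=
      funext fun z => moebius_apply g z
    rw [this]
    refine ContinuousAt.comp (f := fun z : ℂ => (g 0 0 * z + g 0 1, g 1 0 * z + g 1 1))
      (continuousAt_ofHomogeneous fun h => hdet ?_) (by fun_prop)
    have h1 := congrArg Prod.fst h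
    have h2 := congrArg Prod.snd h
    simp only [Prod.fst_zero, Prod.snd_zero] at h1 h2
    linear_combination (g 0 0 : ℂ) * h2 - g 1 0 * h1
  | infty =>
    rw [OnePoint.continuousAt_infty', coclosedCompact_eq_cocompact,
      ← Metric.cobounded_eq_cocompact, moebius_apply_infty]
    have h1 : Tendsto (fun z : ℂ => ofHomogeneous (g 0 0 + g 0 1 * z⁻¹, g 1 0 + g 1 1 * z⁻¹))
        (Bornology.cobounded ℂ) (𝓝 (ofHomogeneous (g 0 0, g 1 0))) := by
      have hne : ((g 0 0 : ℂ), (g 1 0 : ℂ)) ≠ 0 := fun h => hdet (by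
        have h1 := congrArg Prod.fst h
        have h2 := congrArg Prod.snd h
        simp only [Prod.fst_zero, Prod.snd_zero] at h1 h2
        rw [h1, h2]; ring)
      refine (continuousAt_ofHomogeneous hne).tendsto.comp ?_
      have h2 : Tendsto (fun z : ℂ => z⁻¹) (Bornology.cobounded ℂ) (𝓝 0) :=
        tendsto_inv₀_cobounded
      have h3 := (h2.const_mul (g 0 1 : ℂ)).const_add (g 0 0 : ℂ)
      have h4 := (h2.const_mul (g 1 1 : ℂ)).const_add (g 1 0 : ℂ)
      simp only [mul_zero, add_zero] at h3 h4
      exact h3.prodMk_nhds h4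
    refine h1.congr' ?_
    filter_upwards [(hasBasis_cobounded_norm (E := ℂ)).mem_of_mem (i := 1) trivial] with z hz
    have hz0 : z ≠ 0 := norm_pos_iff.mp (one_pos.trans_le hz)
    simp only [Function.comp]
    rw [moebius_apply, ← ofHomogeneous_smul hz0]
    congr 2 <;> · field_simp

lemma continuous_of_mem_moebiusGroup {g : Equiv.Perm Sphere} (hg : g ∈ moebiusGroup) :
    Continuous g := by
  obtain ⟨A, rfl⟩ := hg
  exact continuous_moebius A

/-- A Möbius transformation as a homeomorphism. -/
def moebiusHomeo {g : Equiv.Perm Sphere} (hg : g ∈ moebiusGroup) : Sphere ≃ₜ Sphere where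
  toEquiv := g
  continuous_toFun := continuous_of_mem_moebiusGroup hg
  continuous_invFun := continuous_of_mem_moebiusGroup (moebiusGroup.inv_mem hg)

lemma differentiableAt_moebius {g : Equiv.Perm Sphere} (hg : g ∈ moebiusGroup) {z : ℂ}
    (hz : g z ≠ OnePoint.infty) : DifferentiableAt ℂ (inCharts id id g) z := by
  obtain ⟨A, rfl⟩ := hg
  simp only [MulAction.toPermHom_apply, MulAction.toPerm_apply, moebius_apply,
    ofHomogeneous] at hz
  have hd : A 1 0 * z + A 1 1 ≠ 0 := fun h => hz (if_pos h)
  have he : (fun z : ℂ => (A 0 0 * z + A 0 1) / (A 1 0 * z + A 1 1)) =ᶠ[𝓝 z]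
      inCharts id id (MulAction.toPermHom _ Sphere A) := by
    have hc : ContinuousAt (fun z : ℂ => A 1 0 * z + A 1 1) z := by fun_prop
    filter_upwards [hc.eventually_ne hd] with y hy
    simp [inCharts, moebius_apply, ofHomogeneous, hy, affine]
  refine DifferentiableAt.congr_of_eventuallyEq ?_ he.symm
  have h1 : DifferentiableAt ℂ (fun z : ℂ => A 0 0 * z + A 0 1) z := by fun_prop
  have h2 : DifferentiableAt ℂ (fun z : ℂ => A 1 0 * z + A 1 1) z := by fun_prop
  exact h1.div h2 hd

lemma mk_mem_moebiusGroup {a b c d : ℂ} (h : a * d - b * c ≠ 0) :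
    ∃ g ∈ moebiusGroup, (∀ z : ℂ, g z = ofHomogeneous (a * z + b, c * z + d)) ∧
      g OnePoint.infty = ofHomogeneous (a, c) := by
  let A := Matrix.GeneralLinearGroup.mkOfDetNeZero !![a, b; c, d]
    (by rwa [Matrix.det_fin_two_of])
  refine ⟨MulAction.toPermHom _ Sphere A, ⟨A, rfl⟩, fun z => ?_, ?_⟩
  · have := moebius_apply A z
    exact this
  · have := moebius_apply_infty A
    exact this

lemma exists_moebius_apply_eq_infty (p : Sphere) :
    ∃ g ∈ moebiusGroup, g p = OnePoint.infty := by
  induction p using OnePoint.rec with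
  | infty => exact ⟨1, moebiusGroup.one_mem, rfl⟩
  | coe s =>
    obtain ⟨g, hg, h1, -⟩ := mk_mem_moebiusGroup (a := 0) (b := 1) (c := 1) (d := -s) (by simp)
    exact ⟨g, hg, by rw [h1]; simp [ofHomogeneous]⟩

/-! ### Conformal rigidity of the sphere -/

lemma isBounded_range_of_norm_le {f : ℂ → ℂ} (hf : Continuous f) {R C : ℝ}
    (h : ∀ z, R ≤ ‖z‖ → ‖f z‖ ≤ C) : Bornology.IsBounded (Set.range f) := by
  obtain ⟨B, hB⟩ := (isCompact_closedBall (0 : ℂ) R).exists_bound_of_continuousOn hf.continuousOn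
  refine isBounded_iff_forall_norm_le.mpr ⟨max B C, ?_⟩
  rintro _ ⟨z, rfl⟩
  rcases le_total R ‖z‖ with hz | hz
  · exact (h z hz).trans (le_max_right _ _)
  · exact (hB z (by simpa using hz)).trans (le_max_left _ _)

/-- A proper injective entire function is affine. -/
lemma exists_affine_of_injective_entire {f : ℂ → ℂ} (hf : Differentiable ℂ f)
    (hi : Function.Injective f) (ht : Tendsto f (Bornology.cobounded ℂ) (Bornology.cobounded ℂ)) :
    ∃ α β : ℂ, α ≠ 0 ∧ ∀ z, f z = α * z + β := by
  obtain ⟨w, hw⟩ : ∃ w, deriv f w ≠ 0 := by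
    by_contra! h
    exact zero_ne_one (hi (is_const_of_deriv_eq_zero hf h 0 1))
  have hds : ∀ {u : ℂ → ℂ} (c : ℂ), Differentiable ℂ u → Differentiable ℂ (dslope u c) :=
    fun c hu => differentiableOn_univ.mp
      ((Complex.differentiableOn_dslope univ_mem).mpr hu.differentiableOn)
  set q := dslope f w with hq
  have hqd : Differentiable ℂ q := hds w hf
  have hqne : ∀ z, q z ≠ 0 := fun z => by
    by_cases h : z = w
    · rw [h, hq, dslope_same]; exact hw
    · rw [hq, dslope_of_ne _ h, slope_def_field]
      exact div_ne_zero (sub_ne_zero.mpr (hi.ne h)) (sub_ne_zero.mpr h)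
  -- Injectivity and `deriv f w ≠ 0` make the difference quotient zero-free, so `s` is entire.
  -- Properness bounds `|f z - f w|` below, giving `s` linear growth, and Liouville makes it affine.
  set s : ℂ → ℂ := fun z => (q z)⁻¹ with hs
  have hsd : Differentiable ℂ s := hqd.inv hqne
  have htd : Differentiable ℂ (dslope s 0) := hds 0 hsd
  obtain ⟨R, -, hR⟩ := (hasBasis_cobounded_norm (E := ℂ)).eventually_iff.mp
    (ht.eventually ((hasBasis_cobounded_norm (E := ℂ)).mem_of_mem (i := ‖f w‖ + 1) trivial))
  have hb : Bornology.IsBounded (Set.range (dslope s 0)) := by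
    refine isBounded_range_of_norm_le (R := max R (‖w‖ + 1)) (C := 1 + ‖w‖ + ‖s 0‖) htd.continuous
      fun z hz => ?_
    have hz1 : R ≤ ‖z‖ := (le_max_left _ _).trans hz
    have hz2 : ‖w‖ + 1 ≤ ‖z‖ := (le_max_right _ _).trans hz
    have hz3 : 1 ≤ ‖z‖ := by linarith [norm_nonneg w]
    have hz0 : z ≠ 0 := norm_pos_iff.mp (by linarith)
    have hzw : z ≠ w := by rintro rfl; linarith
    have h1 : 1 ≤ ‖f z - f w‖ := by
      have h2 : ‖f w‖ + 1 ≤ ‖f z‖ := hR hz1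
      linarith [norm_sub_norm_le (f z) (f w)]
    have h2 : ‖s z‖ ≤ ‖z‖ + ‖w‖ := by
      rw [hs]
      simp only
      rw [hq, dslope_of_ne _ hzw, slope_def_field, inv_div, norm_div]
      exact (div_le_self (norm_nonneg _) h1).trans (norm_sub_le _ _)
    rw [dslope_of_ne _ hz0, slope_def_field, sub_zero, norm_div, div_le_iff₀ (by linarith)]
    calc ‖s z - s 0‖ ≤ ‖s z‖ + ‖s 0‖ := norm_sub_le _ _
      _ ≤ ‖z‖ + ‖w‖ + ‖s 0‖ := by linarith
      _ ≤ (1 + ‖w‖ + ‖s 0‖) * ‖z‖ := by nlinarith [norm_nonneg w, norm_nonneg (s 0)]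
  set κ := dslope s 0 0 with hκ
  have hsz : ∀ z, s z = s 0 + κ * z := fun z => by
    by_cases h : z = 0
    · rw [h]; ring
    · have h1 := htd.apply_eq_apply_of_bounded hb z 0
      rw [dslope_of_ne _ h, slope_def_field, sub_zero, div_eq_iff h] at h1
      linear_combination h1
  -- A nonconstant affine function has a zero, while `s` is an inverse of nonzero values.
  have hκ0 : κ = 0 := by
    by_contra h
    have h1 := hsz (-s 0 / κ)
    rw [mul_div_cancel₀ _ h, add_neg_cancel] at h1
    exact inv_ne_zero (hqne _) h1
  have hqc : ∀ z, q z = deriv f w := fun z => by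
    have h1 : s z = s w := by rw [hsz z, hsz w, hκ0]; ring
    rw [inv_injective h1, hq, dslope_same]
  refine ⟨deriv f w, f w - deriv f w * w, hw, fun z => ?_⟩
  by_cases h : z = w
  · rw [h]; ring
  · have h1 := hqc z
    rw [hq, dslope_of_ne _ h, slope_def_field, div_eq_iff (sub_ne_zero.mpr h)] at h1
    linear_combination h1

/-- A homeomorphism of the sphere that is holomorphic off a finite set is a Möbius
transformation. -/
theorem mem_moebiusGroup_of_holomorphic (P : Sphere ≃ₜ Sphere) {S : Set ℂ} (hS : S.Finite)
    (h : ∀ z ∉ S, P z ≠ OnePoint.infty → DifferentiableAt ℂ (inCharts id id P) z) :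
    P.toEquiv ∈ moebiusGroup := by
  -- After normalization infinity is fixed, and the finite part of the map is a proper injective
  -- function on the plane.
  obtain ⟨A, hA, hAP⟩ := exists_moebius_apply_eq_infty (P OnePoint.infty)
  set Q : Sphere ≃ₜ Sphere := P.trans (moebiusHomeo hA) with hQ
  have hQA : ∀ x, Q x = A (P x) := fun x => rfl
  have hQinf : Q OnePoint.infty = OnePoint.infty := hAP
  have hQfin : ∀ z : ℂ, Q z ≠ OnePoint.infty := fun z hz =>
    OnePoint.coe_ne_infty z (Q.injective (hz.trans hQinf.symm))
  set f : ℂ → ℂ := fun z => affine (Q z) with hf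
  have hfQ : ∀ z, (f z : Sphere) = Q z := fun z => coe_affine (hQfin z)
  have hfc : Continuous f := by
    rw [continuous_iff_continuousAt]
    intro z
    exact (continuousAt_affine (hQfin z)).comp (f := fun z : ℂ => Q z)
      (Q.continuous.comp OnePoint.continuous_coe).continuousAt
  have hfi : Function.Injective f := fun x y hxy => by
    have := congrArg (fun z : ℂ => (z : Sphere)) hxy
    simp only [hfQ] at this
    exact OnePoint.coe_injective (Q.injective this)
  -- The pole of `P` is also excluded. If `P` fixes infinity the added point is a default value,
  -- which does no harm: continuity makes every point of `S'` removable.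
  set S' : Set ℂ := S ∪ {affine (P.symm OnePoint.infty)} with hS'
  have hS'f : S'.Finite := hS.union (Set.finite_singleton _)
  have hfd : ∀ z ∉ S', DifferentiableAt ℂ f z := fun z hz => by
    have hPz : P z ≠ OnePoint.infty := fun h1 => hz (Or.inr (by
      rw [Set.mem_singleton_iff, ← h1, P.symm_apply_apply, affine_coe]))
    have h1 := h z (fun h2 => hz (Or.inl h2)) hPz
    have h2 : DifferentiableAt ℂ (inCharts id id A) (inCharts id id P z) := by
      refine differentiableAt_moebius hA ?_
      have : ((inCharts id id P z : ℂ) : Sphere) = P z := coe_affine hPz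
      rw [this]
      exact hQfin z
    refine (h2.comp z h1).congr_of_eventuallyEq ?_
    have h3 : ∀ᶠ y : ℂ in 𝓝 z, P y ≠ OnePoint.infty :=
      (P.continuous.comp OnePoint.continuous_coe).continuousAt.eventually_ne hPz
    filter_upwards [h3] with y hy
    simp only [hf, hQA, inCharts, Function.comp, id]
    rw [coe_affine hy]
  have hfent : Differentiable ℂ f := fun z => by
    refine (Complex.analyticAt_of_differentiable_on_punctured_nhds_of_continuousAt ?_
      hfc.continuousAt).differentiableAt
    have h1 : (S' \ {z})ᶜ ∈ 𝓝 z := (hS'f.sdiff.isClosed.isOpen_compl).mem_nhds (by simp)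
    filter_upwards [mem_nhdsWithin_of_mem_nhds h1, self_mem_nhdsWithin] with y hy hyz
    exact hfd y fun h2 => hy ⟨h2, hyz⟩
  have hft : Tendsto f (Bornology.cobounded ℂ) (Bornology.cobounded ℂ) := by
    have h1 : Tendsto (fun z : ℂ => (f z : Sphere)) (Bornology.cobounded ℂ)
        (𝓝 OnePoint.infty) := by
      simp only [hfQ]
      have := (Q.continuous.tendsto OnePoint.infty).comp tendsto_coe_cobounded
      rwa [hQinf] at this
    have h2 : Bornology.cobounded ℂ = comap ((↑) : ℂ → Sphere) (𝓝 OnePoint.infty) := by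
      rw [OnePoint.comap_coe_nhds_infty, coclosedCompact_eq_cocompact,
        Metric.cobounded_eq_cocompact]
    conv_rhs => rw [h2]
    exact tendsto_comap_iff.mpr h1
  obtain ⟨α, β, hα, hαβ⟩ := exists_affine_of_injective_entire hfent hfi hft
  obtain ⟨B, hB, hB1, hB2⟩ := mk_mem_moebiusGroup (a := α) (b := β) (c := 0) (d := 1)
    (by simpa using hα)
  have hBQ : B = A * P.toEquiv := by
    ext x
    change B x = Q x
    induction x using OnePoint.rec with
    | infty => rw [hB2, hQinf]; simp [ofHomogeneous]
    | coe z => rw [hB1, ← hfQ, hαβ]; simp [ofHomogeneous]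
  have : P.toEquiv = A⁻¹ * B := by rw [hBQ, inv_mul_cancel_left]
  rw [this]
  exact moebiusGroup.mul_mem (moebiusGroup.inv_mem hA) hB

/-! ### Invariance of Beltrami coefficients -/

lemma perm_inv_apply_self {X : Type*} (g : Equiv.Perm X) (x : X) : g⁻¹ (g x) = x :=
  g.symm_apply_apply x

lemma coe_inCharts_id {w : Sphere → Sphere} {z : ℂ} (h : w z ≠ OnePoint.infty) :
    ((inCharts id id w z : ℂ) : Sphere) = w z := coe_affine h

lemma inCharts_id_inv_apply {g : Equiv.Perm Sphere} {z : ℂ} (h : g z ≠ OnePoint.infty) :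
    inCharts id id (g⁻¹ : Equiv.Perm Sphere) (inCharts id id g z) = z := by
  simp only [inCharts, id]
  rw [coe_affine h, perm_inv_apply_self, affine_coe]

lemma differentiableAt_moebius_inv {g : Equiv.Perm Sphere} (hg : g ∈ moebiusGroup) {z : ℂ}
    (h : g z ≠ OnePoint.infty) :
    DifferentiableAt ℂ (inCharts id id (g⁻¹ : Equiv.Perm Sphere)) (inCharts id id g z) := by
  refine differentiableAt_moebius (moebiusGroup.inv_mem hg) ?_
  rw [coe_inCharts_id h, perm_inv_apply_self]
  exact OnePoint.coe_ne_infty z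

/-- Möbius transformations pull back null sets to null sets. -/
lemma ae_moebius {g : Equiv.Perm Sphere} (hg : g ∈ moebiusGroup) {p : ℂ → Prop}
    (hp : ∀ᵐ z, p z) : ∀ᵐ z : ℂ, g z ≠ OnePoint.infty → p (inCharts id id g z) := by
  have h := measure_inter_preimage_eq_zero (g := inCharts id id g)
    (h := inCharts id id (g⁻¹ : Equiv.Perm Sphere)) (K := {z : ℂ | g z ≠ OnePoint.infty})
    (N := {z | ¬ p z}) (by rintro _ ⟨z, hz, rfl⟩; exact differentiableAt_moebius_inv hg hz)
    (fun z hz => inCharts_id_inv_apply hz) (ae_iff.mp hp)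
  rw [ae_iff]
  refine measure_mono_null (fun z hz => ?_) h
  simpa using hz

lemma finite_preimage_infty (g : Equiv.Perm Sphere) :
    {z : ℂ | g z = OnePoint.infty}.Subsingleton := fun _ hx _ hy =>
  OnePoint.coe_injective (g.injective (hx.trans hy.symm))

lemma ae_ne_infty (g : Equiv.Perm Sphere) : ∀ᵐ z : ℂ, g z ≠ OnePoint.infty := by
  rw [ae_iff]
  simp only [not_not]
  exact (finite_preimage_infty g).measure_zero _

/-- Since `Δ` is invariant, both sides vanish off `Δ`, so the transformation rule holds on the whole
plane away from the pole of `g`. -/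
lemma ae_transform {G : Subgroup (Equiv.Perm Sphere)} (hG : G ≤ moebiusGroup) {Δ : Set Sphere}
    (hΔ : ∀ g ∈ G, g '' Δ = Δ) {μ : LInfSpace} (hμ : μ ∈ LInf Δ G) {g : Equiv.Perm Sphere}
    (hg : g ∈ G) :
    ∀ᵐ z : ℂ, g z ≠ OnePoint.infty →
      μ (inCharts id id g z) * (starRingEnd ℂ) (deriv (inCharts id id g) z) =
        μ z * deriv (inCharts id id g) z := by
  filter_upwards [hμ.1, hμ.2 g hg, ae_moebius (hG hg) hμ.1] with z h1 h2 h3 hz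
  by_cases hzΔ : (z : Sphere) ∈ Δ
  · exact h2 hzΔ
  · rw [h1 hzΔ, h3 hz, zero_mul, zero_mul]
    rw [coe_inCharts_id hz]
    intro h
    rw [← hΔ g hg] at h
    obtain ⟨y, hy, hyz⟩ := h
    exact hzΔ (g.injective hyz ▸ hy)

lemma deriv_moebius_ne_zero {g : Equiv.Perm Sphere} (hg : g ∈ moebiusGroup) {z : ℂ}
    (h : g z ≠ OnePoint.infty) : deriv (inCharts id id g) z ≠ 0 := by
  have h1 := (differentiableAt_moebius_inv hg h).hasDerivAt.comp z
    (differentiableAt_moebius hg h).hasDerivAt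
  have h2 : inCharts id id (g⁻¹ : Equiv.Perm Sphere) ∘ inCharts id id g =ᶠ[𝓝 z] id := by
    have h3 : ∀ᶠ y : ℂ in 𝓝 z, g y ≠ OnePoint.infty :=
      ((continuous_of_mem_moebiusGroup hg).comp
        OnePoint.continuous_coe).continuousAt.eventually_ne h
    filter_upwards [h3] with y hy
    exact inCharts_id_inv_apply hy
  have h4 := h1.unique ((hasDerivAt_id z).congr_of_eventuallyEq h2)
  intro h0
  rw [h0, mul_zero] at h4
  exact zero_ne_one h4

lemma ae_norm_eq {G : Subgroup (Equiv.Perm Sphere)} (hG : G ≤ moebiusGroup) {Δ : Set Sphere}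
    (hΔ : ∀ g ∈ G, g '' Δ = Δ) {μ : LInfSpace} (hμ : μ ∈ LInf Δ G) {g : Equiv.Perm Sphere}
    (hg : g ∈ G) : ∀ᵐ z : ℂ, g z ≠ OnePoint.infty → ‖μ (inCharts id id g z)‖ = ‖μ z‖ := by
  filter_upwards [ae_transform hG hΔ hμ hg] with z h hz
  have h1 := congrArg norm (h hz)
  rw [norm_mul, norm_mul, RCLike.norm_conj] at h1
  exact mul_right_cancel₀ (norm_ne_zero_iff.mpr (deriv_moebius_ne_zero (hG hg) hz)) h1

/-- The region of discontinuity of an invariant coefficient is invariant. -/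
lemma apply_mem_coeffRegion {G : Subgroup (Equiv.Perm Sphere)} (hG : G ≤ moebiusGroup)
    {Δ : Set Sphere} (hΔ : ∀ g ∈ G, g '' Δ = Δ) {μ : LInfSpace} (hμ : μ ∈ LInf Δ G)
    {g : Equiv.Perm Sphere} (hg : g ∈ G) {x : Sphere} (hx : x ∈ coeffRegion μ) :
    g x ∈ coeffRegion μ := by
  obtain ⟨U, hU, hxU, hlt⟩ := hx
  have hgi := G.inv_mem hg
  have hcont := continuous_of_mem_moebiusGroup (hG hgi)
  refine ⟨(⇑(g⁻¹ : Equiv.Perm Sphere)) ⁻¹' U, hU.preimage hcont, by simpa [perm_inv_apply_self] using hxU, lt_of_le_of_lt ?_ hlt⟩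
  have hm1 : MeasurableSet ((fun z : ℂ => (z : Sphere)) ⁻¹' U) :=
    (hU.preimage OnePoint.continuous_coe).measurableSet
  have hm2 : MeasurableSet ((fun z : ℂ => (z : Sphere)) ⁻¹' ((⇑(g⁻¹ : Equiv.Perm Sphere)) ⁻¹' U)) :=
    ((hU.preimage hcont).preimage OnePoint.continuous_coe).measurableSet
  rw [eLpNorm_exponent_top, eLpNorm_exponent_top]
  set C := eLpNormEssSup μ (volume.restrict ((fun z : ℂ => (z : Sphere)) ⁻¹' U)) with hC
  have h1 : ∀ᵐ z : ℂ, (z : Sphere) ∈ U → ‖μ z‖ₑ ≤ C := by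
    have := enorm_ae_le_eLpNormEssSup μ (volume.restrict ((fun z : ℂ => (z : Sphere)) ⁻¹' U))
    exact (ae_restrict_iff' hm1).mp this
  refine essSup_le_of_ae_le _ ?_
  rw [EventuallyLE, ae_restrict_iff' hm2]
  filter_upwards [ae_moebius (hG hgi) h1, ae_norm_eq hG hΔ hμ hgi, ae_ne_infty g⁻¹]
    with z h2 h3 h4 hz
  have h5 := h2 h4 (by rw [coe_inCharts_id h4]; exact hz)
  rwa [← ofReal_norm, h3 h4, ofReal_norm] at h5

/-! ### Conjugating a Möbius group by a quasiconformal map -/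

lemma isOpen_chartDomain {w : Sphere → Sphere} (hw : Continuous w) :
    IsOpen (chartDomain Set.univ id id w) := by
  have : chartDomain Set.univ id id w = (fun z : ℂ => w z) ⁻¹' {OnePoint.infty}ᶜ := by
    ext z; simp [chartDomain]
  rw [this]
  exact (OnePoint.isClosed_infty.isOpen_compl).preimage (hw.comp OnePoint.continuous_coe)

lemma continuousAt_inCharts {w : Sphere → Sphere} (hw : Continuous w) {z : ℂ}
    (h : w z ≠ OnePoint.infty) : ContinuousAt (inCharts id id w) z :=
  (continuousAt_affine h).comp (f := fun z : ℂ => w z)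
    (hw.comp OnePoint.continuous_coe).continuousAt

/-- In a chart `w ∘ g` factors holomorphically through `w`, since both solve the Beltrami equation
of `μ`; hence `w g w⁻¹` is holomorphic off finitely many points. -/
theorem conj_mem_moebiusGroup {G : Subgroup (Equiv.Perm Sphere)} (hG : G ≤ moebiusGroup)
    {Δ : Set Sphere} (hΔ : ∀ g ∈ G, g '' Δ = Δ) {μ : LInfSpace} (hμ : μ ∈ LInf Δ G)
    {w : Sphere ≃ₜ Sphere} (hw : IsQuasiconformal μ w) {g : Equiv.Perm Sphere} (hg : g ∈ G) :
    ∃ A ∈ moebiusGroup, ∀ x, w (g x) = A (w x) := by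
  have hgM := hG hg
  have hgc := continuous_of_mem_moebiusGroup hgM
  set P : Sphere ≃ₜ Sphere := (w.symm.trans (moebiusHomeo hgM)).trans w with hP
  have hPa : ∀ x, P x = w (g (w.symm x)) := fun x => rfl
  refine ⟨P.toEquiv, ?_, fun x => ?_⟩
  swap
  · change _ = P (w x)
    rw [hPa, w.symm_apply_apply]
  obtain ⟨a, b, hweak, hbel⟩ := hw.beltrami id (Or.inl rfl)
  set f₂ := inCharts id id w with hf₂
  set γ := inCharts id id g with hγ
  set U := chartDomain Set.univ id id w with hUdef
  have hU : IsOpen U := isOpen_chartDomain w.continuous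
  have hUmem : ∀ z : ℂ, z ∈ U ↔ w z ≠ OnePoint.infty := fun z => by simp [hUdef, chartDomain]
  set V : Set ℂ := {z | w z ≠ OnePoint.infty ∧ g z ≠ OnePoint.infty ∧
    w (g z) ≠ OnePoint.infty} with hVdef
  have hne : ∀ {u : Sphere → Sphere}, Continuous u → IsOpen {z : ℂ | u z ≠ OnePoint.infty} :=
    fun hu => (OnePoint.isClosed_infty.isOpen_compl).preimage (hu.comp OnePoint.continuous_coe)
  have hV : IsOpen V := (hne w.continuous).inter ((hne hgc).inter (hne (w.continuous.comp hgc)))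
  have hVU : V ⊆ U := fun z hz => (hUmem z).mpr hz.1
  have hγd : ∀ z ∈ V, DifferentiableAt ℂ γ z := fun z hz => differentiableAt_moebius hgM hz.2.1
  have hγU : ∀ z ∈ V, γ z ∈ U := fun z hz => by
    rw [hUmem, hγ, coe_inCharts_id hz.2.1]
    exact hz.2.2
  have hf₂c : ContinuousOn f₂ U := fun z hz =>
    (continuousAt_inCharts w.continuous ((hUmem z).mp hz)).continuousWithinAt
  have hf₂i : Set.InjOn f₂ U := fun x hx y hy hxy => by
    have := congrArg (fun z : ℂ => (z : Sphere)) hxy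
    simp only [hf₂] at this
    rw [coe_inCharts_id ((hUmem x).mp hx), coe_inCharts_id ((hUmem y).mp hy)] at this
    exact OnePoint.coe_injective (w.injective this)
  have hγc : ContinuousOn γ V := fun z hz => (hγd z hz).continuousAt.continuousWithinAt
  have hμ1 : ∀ᵐ z : ℂ, ‖μ z‖ ≤ 1 := by
    have h1 := enorm_ae_le_eLpNormEssSup μ (volume : Measure ℂ)
    filter_upwards [h1] with z hz
    have h2 := hw.norm_lt_one
    rw [Lp.norm_def, eLpNorm_exponent_top] at h2
    have h3 := ENNReal.toReal_mono (by
      have := Lp.eLpNorm_ne_top μ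
      rwa [eLpNorm_exponent_top] at this) hz
    rw [toReal_enorm] at h3
    exact h3.trans h2.le
  -- Exactly the values for which the point `w⁻¹ c`, or its image under `g`, is infinity and leaves
  -- the affine chart. A default value merely enlarges the exceptional set.
  set S : Set ℂ := {affine (w OnePoint.infty), affine (w (g⁻¹ OnePoint.infty))} with hS
  refine mem_moebiusGroup_of_holomorphic P (Set.toFinite S) fun c hc hPc => ?_
  have hx1 : w.symm c ≠ OnePoint.infty := fun h => hc (Or.inl (by
    rw [← h, w.apply_symm_apply, affine_coe]))
  set z₀ := affine (w.symm c) with hz₀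
  have hz₀c : (z₀ : Sphere) = w.symm c := coe_affine hx1
  have hwz₀ : w z₀ = c := by rw [hz₀c, w.apply_symm_apply]
  have hz₀V : z₀ ∈ V := by
    refine ⟨by rw [hwz₀]; exact OnePoint.coe_ne_infty c, fun h => hc (Or.inr ?_), ?_⟩
    · rw [Set.mem_singleton_iff, ← h, perm_inv_apply_self, hwz₀, affine_coe]
    · rw [hz₀c]; exact hPc
  have hf₂z₀ : f₂ z₀ = c := by rw [hf₂, inCharts, id, id, hwz₀, affine_coe]
  have hwind : WindsOnceAt f₂ z₀ :=
    hw.orientation id (Or.inl rfl) id (Or.inl rfl) z₀ (hVU hz₀V)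
      ⟨U, hU.mem_nhds (hVU hz₀V), hf₂i⟩
  obtain ⟨Φ, hΦ, hΦf⟩ := exists_holomorphic_factor hV (f₁ := fun z => f₂ (γ z))
    (a₁ := fun z => a (γ z) * deriv γ z) (b₁ := fun z => b (γ z) * (starRingEnd ℂ) (deriv γ z))
    (a₂ := a) (b₂ := b) hz₀V (hf₂c.comp hγc hγU) (hf₂c.mono hVU) (hf₂i.mono hVU) hwind
    (fun K hKV hK => by
      obtain ⟨F, hF, hs⟩ := exists_sobolevApprox hU hweak hf₂c
        (hK.image_of_continuousOn (hγc.mono hKV)) (by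
          rintro _ ⟨z, hz, rfl⟩; exact hγU z (hKV hz))
      refine ⟨fun n z => F n (γ z), fun n z hz => ?_, hs.comp_holomorphic hK
        (h := inCharts id id (g⁻¹ : Equiv.Perm Sphere)) (fun z hz => hγd z (hKV hz)) ?_
        (fun z hz => inCharts_id_inv_apply (hKV hz).2.1) (fun n => (hF n).differentiable (by simp))⟩
      · have h1 : AnalyticAt ℂ γ z :=
          DifferentiableOn.analyticAt (fun y hy => (hγd y hy).differentiableWithinAt)
            (hV.mem_nhds (hKV hz))
        have h2 : ContDiffAt ℝ 1 γ z := h1.contDiffAt.restrict_scalars ℝ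
        exact ContDiffAt.comp z (((hF n).of_le (by norm_cast)).contDiffAt) h2
      · rintro _ ⟨z, hz, rfl⟩
        exact differentiableAt_moebius_inv hgM (hKV hz).2.1)
    (fun K hKV hK => by
      obtain ⟨F, hF, hs⟩ := exists_sobolevApprox hU hweak hf₂c hK (hKV.trans hVU)
      exact ⟨F, fun n => (hF n).of_le (by norm_cast), hs⟩)
    (by
      -- The invariance of `μ` is precisely the condition that the Beltrami equation at `γ z`,
      -- multiplied by the derivatives of `γ`, is the equation at `z`.
      filter_upwards [hbel, ae_moebius hgM hbel, ae_transform hG hΔ hμ hg] with z h1 h2 h3 hz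
      rw [h1 (hVU hz), h2 hz.2.1 (hγU z hz)]
      linear_combination (-(a (γ z)) * a z) * h3 hz.2.1)
    (by
      filter_upwards [hbel, hμ1] with z h1 h2 hz
      rw [h1 (hVU hz), norm_mul]
      exact mul_le_of_le_one_left (norm_nonneg _) h2)
  rw [hf₂z₀] at hΦ
  refine hΦ.congr_of_eventuallyEq ?_
  have hcont : ContinuousAt (fun y : ℂ => affine (w.symm y)) c :=
    continuousAt_inCharts w.symm.continuous hx1
  have hev : ∀ᶠ y : ℂ in 𝓝 c, w.symm y ≠ OnePoint.infty :=
    (w.symm.continuous.comp OnePoint.continuous_coe).continuousAt.eventually_ne hx1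
  filter_upwards [hev, hcont.eventually hΦf, hcont.eventually (hV.mem_nhds hz₀V)] with y h1 h2 h3
  have h4 : ((affine (w.symm y) : ℂ) : Sphere) = w.symm y := coe_affine h1
  have h5 : f₂ (affine (w.symm y)) = y := by
    rw [hf₂, inCharts, id, id, h4, w.apply_symm_apply, affine_coe]
  rw [h5] at h2
  rw [← h2, hf₂, hγ]
  simp only [inCharts, id]
  rw [h4, coe_affine (by rw [← h4]; exact h3.2.1)]
  rfl

/-! ### Topology of the sphere -/

/-- Local connectedness is transported from the round sphere in `ℝ³`, which is a manifold. It is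
used to show that limits of homeomorphisms are open. -/
lemma locallyConnectedSpace_sphere : LocallyConnectedSpace Sphere := by
  have h : Module.finrank ℝ ℂ + 1 = Fintype.card (Fin 3) := by
    rw [Complex.finrank_real_complex, Fintype.card_fin]
  have : Fact (Module.finrank ℝ (EuclideanSpace ℝ (Fin 3)) = 2 + 1) := ⟨by simp⟩
  have : LocallyConnectedSpace (Metric.sphere (0 : EuclideanSpace ℝ (Fin 3)) 1) :=
    ChartedSpace.locallyConnectedSpace (EuclideanSpace ℝ (Fin 2)) _
  exact (onePointEquivSphereOfFinrankEq (ι := Fin 3) (V := ℂ) h).locallyConnectedSpace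

lemma continuous_stereo : Continuous stereo := by
  have hpos : ∀ z : ℂ, 1 + ‖z‖ ^ 2 ≠ 0 := fun z => by positivity
  rw [OnePoint.continuous_iff, coclosedCompact_eq_cocompact, ← Metric.cobounded_eq_cocompact]
  constructor
  · have hn : Tendsto (fun z : ℂ => ‖z‖) (Bornology.cobounded ℂ) atTop :=
      tendsto_norm_cobounded_atTop
    have hsq : Tendsto (fun z : ℂ => 2 / (1 + ‖z‖ ^ 2)) (Bornology.cobounded ℂ) (𝓝 0) :=
      tendsto_const_nhds.div_atTop
        (tendsto_atTop_add_const_left _ _ ((tendsto_pow_atTop two_ne_zero).comp hn))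
    have hinv : Tendsto (fun z : ℂ => 2 / ‖z‖) (Bornology.cobounded ℂ) (𝓝 0) :=
      tendsto_const_nhds.div_atTop hn
    have hpart : ∀ l : ℂ → ℝ, (∀ z, |l z| ≤ ‖z‖) →
        Tendsto (fun z : ℂ => 2 * l z / (1 + ‖z‖ ^ 2)) (Bornology.cobounded ℂ) (𝓝 0) := by
      intro l hl
      refine squeeze_zero_norm' ?_ hinv
      filter_upwards [hn.eventually_gt_atTop 0] with z hz
      rw [Real.norm_eq_abs, abs_div, abs_mul, abs_two, abs_of_pos (by positivity : 0 < 1 + ‖z‖ ^ 2),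
        div_le_div_iff₀ (by positivity) hz]
      nlinarith [hl z, abs_nonneg (l z)]
    refine (PiLp.continuous_toLp 2 _).continuousAt.tendsto.comp (f := fun z : ℂ =>
      ![2 * z.re / (1 + ‖z‖ ^ 2), 2 * z.im / (1 + ‖z‖ ^ 2), (‖z‖ ^ 2 - 1) / (1 + ‖z‖ ^ 2)])
      (y := 𝓝 ![0, 0, 1]) ?_
    rw [tendsto_pi_nhds]
    intro i
    fin_cases i
    · exact hpart Complex.re fun z => Complex.abs_re_le_norm z
    · exact hpart Complex.im fun z => Complex.abs_im_le_norm z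
    · have h := hsq.const_sub 1
      rw [sub_zero] at h
      refine h.congr fun z => ?_
      simp only [Fin.reduceFinMk, Matrix.cons_val]
      rw [eq_div_iff (hpos z), sub_mul, div_mul_cancel₀ _ (hpos z)]
      ring
  · refine (PiLp.continuous_toLp 2 _).comp (continuous_pi fun i => ?_)
    fin_cases i
    · exact (by fun_prop : Continuous fun z : ℂ => 2 * z.re).div (by fun_prop) hpos
    · exact (by fun_prop : Continuous fun z : ℂ => 2 * z.im).div (by fun_prop) hpos
    · exact (by fun_prop : Continuous fun z : ℂ => ‖z‖ ^ 2 - 1).div (by fun_prop) hpos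

lemma stereo_injective : Function.Injective stereo := by
  have key : ∀ z : ℂ, stereo z ≠ stereo OnePoint.infty := fun z h => by
    have h2 := congrFun (congrArg WithLp.ofLp h) 2
    have hz : 1 + ‖z‖ ^ 2 ≠ 0 := by positivity
    simp [stereo] at h2
    rw [div_eq_iff hz] at h2
    linarith
  intro x y h
  induction x using OnePoint.rec with
  | infty =>
    induction y using OnePoint.rec with
    | infty => rfl
    | coe z => exact absurd h.symm (key z)
  | coe z =>
    induction y using OnePoint.rec with
    | infty => exact absurd h (key z)
    | coe w =>
      have h0 := congrFun (congrArg WithLp.ofLp h) 0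
      have h1 := congrFun (congrArg WithLp.ofLp h) 1
      have h2 := congrFun (congrArg WithLp.ofLp h) 2
      simp [stereo] at h0 h1 h2
      have hz : 1 + ‖z‖ ^ 2 ≠ 0 := by positivity
      have hw : 1 + ‖w‖ ^ 2 ≠ 0 := by positivity
      have hn : ‖z‖ ^ 2 = ‖w‖ ^ 2 := by
        rw [div_eq_div_iff hz hw] at h2
        linarith
      rw [hn, div_left_inj' hw] at h0 h1
      exact congrArg _ (Complex.ext (by linarith) (by linarith))

lemma isClosedEmbedding_stereo : IsClosedEmbedding stereo :=
  continuous_stereo.isClosedEmbedding stereo_injective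

/-- A locally uniform limit of homeomorphisms is open at every point that is isolated in its
fibre. -/
theorem image_mem_nhds_of_tendsto {X E : Type*} [TopologicalSpace X] [T2Space X]
    [LocallyCompactSpace X] [LocallyConnectedSpace X] [PseudoMetricSpace E] [T2Space E] {e : X → E}
    (he : IsEmbedding e) {v : ℕ → X ≃ₜ X} {w : X → X} (hw : Continuous w) {Ω : Set X}
    (hΩ : IsOpen Ω)
    (hv : TendstoLocallyUniformlyOn (fun n x => e (v n x)) (fun x => e (w x)) atTop Ω)
    (hi : Set.InjOn w Ω) {x : X} (hx : x ∈ Ω) {U : Set X} (hU : U ∈ 𝓝 x) :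
    w '' U ∈ 𝓝 (w x) := by
  obtain ⟨D, hD, hDU, hDc⟩ := local_compact_nhds (inter_mem hU (hΩ.mem_nhds hx))
  have hDcl := hDc.isClosed
  have hvD := (tendstoLocallyUniformlyOn_iff_tendstoUniformlyOn_of_compact hDc).mp
    (hv.mono (hDU.trans Set.inter_subset_right))
  rw [Metric.tendstoUniformlyOn_iff] at hvD
  have hfr : frontier D ⊆ D := hDcl.frontier_subset
  have hxint : x ∈ interior D := mem_interior_iff_mem_nhds.mpr hD
  have hK : IsCompact ((fun y => e (w y)) '' frontier D) :=
    (hDc.of_isClosed_subset isClosed_frontier hfr).image (he.continuous.comp hw)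
  have hxK : e (w x) ∈ ((fun y => e (w y)) '' frontier D)ᶜ := by
    rintro ⟨y, hy, hyx⟩
    have := hi (hDU (hfr hy)).2 hx (he.injective hyx)
    exact hy.2 (this ▸ hxint)
  -- On `frontier D` the map `w` stays `ε` away from `w x`; halving it leaves room both for the
  -- approximation error and for the size of `B`.
  obtain ⟨ε, hε, hball⟩ := Metric.isOpen_iff.mp hK.isClosed.isOpen_compl _ hxK
  obtain ⟨B, hB, hBp, hBb⟩ := locallyConnectedSpace_iff_connected_subsets.mp inferInstance (w x)
    (e ⁻¹' Metric.ball (e (w x)) (ε / 2))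
    (he.continuous.continuousAt (Metric.ball_mem_nhds _ (half_pos hε)))
  have hvx : Tendsto (fun n => v n x) atTop (𝓝 (w x)) :=
    he.tendsto_nhds_iff.mpr (hv.tendsto_at hx)
  -- The preimage of the connected set `B` under `v n` contains `x` and cannot cross `frontier D`,
  -- so it is trapped in `D`.
  have hsub : ∀ᶠ n in atTop, ∀ p ∈ B, (v n).symm p ∈ D := by
    filter_upwards [hvD (ε / 2) (half_pos hε), hvx.eventually hB] with n h1 h2
    have hS : IsPreconnected ((v n).symm '' B) := hBp.image _ (v n).symm.continuous.continuousOn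
    have h3 : (v n).symm '' B ⊆ interior D := by
      refine hS.subset_of_closure_inter_subset isOpen_interior
        ⟨x, ⟨v n x, h2, (v n).symm_apply_apply x⟩, hxint⟩ ?_
      rintro _ ⟨hy, p, hp, rfl⟩
      by_contra hyi
      have hyD : (v n).symm p ∈ D := hDcl.closure_interior_subset hy
      have hyf : (v n).symm p ∈ frontier D := ⟨subset_closure hyD, hyi⟩
      have h4 := h1 _ hyD
      rw [(v n).apply_symm_apply] at h4
      have h5 : dist (e p) (e (w x)) < ε / 2 := hBb hp
      refine hball ?_ ⟨_, hyf, rfl⟩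
      rw [Metric.mem_ball]
      calc dist (e (w ((v n).symm p))) (e (w x)) ≤ _ + dist (e p) (e (w x)) := dist_triangle _ _ _
        _ < ε := by linarith
    exact fun p hp => interior_subset (h3 ⟨p, hp, rfl⟩)
  refine mem_of_superset hB fun p hp => ?_
  have hcl : IsClosed ((fun y => e (w y)) '' D) := (hDc.image (he.continuous.comp hw)).isClosed
  -- The preimages of `p` stay in `D`, where `v n` is uniformly close to `w`; compactness of the
  -- image of `D` then puts `p` in `w '' D`.
  have hlim : Tendsto (fun n => e (w ((v n).symm p))) atTop (𝓝 (e p)) := by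
    rw [Metric.tendsto_nhds]
    intro δ hδ
    filter_upwards [hvD δ hδ, hsub] with n h1 h2
    have := h1 _ (h2 p hp)
    rwa [(v n).apply_symm_apply] at this
  obtain ⟨y, hy, hyp⟩ := hcl.mem_of_tendsto hlim (by
    filter_upwards [hsub] with n h2
    exact ⟨_, h2 p hp, rfl⟩)
  exact ⟨y, (hDU hy).1, he.injective hyp⟩

/-! ### A degree argument -/

lemma tendsto_circle_uniformly {F : ℂ → ℂ} (hF : Continuous F) (z₀ : ℂ) (r : ℝ) {ε : ℝ}
    (hε : 0 < ε) : ∀ᶠ s : ℝ in 𝓝 r, ∀ t : ℝ,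
      ‖F (z₀ + s * Complex.exp (t * Complex.I)) - F (z₀ + r * Complex.exp (t * Complex.I))‖ < ε := by
  have h := Continuous.tendstoUniformly (fun (s : ℝ) (u : Circle) => F (z₀ + s * (u : ℂ)))
    (hF.comp (by fun_prop)) r
  rw [Metric.tendstoUniformly_iff] at h
  filter_upwards [h ε hε] with s hs t
  have := hs (Circle.exp t)
  rwa [Circle.coe_exp, dist_comm, dist_eq_norm] at this

/-- Nearby circles have uniformly close images, while on the given circle `|F|` is bounded below;
Rouché applies in both directions. -/
lemma windsOnce_iff_eventually {F : ℂ → ℂ} (hF : Continuous F) {z₀ : ℂ}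
    (hne : ∀ z, z ≠ z₀ → F z ≠ 0) {r : ℝ} (hr : 0 < r) : ∀ᶠ s : ℝ in 𝓝 r,
      (WindsOnce (fun t => F (z₀ + s * Complex.exp (t * Complex.I))) ↔
        WindsOnce fun t => F (z₀ + r * Complex.exp (t * Complex.I))) := by
  have hc : ∀ s : ℝ, Continuous fun t : ℝ => F (z₀ + s * Complex.exp (t * Complex.I)) :=
    fun s => hF.comp (by fun_prop)
  have hper : ∀ s : ℝ, F (z₀ + s * Complex.exp ((2 * Real.pi : ℝ) * Complex.I)) =
      F (z₀ + s * Complex.exp ((0 : ℝ) * Complex.I)) := fun s => by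
    push_cast
    rw [Complex.exp_two_pi_mul_I, zero_mul, Complex.exp_zero]
  obtain ⟨m, hm, hmle⟩ : ∃ m > 0, ∀ t : ℝ, m ≤ ‖F (z₀ + r * Complex.exp (t * Complex.I))‖ := by
    obtain ⟨u, -, hu⟩ := isCompact_univ.exists_isMinOn (s := (Set.univ : Set Circle))
      Set.univ_nonempty (f := fun u : Circle => ‖F (z₀ + r * (u : ℂ))‖)
      (Continuous.continuousOn (hF.comp (by fun_prop)).norm)
    refine ⟨_, norm_pos_iff.mpr (hne (z₀ + r * (u : ℂ)) ?_), fun t => ?_⟩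
    · simp [hr.ne']
    · have := isMinOn_iff.mp hu (Circle.exp t) trivial
      rwa [Circle.coe_exp] at this
  filter_upwards [tendsto_circle_uniformly hF z₀ r (half_pos hm)] with s hs
  constructor
  · intro h
    refine h.of_norm_sub_lt (hc r) (hper r) fun t => ?_
    have h1 := hs t
    have h2 := hmle t
    rw [norm_sub_rev] at h1 ⊢
    have h3 := norm_sub_norm_le (F (z₀ + r * Complex.exp (t * Complex.I)))
      (F (z₀ + s * Complex.exp (t * Complex.I)))
    rw [norm_sub_rev]
    linarith
  · intro h
    refine h.of_norm_sub_lt (hc s) (hper s) fun t => ?_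
    linarith [hs t, hmle t]

/-- A continuous self-map of the sphere with a point of local degree one that is alone in its fibre
is surjective. -/
theorem surjective_of_windsOnceAt {w : Sphere → Sphere} (hw : Continuous w) {z₀ : ℂ}
    (h0 : w z₀ ≠ OnePoint.infty) (huniq : ∀ y, w y = w z₀ → y = z₀)
    (hwind : WindsOnceAt (inCharts id id w) z₀) : Function.Surjective w := by
  by_contra hsurj
  rw [Function.Surjective] at hsurj
  push Not at hsurj
  obtain ⟨p, hp⟩ := hsurj
  set ζ₀ := affine (w z₀) with hζ₀
  have hζ₀w : (ζ₀ : Sphere) = w z₀ := coe_affine h0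
  -- An omitted value `p` is sent to infinity and `w z₀` to the origin, so `A ∘ w` becomes a
  -- continuous complex function on the whole sphere with `z₀` as its only zero.
  obtain ⟨A, hA, c, d, hcd, hAz, hAp⟩ : ∃ A ∈ moebiusGroup, ∃ c d : ℂ, c * ζ₀ + d ≠ 0 ∧
      (∀ z : ℂ, A z = ofHomogeneous (z - ζ₀, c * z + d)) ∧ A p = OnePoint.infty := by
    induction p using OnePoint.rec with
    | infty =>
      obtain ⟨A, hA, h1, h2⟩ := mk_mem_moebiusGroup (a := 1) (b := -ζ₀) (c := 0) (d := 1) (by simp)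
      exact ⟨A, hA, 0, 1, by simp, fun z => by rw [h1, one_mul, ← sub_eq_add_neg],
        by rw [h2]; simp [ofHomogeneous]⟩
    | coe s =>
      have hs : ζ₀ - s ≠ 0 := fun h => hp z₀ (by rw [← hζ₀w, sub_eq_zero.mp h])
      obtain ⟨A, hA, h1, h2⟩ := mk_mem_moebiusGroup (a := 1) (b := -ζ₀) (c := 1) (d := -s)
        (by convert hs using 1; ring)
      exact ⟨A, hA, 1, -s, by convert hs using 1; ring,
        fun z => by rw [h1, one_mul, ← sub_eq_add_neg], by rw [h1]; simp [ofHomogeneous]⟩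
  have hAc := continuous_of_mem_moebiusGroup hA
  have hAne : ∀ x, A (w x) ≠ OnePoint.infty := fun x h => hp x (A.injective (h.trans hAp.symm))
  set F : Sphere → ℂ := fun x => affine (A (w x)) with hF
  have hFc : Continuous F := continuous_iff_continuousAt.mpr fun x =>
    (continuousAt_affine (hAne x)).comp (f := fun x => A (w x)) (hAc.comp hw).continuousAt
  have hAz₀ : A (w z₀) = ((0 : ℂ) : Sphere) := by
    rw [← hζ₀w, hAz]
    simp [ofHomogeneous, hcd]
  have hF0 : ∀ x, F x = 0 → x = z₀ := fun x hx => by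
    refine huniq x (A.injective ?_)
    rw [hAz₀, ← coe_affine (hAne x)]
    exact congrArg _ hx
  set f := inCharts id id w with hf
  have hfz₀ : f z₀ = ζ₀ := rfl
  have hFf : ∀ z : ℂ, w z ≠ OnePoint.infty → F (z : Sphere) = (f z - f z₀) * (c * f z + d)⁻¹ := fun z hz => by
    have h1 : ((f z : ℂ) : Sphere) = w z := coe_affine hz
    have h2 := hAne z
    have h3 : F (z : Sphere) = affine (A (f z)) := by rw [h1]
    rw [← h1, hAz] at h2
    have h4 : c * f z + d ≠ 0 := fun h => h2 (if_pos h)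
    rw [h3, hAz, hfz₀]
    simp [ofHomogeneous, h4, affine_coe, div_eq_mul_inv]
  set g : ℂ → ℂ := fun z => F (z : Sphere) with hg
  have hgc : Continuous g := hFc.comp OnePoint.continuous_coe
  have hgne : ∀ z, z ≠ z₀ → g z ≠ 0 := fun z hz h => hz (OnePoint.coe_injective (hF0 z h))
  -- On small circles `g` differs from `f - f z₀` by a factor close to a nonzero constant.
  have hsmall : ∃ r : ℝ, 0 < r ∧ WindsOnce fun t => g (z₀ + r * Complex.exp (t * Complex.I)) := by
    have hu : ContinuousAt (fun z => (c * f z + d)⁻¹) z₀ := by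
      have : ContinuousAt f z₀ := continuousAt_inCharts hw h0
      exact ((continuousAt_const.mul this).add continuousAt_const).inv₀ hcd
    have hN : {z : ℂ | w z ≠ OnePoint.infty} ∈ 𝓝 z₀ :=
      (hw.comp OnePoint.continuous_coe).continuousAt.eventually_ne h0
    have hpos : 0 < ‖(c * f z₀ + d)⁻¹‖ := norm_pos_iff.mpr (inv_ne_zero hcd)
    have he : ∀ᶠ z : ℂ in 𝓝 z₀, w z ≠ OnePoint.infty ∧
        ‖(c * f z + d)⁻¹ - (c * f z₀ + d)⁻¹‖ < ‖(c * f z₀ + d)⁻¹‖ := by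
      filter_upwards [hN, Metric.tendsto_nhds.mp hu _ hpos] with z h1 h2
      exact ⟨h1, by rwa [dist_eq_norm] at h2⟩
    obtain ⟨δ, hδ, hball⟩ := Metric.eventually_nhds_iff.mp he
    obtain ⟨r, hr, hr0, hrδ⟩ := (hwind.and (Ioo_mem_nhdsGT hδ)).exists
    have hin : ∀ t : ℝ, dist (z₀ + r * Complex.exp (t * Complex.I)) z₀ < δ := fun t => by
      rw [dist_eq_norm, add_sub_cancel_left, norm_mul, Complex.norm_exp_ofReal_mul_I, mul_one,
        Complex.norm_real, Real.norm_eq_abs, abs_of_pos hr0]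
      exact hrδ
    refine ⟨r, hr0, ?_⟩
    have hr' : WindsOnce fun t => f (z₀ + r * Complex.exp (t * Complex.I)) - f z₀ := hr
    have hne : ∀ t : ℝ, c * f (z₀ + r * Complex.exp (t * Complex.I)) + d ≠ 0 := fun t h => by
      have h1 := (hball (hin t)).2
      rw [h] at h1
      simp at h1
    have hfc : Continuous fun t : ℝ => f (z₀ + r * Complex.exp (t * Complex.I)) :=
      continuous_iff_continuousAt.mpr fun t =>
        (continuousAt_inCharts hw (hball (hin t)).1).comp
          (f := fun t : ℝ => z₀ + r * Complex.exp (t * Complex.I)) (by fun_prop)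
    have h2 := hr'.mul_of_norm_sub_lt
      (u := fun t => (c * f (z₀ + r * Complex.exp (t * Complex.I)) + d)⁻¹)
      (c := (c * f z₀ + d)⁻¹) (((continuous_const.mul hfc).add continuous_const).inv₀ hne)
      (by
        push_cast
        rw [Complex.exp_two_pi_mul_I, zero_mul, Complex.exp_zero]) fun t => (hball (hin t)).2
    refine (congrArg WindsOnce (funext fun t => ?_)).mpr h2
    exact hFf _ (hball (hin t)).1
  -- Large circles have images clustering near the nonzero value at infinity, hence do not wind.
  have hlarge : ∃ r : ℝ, 0 < r ∧ ¬ WindsOnce fun t => g (z₀ + r * Complex.exp (t * Complex.I)) := by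
    have hFi : F OnePoint.infty ≠ 0 := fun h => OnePoint.infty_ne_coe z₀ (hF0 _ h)
    have h1 : Tendsto g (Bornology.cobounded ℂ) (𝓝 (F OnePoint.infty)) :=
      (hFc.tendsto _).comp tendsto_coe_cobounded
    obtain ⟨R, -, hR⟩ := (hasBasis_cobounded_norm (E := ℂ)).eventually_iff.mp
      (Metric.tendsto_nhds.mp h1 _ (norm_pos_iff.mpr hFi))
    refine ⟨|R| + ‖z₀‖ + 1, by positivity, ?_⟩
    refine not_windsOnce_of_norm_sub_lt (c := F OnePoint.infty) fun t => ?_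
    rw [← dist_eq_norm]
    refine hR ?_
    have h2 : ‖(((|R| + ‖z₀‖ + 1 : ℝ) : ℂ)) * Complex.exp (t * Complex.I)‖ = |R| + ‖z₀‖ + 1 := by
      rw [norm_mul, Complex.norm_exp_ofReal_mul_I, mul_one, Complex.norm_real, Real.norm_eq_abs,
        abs_of_pos (by positivity)]
    have h3 := norm_sub_norm_le ((((|R| + ‖z₀‖ + 1 : ℝ) : ℂ)) * Complex.exp (t * Complex.I)) (-z₀)
    rw [norm_neg, sub_neg_eq_add, add_comm _ z₀, h2] at h3
    have h4 : R ≤ |R| + ‖z₀‖ + 1 - ‖z₀‖ := by linarith [le_abs_self R]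
    exact h4.trans h3
  obtain ⟨r₁, hr₁, hw₁⟩ := hsmall
  obtain ⟨r₂, hr₂, hw₂⟩ := hlarge
  set S : Set ℝ := {r | 0 < r ∧ WindsOnce fun t => g (z₀ + r * Complex.exp (t * Complex.I))}
  set T : Set ℝ := {r | 0 < r ∧ ¬ WindsOnce fun t => g (z₀ + r * Complex.exp (t * Complex.I))}
  have hS : IsOpen S := isOpen_iff_mem_nhds.mpr fun r hr => by
    filter_upwards [windsOnce_iff_eventually hgc hgne hr.1, lt_mem_nhds hr.1] with s h1 h2
    exact ⟨h2, h1.mpr hr.2⟩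
  have hT : IsOpen T := isOpen_iff_mem_nhds.mpr fun r hr => by
    filter_upwards [windsOnce_iff_eventually hgc hgne hr.1, lt_mem_nhds hr.1] with s h1 h2
    exact ⟨h2, fun h => hr.2 (h1.mp h)⟩
  -- Connectedness of the set of radii forbids the change from winding once to not doing so.
  obtain ⟨r, -, h1, h2⟩ := isPreconnected_Ioi (a := (0 : ℝ)) S T hS hT
    (fun r hr => (em _).imp (fun h => ⟨hr, h⟩) fun h => ⟨hr, h⟩)
    ⟨r₁, hr₁, hr₁, hw₁⟩ ⟨r₂, hr₂, hr₂, hw₂⟩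
  exact h2.2 h1.2

/-! ### Topology of noded deformations -/

lemma isOpen_coeffRegion (μ : LInfSpace) : IsOpen (coeffRegion μ) := by
  refine isOpen_iff_mem_nhds.mpr ?_
  rintro x ⟨U, hU, hx, h⟩
  exact mem_of_superset (hU.mem_nhds hx) fun y hy => ⟨U, hU, hy, h⟩

/-- The finite points of an open subset of the sphere at which a map is finite form an infinite
set if the map is injective there. -/
lemma infinite_finite_points {w : Sphere → Sphere} {Ω : Set Sphere} (hΩ : IsOpen Ω)
    (hne : Ω.Nonempty) (hi : Set.InjOn w Ω) :
    {z : ℂ | (z : Sphere) ∈ Ω ∧ w z ≠ OnePoint.infty}.Infinite := by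
  obtain ⟨z, hz⟩ : ∃ z : ℂ, (z : Sphere) ∈ Ω := by
    obtain ⟨x, hx, z, rfl⟩ := OnePoint.denseRange_coe.inter_open_nonempty Ω hΩ hne
    exact ⟨z, hx⟩
  have h1 : {z : ℂ | (z : Sphere) ∈ Ω}.Infinite :=
    infinite_of_mem_nhds z ((hΩ.preimage OnePoint.continuous_coe).mem_nhds hz)
  have h2 : {z : ℂ | (z : Sphere) ∈ Ω ∧ w z = OnePoint.infty}.Subsingleton :=
    fun x hx y hy => OnePoint.coe_injective (hi hx.1 hy.1 (hx.2.trans hy.2.symm))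
  refine (h1.sdiff h2.finite).mono fun x hx => ⟨hx.1, fun h => hx.2 ⟨hx.1, h⟩⟩

namespace IsNodedDeformationAlong

variable {Δ : Set Sphere} {G : Subgroup (Equiv.Perm Sphere)} {μ : LInfSpace}
  {F : Set (Set Sphere)} {w : Sphere → Sphere}

lemma injOn_coeffRegion (hw : IsNodedDeformationAlong Δ G μ F w) :
    Set.InjOn w (coeffRegion μ) :=
  hw.injOn.mono fun x hx => by
    intro hxF
    have : x ∈ coeffLimitSet μ := by
      rw [hw.family.limitSet]
      exact subset_closure hxF
    exact this hx

lemma image_mem_nhds (hw : IsNodedDeformationAlong Δ G μ F w) {x : Sphere}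
    (hx : x ∈ coeffRegion μ) {U : Set Sphere} (hU : U ∈ 𝓝 x) : w '' U ∈ 𝓝 (w x) := by
  obtain ⟨ν, v, -, -, -, hv⟩ := hw.noded.approx
  have := locallyConnectedSpace_sphere
  exact image_mem_nhds_of_tendsto isClosedEmbedding_stereo.isEmbedding hw.continuous
    (isOpen_coeffRegion μ) hv hw.injOn_coeffRegion hx hU

/-- If `y ≠ x` had the same image, points of the dense set `Ω(μ)` near `y` would map into the image
of a small neighbourhood of `x`, which is a neighbourhood of `w x`; injectivity on `Ω(μ)` would
place them near `x` as well. -/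
lemma eq_of_apply_eq (hw : IsNodedDeformationAlong Δ G μ F w) {x y : Sphere}
    (hx : x ∈ coeffRegion μ) (h : w y = w x) : y = x := by
  by_contra hne
  obtain ⟨A, B, hA, hB, hxA, hyB, hAB⟩ := t2_separation (Ne.symm hne)
  have h1 := hw.image_mem_nhds hx
    (inter_mem (hA.mem_nhds hxA) ((isOpen_coeffRegion μ).mem_nhds hx))
  rw [← h] at h1
  have h2 := inter_mem (hw.continuous.continuousAt.preimage_mem_nhds h1) (hB.mem_nhds hyB)
  obtain ⟨z, hzΩ, ⟨a, ha, haz⟩, hzB⟩ := hw.family.dense.inter_nhds_nonempty h2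
  exact Set.disjoint_left.mp hAB (hw.injOn_coeffRegion ha.2 hzΩ haz ▸ ha.1) hzB

lemma surjective (hw : IsNodedDeformationAlong Δ G μ F w) : Function.Surjective w := by
  have hΩ := isOpen_coeffRegion μ
  obtain ⟨z, hz, hwz⟩ := (infinite_finite_points hΩ hw.family.dense.nonempty
    hw.injOn_coeffRegion).nonempty
  refine surjective_of_windsOnceAt hw.continuous hwz (fun y hy => hw.eq_of_apply_eq hz hy) ?_
  refine hw.noded.orientation id (Or.inl rfl) id (Or.inl rfl) z ⟨hz, hwz⟩
    ⟨{z : ℂ | (z : Sphere) ∈ coeffRegion μ} ∩ {z : ℂ | w z ≠ OnePoint.infty}, ?_, ?_⟩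
  · exact inter_mem ((hΩ.preimage OnePoint.continuous_coe).mem_nhds hz)
      ((hw.continuous.comp OnePoint.continuous_coe).continuousAt.eventually_ne hwz)
  · intro x hx y hy hxy
    have h1 := congrArg (fun z : ℂ => (z : Sphere)) hxy
    rw [coe_inCharts_id hx.2, coe_inCharts_id hy.2] at h1
    exact OnePoint.coe_injective (hw.injOn_coeffRegion hx.1 hy.1 h1)

end IsNodedDeformationAlong

/-! ### The limit group -/

/-- The matrix of a Möbius transformation can be normalized to have norm one. -/
lemma exists_normalized_matrix {A : Equiv.Perm Sphere} (hA : A ∈ moebiusGroup) :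
    ∃ e ∈ Metric.sphere (0 : Fin 4 → ℂ) 1,
      ∀ z : ℂ, A z = ofHomogeneous (e 0 * z + e 1, e 2 * z + e 3) := by
  obtain ⟨B, rfl⟩ := hA
  set q : Fin 4 → ℂ := ![B 0 0, B 0 1, B 1 0, B 1 1] with hq
  have hq0 : q ≠ 0 := fun h => by
    have h0 : (B 0 0 : ℂ) = 0 := congrFun h 0
    have h1 : (B 0 1 : ℂ) = 0 := congrFun h 1
    exact moebius_det B (by rw [h0, h1]; ring)
  have hn : ‖q‖ ≠ 0 := norm_ne_zero_iff.mpr hq0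
  have ht : ((‖q‖⁻¹ : ℝ) : ℂ) ≠ 0 := Complex.ofReal_ne_zero.mpr (inv_ne_zero hn)
  refine ⟨((‖q‖⁻¹ : ℝ) : ℂ) • q, ?_, fun z => ?_⟩
  · rw [mem_sphere_zero_iff_norm, norm_smul, Complex.norm_real, norm_inv, norm_norm,
      inv_mul_cancel₀ hn]
  · rw [MulAction.toPermHom_apply, MulAction.toPerm_apply, moebius_apply, ← ofHomogeneous_smul ht]
    simp only [Pi.smul_apply, smul_eq_mul, hq, Matrix.cons_val]
    ring_nf

lemma eq_mul_of_coe_eq_ofHomogeneous {η : ℂ} {p : ℂ × ℂ}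
    (h : (η : Sphere) = ofHomogeneous p) : η * p.2 = p.1 := by
  rw [ofHomogeneous] at h
  split_ifs at h with h2
  · exact absurd h (OnePoint.coe_ne_infty η)
  · rw [OnePoint.coe_injective h, div_mul_cancel₀ _ h2]

/-- When the determinant vanishes and `c ≠ 0`, the relation factors as `(c η - a)(c ζ + d) = 0`,
which injective functions satisfy at only finitely many points; the cases with `c = 0` force `ζ` or
`η` to be constant, or all coefficients to vanish. -/
lemma det_ne_zero_of_infinite {X : Type*} {Z : Set X} (hZ : Z.Infinite) {ζ η : X → ℂ}
    (hζ : Set.InjOn ζ Z) (hη : Set.InjOn η Z) {a b c d : ℂ}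
    (hne : ¬ (a = 0 ∧ b = 0 ∧ c = 0 ∧ d = 0))
    (h : ∀ x ∈ Z, η x * (c * ζ x + d) = a * ζ x + b) : a * d - b * c ≠ 0 := by
  intro hdet
  have hsub : ∀ {f : X → ℂ} (k : ℂ), Set.InjOn f Z → {x ∈ Z | f x = k}.Finite := fun k hf =>
    Set.Subsingleton.finite fun x hx y hy => hf hx.1 hy.1 (hx.2.trans hy.2.symm)
  by_cases hc : c = 0
  · by_cases hd : d = 0
    · by_cases ha : a = 0
      · obtain ⟨x, hx⟩ := hZ.nonempty
        have := h x hx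
        rw [hc, hd, ha] at this
        exact hne ⟨ha, by linear_combination -this, hc, hd⟩
      · refine hZ ((hsub (-b / a) hζ).subset fun x hx => ⟨hx, ?_⟩)
        have := h x hx
        rw [hc, hd] at this
        rw [eq_div_iff ha]
        linear_combination -this
    · have ha : a = 0 := by
        rw [hc] at hdet
        simpa [hd] using hdet
      refine hZ ((hsub (b / d) hη).subset fun x hx => ⟨hx, ?_⟩)
      have := h x hx
      rw [hc, ha] at this
      rw [eq_div_iff hd]
      linear_combination this
  · refine hZ (((hsub (a / c) hη).union (hsub (-d / c) hζ)).subset fun x hx => ?_)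
    have h1 : (η x * c - a) * (ζ x * c + d) = 0 := by
      linear_combination c * h x hx - hdet
    rcases mul_eq_zero.mp h1 with h2 | h2
    · exact Or.inl ⟨hx, by rw [eq_div_iff hc]; linear_combination h2⟩
    · exact Or.inr ⟨hx, by rw [eq_div_iff hc]; linear_combination h2⟩

namespace IsNodedDeformationAlong

variable {Δ : Set Sphere} {G : Subgroup (Equiv.Perm Sphere)} {μ : LInfSpace}
  {F : Set (Set Sphere)} {w : Sphere → Sphere}

/-- Möbius transformations are not compact, but their matrices scaled to norm one are relatively
compact, with possibly singular limits. Singularity is excluded because the limit relation holds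
between two injective functions on an infinite set. -/
theorem exists_moebius (hw : IsNodedDeformationAlong Δ G μ F w) (hG : G ≤ moebiusGroup)
    (hΔ : ∀ g ∈ G, g '' Δ = Δ) (hμ : μ ∈ LInf Δ G) {g : Equiv.Perm Sphere} (hg : g ∈ G) :
    ∃ A ∈ moebiusGroup, ∀ x, w (g x) = A (w x) := by
  obtain ⟨ν, v, hν, -, hqc, hv⟩ := hw.noded.approx
  have hpt : ∀ x ∈ coeffRegion μ, Tendsto (fun n => v n x) atTop (𝓝 (w x)) := fun x hx =>
    isClosedEmbedding_stereo.isEmbedding.tendsto_nhds_iff.mpr (hv.tendsto_at hx)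
  choose A hA hAv using fun n => conj_mem_moebiusGroup hG hΔ (hν n).1 (hqc n) hg
  choose e he heA using fun n => exists_normalized_matrix (hA n)
  obtain ⟨l, hl, φ, hφ, hel⟩ := (isCompact_sphere (0 : Fin 4 → ℂ) 1).tendsto_subseq he
  have hΩg : ∀ x ∈ coeffRegion μ, g x ∈ coeffRegion μ := fun x hx =>
    apply_mem_coeffRegion hG hΔ hμ hg hx
  have hi := hw.injOn_coeffRegion
  -- The finitely many points at which the relation cannot be written in affine coordinates.
  -- Removing them does not destroy density, because the sphere has no isolated points.
  set P : Set Sphere := {x | x ∈ coeffRegion μ ∧ w x = OnePoint.infty} ∪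
    {x | x ∈ coeffRegion μ ∧ w (g x) = OnePoint.infty} with hP
  have hPf : P.Finite := by
    refine Set.Finite.union (Set.Subsingleton.finite fun x hx y hy => ?_)
      (Set.Subsingleton.finite fun x hx y hy => ?_)
    · exact hi hx.1 hy.1 (hx.2.trans hy.2.symm)
    · exact g.injective (hi (hΩg x hx.1) (hΩg y hy.1) (hx.2.trans hy.2.symm))
  set Z := coeffRegion μ \ P with hZdef
  have hZd : Dense Z := hw.family.dense.sdiff_finite hPf
  have hZi : Z.Infinite := fun h => by
    have h1 := hZd.closure_eq
    rw [h.isClosed.closure_eq] at h1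
    exact Set.infinite_univ (h1 ▸ h)
  have hZ : ∀ x ∈ Z, w x ≠ OnePoint.infty ∧ w (g x) ≠ OnePoint.infty := fun x hx =>
    ⟨fun h => hx.2 (Or.inl ⟨hx.1, h⟩), fun h => hx.2 (Or.inr ⟨hx.1, h⟩)⟩
  have hrel : ∀ x ∈ Z, affine (w (g x)) * (l 2 * affine (w x) + l 3) =
      l 0 * affine (w x) + l 1 := fun x hx => by
    have hx1 := (hpt x hx.1).comp hφ.tendsto_atTop
    have hx2 := (hpt (g x) (hΩg x hx.1)).comp hφ.tendsto_atTop
    have t1 := (continuousAt_affine (hZ x hx).1).tendsto.comp hx1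
    have t2 := (continuousAt_affine (hZ x hx).2).tendsto.comp hx2
    have hl' := tendsto_pi_nhds.mp hel
    refine tendsto_nhds_unique_of_eventuallyEq (t2.mul (((hl' 2).mul t1).add (hl' 3)))
      (((hl' 0).mul t1).add (hl' 1)) ?_
    filter_upwards [hx1.eventually_ne (hZ x hx).1, hx2.eventually_ne (hZ x hx).2] with n h1 h2
    refine eq_mul_of_coe_eq_ofHomogeneous (p := (_, _)) ?_
    simp only [Function.comp] at h1 h2 ⊢
    rw [coe_affine h2, hAv, ← heA, coe_affine h1]
  have hdet := det_ne_zero_of_infinite hZi (ζ := fun x => affine (w x))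
    (η := fun x => affine (w (g x)))
    (fun x hx y hy hxy => hi hx.1 hy.1 (by
      rw [← coe_affine (hZ x hx).1, ← coe_affine (hZ y hy).1]
      exact congrArg _ hxy))
    (fun x hx y hy hxy => g.injective (hi (hΩg x hx.1) (hΩg y hy.1) (by
      rw [← coe_affine (hZ x hx).2, ← coe_affine (hZ y hy).2]
      exact congrArg _ hxy)))
    (a := l 0) (b := l 1) (c := l 2) (d := l 3) (by
      rintro ⟨h0, h1, h2, h3⟩
      have : l = 0 := by
        ext i
        fin_cases i <;> assumption
      rw [this, mem_sphere_zero_iff_norm, norm_zero] at hl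
      exact zero_ne_one hl) hrel
  obtain ⟨B, hB, hBz, -⟩ := mk_mem_moebiusGroup hdet
  refine ⟨B, hB, congrFun (Continuous.ext_on hZd
    (hw.continuous.comp (continuous_of_mem_moebiusGroup (hG hg)))
    ((continuous_of_mem_moebiusGroup hB).comp hw.continuous) fun x hx => ?_)⟩
  have h1 := hrel x hx
  -- If the denominator vanished, so would the numerator, and the matrix would have a nontrivial
  -- kernel.
  have hden : l 2 * affine (w x) + l 3 ≠ 0 := fun h => by
    rw [h, mul_zero] at h1
    exact hdet (by linear_combination l 0 * h + l 2 * h1)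
  change w (g x) = B (w x)
  rw [← coe_affine (hZ x hx).1, hBz, ofHomogeneous, if_neg hden, ← h1,
    mul_div_cancel_right₀ _ hden, coe_affine (hZ x hx).2]

end IsNodedDeformationAlong

/-! ### The region of discontinuity of the conjugated group -/

lemma isOpen_regionOfDiscontinuity (Γ : Subgroup (Equiv.Perm Sphere)) :
    IsOpen (regionOfDiscontinuity Γ) := by
  refine isOpen_iff_mem_nhds.mpr ?_
  rintro x ⟨U, hU, hx, h⟩
  exact mem_of_superset (hU.mem_nhds hx) fun y hy => ⟨U, hU, hy, h⟩

/-- The conjugate `z ↦ k z` moves `1` to the points `k ^ n`, whose moduli grow strictly. -/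
lemma IsLoxodromic.not_isOfFinOrder {g : Equiv.Perm Sphere} (hg : IsLoxodromic g) :
    ¬ IsOfFinOrder g := by
  obtain ⟨A, -, k, hk, hz⟩ := hg
  intro h
  obtain ⟨n, hn, hgn⟩ := isOfFinOrder_iff_pow_eq_one.mp h
  have hpow : ∀ m : ℕ, ((A * g * A⁻¹) ^ m) ((1 : ℂ) : Sphere) = ((k ^ m : ℂ) : Sphere) := by
    intro m
    induction m with
    | zero => simp
    | succ m ih => rw [pow_succ', Equiv.Perm.mul_apply, ih, hz, pow_succ']
  have h1 := hpow n
  rw [conj_pow, hgn, mul_one, mul_inv_cancel, Equiv.Perm.one_apply] at h1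
  have h2 := congrArg norm (OnePoint.coe_injective h1)
  rw [norm_one, norm_pow] at h2
  exact (one_lt_pow₀ hk hn.ne').ne h2

lemma IsCyclicLoxodromicOrExtension.infinite {H : Subgroup (Equiv.Perm Sphere)}
    (h : IsCyclicLoxodromicOrExtension H) : (H : Set (Equiv.Perm Sphere)).Infinite := by
  have key : ∀ C ≤ H, IsCyclicLoxodromic C → (H : Set (Equiv.Perm Sphere)).Infinite := by
    rintro C hC ⟨g, hg, rfl⟩ hfin
    exact hg.not_isOfFinOrder (finite_zpowers.mp (hfin.subset hC))
  rcases h with h | ⟨C, hC, h, -⟩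
  · exact key H le_rfl h
  · exact key C hC h

/-- A group isomorphism from `G` to a permutation group is determined by its values. -/
lemma sigma_mulEquiv_ext {X : Type*} {G : Subgroup (Equiv.Perm X)}
    {p q : (Γ : Subgroup (Equiv.Perm X)) × (G ≃* Γ)}
    (h : ∀ g : G, (p.2 g : Equiv.Perm X) = q.2 g) : p = q := by
  obtain ⟨Γ, θ⟩ := p
  obtain ⟨Γ', θ'⟩ := q
  simp only at h
  obtain rfl : Γ = Γ' := by
    ext γ
    constructor
    · intro hγ
      obtain ⟨g, hg⟩ := θ.surjective ⟨γ, hγ⟩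
      have h1 := h g
      rw [hg] at h1
      change γ = _ at h1
      rw [h1]
      exact (θ' g).2
    · intro hγ
      obtain ⟨g, hg⟩ := θ'.surjective ⟨γ, hγ⟩
      have h1 := h g
      rw [hg] at h1
      change _ = γ at h1
      rw [← h1]
      exact (θ g).2
  have : θ = θ' := MulEquiv.ext fun g => Subtype.ext (h g)
  rw [this]

namespace IsNodedDeformationAlong

variable {Δ : Set Sphere} {G : Subgroup (Equiv.Perm Sphere)} {μ : LInfSpace}
  {F : Set (Set Sphere)} {w : Sphere → Sphere}

/-- Fibres over the image of `Ω(μ)` are single points, so `g` fixes this dense set. This gives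
faithfulness of `θ`. -/
lemma eq_one_of_apply_eq (hw : IsNodedDeformationAlong Δ G μ F w) {g : Equiv.Perm Sphere}
    (hg : g ∈ moebiusGroup) (h : ∀ x, w (g x) = w x) : g = 1 := by
  have := Continuous.ext_on hw.family.dense (continuous_of_mem_moebiusGroup hg) continuous_id
    fun x hx => hw.eq_of_apply_eq hx (h x)
  exact Equiv.ext (congrFun this)

/-- The group to which a noded deformation conjugates `G`. -/
theorem exists_mulEquiv (hw : IsNodedDeformationAlong Δ G μ F w) (hG : G ≤ moebiusGroup)
    (hΔ : ∀ g ∈ G, g '' Δ = Δ) (hμ : μ ∈ LInf Δ G) :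
    ∃ (Γ : Subgroup (Equiv.Perm Sphere)) (θ : G ≃* Γ), Γ ≤ moebiusGroup ∧
      ∀ (g : G) (x : Sphere), w ((g : Equiv.Perm Sphere) x) = (θ g : Equiv.Perm Sphere) (w x) := by
  choose A hA hAw using fun g : G => hw.exists_moebius hG hΔ hμ g.2
  let Θ : G →* Equiv.Perm Sphere := MonoidHom.mk' A fun g h => by
    ext p
    -- Both sides are computed at a value of `w`; surjectivity is what makes the chosen
    -- transformations multiply correctly.
    obtain ⟨x, rfl⟩ := hw.surjective p
    rw [← hAw, Equiv.Perm.mul_apply, ← hAw, ← hAw]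
    rfl
  have hΘ : ∀ g, Θ g = A g := fun _ => rfl
  have hinj : Function.Injective Θ := by
    rw [injective_iff_map_eq_one]
    intro g hg
    refine Subtype.ext (hw.eq_one_of_apply_eq (hG g.2) fun x => ?_)
    rw [hAw, ← hΘ, hg, Equiv.Perm.one_apply]
  refine ⟨Θ.range, MonoidHom.ofInjective hinj, ?_, fun g x => hAw g x⟩
  rintro _ ⟨g, rfl⟩
  exact hA g

variable {Γ : Subgroup (Equiv.Perm Sphere)} {θ : G ≃* Γ}

/-- A good neighbourhood, cut down to `Ω(μ)`, has an image that is a neighbourhood of `w x`. Since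
fibres there are single points, a return of `θ g` to the image is a return of `g` to the original
set. -/
lemma image_subset_regionOfDiscontinuity (hw : IsNodedDeformationAlong Δ G μ F w)
    (hθ : ∀ (g : G) (x : Sphere),
      w ((g : Equiv.Perm Sphere) x) = (θ g : Equiv.Perm Sphere) (w x)) :
    w '' (coeffRegion μ ∩ regionOfDiscontinuity G) ⊆ regionOfDiscontinuity Γ := by
  rintro _ ⟨x, ⟨hxΩ, U, hU, hxU, hfin⟩, rfl⟩
  have hUΩ : U ∩ coeffRegion μ ∈ 𝓝 x :=
    inter_mem (hU.mem_nhds hxU) ((isOpen_coeffRegion μ).mem_nhds hxΩ)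
  refine ⟨interior (w '' (U ∩ coeffRegion μ)), isOpen_interior,
    mem_interior_iff_mem_nhds.mpr (hw.image_mem_nhds hxΩ hUΩ), ?_⟩
  refine ((hfin.preimage (f := fun g : G => (g : Equiv.Perm Sphere))
    Subtype.coe_injective.injOn).image fun g => (θ g : Equiv.Perm Sphere)).subset ?_
  rintro γ ⟨hγ, _, ⟨p, hp, rfl⟩, hγp⟩
  obtain ⟨g, hg⟩ := θ.surjective ⟨γ, hγ⟩
  have hgγ : (θ g : Equiv.Perm Sphere) = γ := congrArg Subtype.val hg
  obtain ⟨u, hu, rfl⟩ := interior_subset hp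
  obtain ⟨u', hu', huu'⟩ := interior_subset hγp
  rw [← hgγ, ← hθ] at huu'
  refine ⟨g, ⟨g.2, u', ⟨u, hu.1, ?_⟩, hu'.1⟩, hgγ⟩
  exact hw.eq_of_apply_eq hu'.2 huu'.symm

/-- The preimage under `w` of a good neighbourhood is good for `G`. That the preimage point lies in
`Ω(μ)` uses the collapsed arcs: each has an infinite stabilizer, incompatible with finitely many
returns. -/
lemma regionOfDiscontinuity_subset_image (hw : IsNodedDeformationAlong Δ G μ F w)
    (hθ : ∀ (g : G) (x : Sphere),
      w ((g : Equiv.Perm Sphere) x) = (θ g : Equiv.Perm Sphere) (w x)) :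
    regionOfDiscontinuity Γ ⊆ w '' (coeffRegion μ ∩ regionOfDiscontinuity G) := by
  rintro p ⟨V, hV, hpV, hfin⟩
  obtain ⟨y, rfl⟩ := hw.surjective p
  have hU : IsOpen (w ⁻¹' V) := hV.preimage hw.continuous
  have hfinG : {g | g ∈ G ∧ (g '' (w ⁻¹' V) ∩ w ⁻¹' V).Nonempty}.Finite := by
    refine ((hfin.preimage (f := fun g : G => (θ g : Equiv.Perm Sphere))
      (Subtype.coe_injective.comp θ.injective).injOn).image
        fun g : G => (g : Equiv.Perm Sphere)).subset ?_
    rintro g ⟨hg, _, ⟨u, hu, rfl⟩, hgu⟩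
    exact ⟨⟨g, hg⟩, ⟨(θ ⟨g, hg⟩).2, _, ⟨w u, hu, rfl⟩, (hθ ⟨g, hg⟩ u) ▸ hgu⟩, rfl⟩
  refine ⟨y, ⟨?_, w ⁻¹' V, hU, hpV, hfinG⟩, rfl⟩
  by_contra hy
  have hy' : y ∈ closure (⋃₀ F) := hw.family.limitSet ▸ hy
  obtain ⟨u, huV, α, hα, huα⟩ := mem_closure_iff.mp hy' _ hU hpV
  refine (hw.family.stabilizer α hα).infinite (hfinG.subset ?_)
  rintro g ⟨hg, hgα⟩
  have hgu : g u ∈ α := by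
    have h1 : g • α = α := hgα
    have h2 : g • u ∈ g • α := Set.smul_mem_smul_set huα
    rwa [h1] at h2
  -- Although `g u` may be far from `u` on the arc, `w` takes the same value at both, so `g u` is
  -- again in the preimage of `V`.
  refine ⟨hg, g u, ⟨u, huV, rfl⟩, ?_⟩
  rw [Set.mem_preimage, hw.const α hα (g u) hgu u huα]
  exact huV

end IsNodedDeformationAlong

end NodedQC

theorem theorem1 (G : Subgroup (Equiv.Perm NodedQC.Sphere)) (hG : NodedQC.IsKleinian G)
    (hfg : G.FG) (Δ : Set NodedQC.Sphere) (hΔ : NodedQC.IsInvariantCollection G Δ)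
    (μ : NodedQC.LInfSpace) (hμ : μ ∈ NodedQC.nodedBeltrami Δ G)
    (w : NodedQC.Sphere → NodedQC.Sphere) (hw : NodedQC.IsNodedDeformation Δ G μ w) :
    (∃! p : (Γ : Subgroup (Equiv.Perm NodedQC.Sphere)) × (G ≃* Γ),
      NodedQC.IsKleinian p.1 ∧
        ∀ g : G, w ∘ (g : Equiv.Perm NodedQC.Sphere) =
          (p.2 g : Equiv.Perm NodedQC.Sphere) ∘ w) ∧
    ∀ (Γ : Subgroup (Equiv.Perm NodedQC.Sphere)) (θ : G ≃* Γ),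
      NodedQC.IsKleinian Γ →
      (∀ g : G, w ∘ (g : Equiv.Perm NodedQC.Sphere) =
        (θ g : Equiv.Perm NodedQC.Sphere) ∘ w) →
      NodedQC.regionOfDiscontinuity Γ =
        w '' (NodedQC.coeffRegion μ ∩ NodedQC.regionOfDiscontinuity G) := by
  obtain ⟨F, hwF⟩ := hw
  refine ⟨?_, fun Γ θ _ hθ => Set.Subset.antisymm
    (hwF.regionOfDiscontinuity_subset_image fun g x => congrFun (hθ g) x)
    (hwF.image_subset_regionOfDiscontinuity fun g x => congrFun (hθ g) x)⟩
  obtain ⟨Γ, θ, hΓ, hθ⟩ := hwF.exists_mulEquiv hG.1 hΔ.invariant hμ.1.1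
  -- Density of `Ω(μ)` makes `Ω(μ) ∩ Ω(G)` nonempty, and its image consists of points of
  -- discontinuity; hence the new group is Kleinian.
  obtain ⟨x, hx⟩ := hwF.family.dense.inter_open_nonempty _
    (NodedQC.isOpen_regionOfDiscontinuity G) hG.2
  refine ⟨⟨Γ, θ⟩, ⟨⟨hΓ, w x, hwF.image_subset_regionOfDiscontinuity hθ ⟨x, hx.symm, rfl⟩⟩,
    fun g => funext fun x => hθ g x⟩, ?_⟩
  rintro ⟨Γ', θ'⟩ ⟨-, hθ'⟩
  refine NodedQC.sigma_mulEquiv_ext fun g => Equiv.ext fun p => ?_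
  -- Since `w` is onto, the intertwining relation determines every value of `θ g`.
  obtain ⟨y, rfl⟩ := hwF.surjective p
  rw [← hθ]
  exact (congrFun (hθ' g) y).symm
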